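/- **Setting.** Positions of a string $w\in\Sigma^n$ ($\Sigma$ finite) are $1,\dots,n$. $\mathsf{FO}+\mathsf M^2$ formulas are built from indices (the constants $1$ and $n=|w|$, and variables ranging over positions) by the atoms $Q_\sigma(i)$ ("the $i$-th token is $\sigma$"), $i=j$, $i\le j$, $i\ge j$, by $\neg,\wedge,\vee$, by $\exists i$, $\forall i$, and by the paired majority quantifier $\mathsf M^2(i,j).P$ ("$P$ holds for more than half of the $n^2$ pairs $(i,j)\in[n]^2$"). The nesting depth is the depth of the syntax tree (indices are leaves, of depth $1$). An AHAT has rational parameters and acts in exact real arithmetic on the sequence consisting of a beginning-of-sequence token, $w$, and padding tokens. Each layer is a self-attention sublayer followed by a feedforward sublayer. Each sublayer reads $z_i=\mathsf{layer\_norm}(Mh_i)$ for a matrix $M$ and adds its output to the residual stream $h_i$; layer-norm is standard layer-norm or RMS norm (with $0\mapsto 0$). Each attention head returns the uniform average of the values at the visible positions of maximal score $q_i^\top k_j$. The feedforward sublayer outputs $U\,\mathrm{ReLU}(Wz_i)$. The output in $\{0,1\}$ at a token is the argmax of a linear head with two logits. The depth is the number of layers. An unmasked AHAT sees all positions and has position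 encoding $1/i$; a causally masked AHAT sees only the positions $j\le i$ and has no position encoding. **Lemma.** There is an absolute constant $C$, and for every $k\ge 1$ a constant $c_k$, such that for either kind of layer-norm, every finite alphabet $\Sigma$, and every $\mathsf{FO}+\mathsf M^2$ formula $P$ over $\Sigma$ with (at most) $k$ distinct variables $x_0,\dots,x_{k-1}$ and nesting depth $\ell$: 1. There is an unmasked AHAT of fixed depth at most $C\ell+c_k$ which, run on $w\in\Sigma^n$ (any $n\ge0$) with exactly $n^k$ padding tokens, computes $P$: each padding token stores one assignment of the $k$ variables, in the sense that for every $v\in\{0,\dots,n-1\}^k$ the output at the padding token number $\sum_i v_i n^i$ (counting from $0$) is the truth value of $P$ on $w$ under the assignment $x_i\mapsto v_i+1$. If $P$ is a sentence, the output at the last token is $1$ if and only if $w$ belongs to the language defined by $P$. 2. There are a number $K\ge1$ (depending on $P$) and a causally masked AHAT of fixed depth at most $C\ell+c_k$ which does the same with $Kn^k$ padding tokens, the $n^k$ assignments being stored in this order in the last $n^k$ of them. If $P$ is a sentence, the output at the last token is $1$ if and only if $w$ belongs to the language defined by $P$. In particular, the language defined by a sentence with $k\ge1$ variables is in $\mathsf{uAHAT}^0_k$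 and in $\mathsf{AHAT}^0_k$. -/

import Mathlib

universe u

noncomputable section

namespace PaddedAHAT

/-! ### First-order logic with paired majority over strings -/

/-- Index terms over `k` variable names: the constants `1` and `n`, and variables. -/
inductive Index (k : ℕ) : Type
  | one : Index k
  | last : Index k
  | var (i : Fin k) : Index k

/-- Value of an index on a string of length `n`; positions are numbered `1, …, n`. -/
def Index.val {k : ℕ} (n : ℕ) (v : Fin k → ℕ) : Index k → ℕ
  | .one => 1
  | .last => n
  | .var i => v i

/-- The variables occurring in an index. -/
def Index.vars {k : ℕ} : Index k → Finset (Fin k)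
  | .one => ∅
  | .last => ∅
  | .var i => {i}

/-- `FO + M²` formulas over the alphabet `α` with variable names among `k` names. -/
inductive Formula (α : Type u) (k : ℕ) : Type u
  | sym (a : α) (s : Index k) : Formula α k
  | eq (s t : Index k) : Formula α k
  | le (s t : Index k) : Formula α k
  | ge (s t : Index k) : Formula α k
  | neg (P : Formula α k) : Formula α k
  | and (P Q : Formula α k) : Formula α k
  | or (P Q : Formula α k) : Formula α k
  | ex (i : Fin k) (P : Formula α k) : Formula α k
  | all (i : Fin k) (P : Formula α k) : Formula α k
  | maj (i j : Fin k) (P : Formula α k) : Formula α k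

namespace Formula

variable {α : Type u} {k : ℕ}

open Classical in
/-- Truth of a formula on the string `w` under the assignment `v`.  Quantifiers range over the
positions `1, …, |w|`; `maj i j P` says that more than half of the `|w|²` pairs of values for
`(i, j)` satisfy `P`. -/
def Holds (w : List α) : Formula α k → (Fin k → ℕ) → Prop
  | .sym a s, v => 1 ≤ s.val w.length v ∧ w[s.val w.length v - 1]? = some a
  | .eq s t, v => s.val w.length v = t.val w.length v
  | .le s t, v => s.val w.length v ≤ t.val w.length v
  | .ge s t, v => t.val w.length v ≤ s.val w.length v
  | .neg P, v => ¬ Holds w P v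
  | .and P Q, v => Holds w P v ∧ Holds w Q v
  | .or P Q, v => Holds w P v ∨ Holds w Q v
  | .ex i P, v => ∃ m ∈ Finset.Icc 1 w.length, Holds w P (Function.update v i m)
  | .all i P, v => ∀ m ∈ Finset.Icc 1 w.length, Holds w P (Function.update v i m)
  | .maj i j P, v =>
      w.length ^ 2 < 2 * ((Finset.Icc 1 w.length ×ˢ Finset.Icc 1 w.length).filter
        (fun m => Holds w P (Function.update (Function.update v i m.1) j m.2))).card

/-- Nesting depth: the number of levels of the syntax tree, whose leaves are the indices. -/
def depth : Formula α k → ℕ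
  | .sym _ _ => 2
  | .eq _ _ => 2
  | .le _ _ => 2
  | .ge _ _ => 2
  | .neg P => P.depth + 1
  | .and P Q => max P.depth Q.depth + 1
  | .or P Q => max P.depth Q.depth + 1
  | .ex _ P => P.depth + 1
  | .all _ P => P.depth + 1
  | .maj _ _ P => P.depth + 1

/-- The free variables of a formula. -/
def freeVars : Formula α k → Finset (Fin k)
  | .sym _ s => s.vars
  | .eq s t => s.vars ∪ t.vars
  | .le s t => s.vars ∪ t.vars
  | .ge s t => s.vars ∪ t.vars
  | .neg P => P.freeVars
  | .and P Q => P.freeVars ∪ Q.freeVars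
  | .or P Q => P.freeVars ∪ Q.freeVars
  | .ex i P => P.freeVars.erase i
  | .all i P => P.freeVars.erase i
  | .maj i j P => (P.freeVars.erase i).erase j

/-- A sentence is a formula without free variables. -/
def IsSentence (P : Formula α k) : Prop := P.freeVars = ∅

/-- The language defined by a sentence (for a sentence the assignment is irrelevant). -/
def language (P : Formula α k) : Language α := {w | ∀ v : Fin k → ℕ, P.Holds w v}

end Formula

/-! ### Averaging-hard-attention transformers -/

/-- Input symbols, the beginning-of-sequence token, and the blank padding token. -/
inductive Token (α : Type u) : Type u
  | bos : Token α
  | sym (a : α) : Token α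
  | pad : Token α

/-- The token at (0-based) position `i` of the string consisting of the beginning-of-sequence
token, then `w`, then padding. -/
def tokenAt {α : Type u} (w : List α) (i : ℕ) : Token α :=
  (Token.bos :: w.map Token.sym).getD i Token.pad

/-- Unmasked transformers have the position encoding `1/i`; causally masked ones have none. -/
inductive Masking : Type
  | unmasked
  | causal

/-- The positions (0-based) that position `i` may attend to in a sequence of length `N`. -/
def Masking.visible : Masking → ℕ → ℕ → Finset ℕ
  | .unmasked, N, _ => Finset.range N
  | .causal, _, i => Finset.range (i + 1)

/-- The scalar position encoding at 0-based position `i`, i.e. at the `(i+1)`-st token. -/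
def Masking.posEnc : Masking → ℕ → ℝ
  | .unmasked, i => 1 / ((i : ℝ) + 1)
  | .causal, _ => 0

/-- The two kinds of layer normalization. -/
inductive NormKind : Type
  | standard
  | rms

/-- Layer-norm, as either standard layer-norm or RMS norm.  A vector whose denominator vanishes
is sent to `0`. -/
def NormKind.apply {d : ℕ} : NormKind → (Fin d → ℝ) → (Fin d → ℝ)
  | .standard, x => fun r =>
      (x r - (∑ c, x c) / d) / Real.sqrt ((∑ c, (x c - (∑ c', x c') / d) ^ 2) / d)
  | .rms, x => fun r => x r / Real.sqrt ((∑ c, x c ^ 2) / d)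

/-- A rational matrix acting on a real vector. -/
def act {m n : Type} [Fintype n] (A : Matrix m n ℚ) (x : n → ℝ) : m → ℝ :=
  (A.map (fun q : ℚ => (q : ℝ))).mulVec x

open Classical in
/-- The positions in `S` with maximal score. -/
def argmaxSet (S : Finset ℕ) (score : ℕ → ℝ) : Finset ℕ :=
  S.filter (fun j => ∀ j' ∈ S, score j' ≤ score j)

/-- Averaging hard attention: the uniform average of the values at the positions of maximal
score, which is the zero-temperature limit of softmax attention. -/
def hardAttention {e : ℕ} (S : Finset ℕ) (score : ℕ → ℝ) (value : ℕ → Fin e → ℝ) : Fin e → ℝ :=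
  fun r => (∑ j ∈ argmaxSet S score, value j r) / ((argmaxSet S score).card : ℝ)

/-- A self-attention sublayer of width `d`: pre-norm matrix, heads, output projection. -/
structure AttentionSublayer (d : ℕ) : Type where
  mask : Matrix (Fin d) (Fin d) ℚ
  heads : ℕ
  headDim : ℕ
  width_eq : heads * headDim = d
  query : Fin heads → Matrix (Fin headDim) (Fin d) ℚ
  key : Fin heads → Matrix (Fin headDim) (Fin d) ℚ
  value : Fin heads → Matrix (Fin headDim) (Fin d) ℚ
  out : Matrix (Fin d) (Fin heads × Fin headDim) ℚ

/-- A feedforward sublayer of width `d`. -/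
structure FeedforwardSublayer (d : ℕ) : Type where
  mask : Matrix (Fin d) (Fin d) ℚ
  hidden : ℕ
  inner : Matrix (Fin hidden) (Fin d) ℚ
  outer : Matrix (Fin d) (Fin hidden) ℚ

/-- The update of the residual stream `h` (a vector at every position) by an attention sublayer,
on a sequence of length `N`. -/
def AttentionSublayer.apply {d : ℕ} (A : AttentionSublayer d) (norm : NormKind)
    (mk : Masking) (N : ℕ) (h : ℕ → Fin d → ℝ) : ℕ → Fin d → ℝ :=
  let z : ℕ → Fin d → ℝ := fun i => norm.apply (act A.mask (h i))
  fun i => h i + act A.out (fun p : Fin A.heads × Fin A.headDim =>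
    hardAttention (mk.visible N i)
      (fun j => act (A.query p.1) (z i) ⬝ᵥ act (A.key p.1) (z j))
      (fun j => act (A.value p.1) (z j)) p.2)

/-- The update of the residual stream by a feedforward sublayer. -/
def FeedforwardSublayer.apply {d : ℕ} (F : FeedforwardSublayer d) (norm : NormKind)
    (h : ℕ → Fin d → ℝ) : ℕ → Fin d → ℝ :=
  fun i => h i + act F.outer
    (fun r => max 0 (act F.inner (norm.apply (act F.mask (h i))) r))

/-- A transformer layer: a self-attention sublayer followed by a feedforward sublayer. -/
structure Layer (d : ℕ) : Type where
  attn : AttentionSublayer d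
  ff : FeedforwardSublayer d

def Layer.apply {d : ℕ} (L : Layer d) (norm : NormKind) (mk : Masking) (N : ℕ)
    (h : ℕ → Fin d → ℝ) : ℕ → Fin d → ℝ :=
  L.ff.apply norm (L.attn.apply norm mk N h)

/-- A fixed-depth transformer over the alphabet `α`: token embedding, direction in which the
position encoding is added (if there is one), layers, and a linear output head with two logits. -/
structure Transformer (α : Type u) : Type u where
  width : ℕ
  embed : Token α → Fin width → ℚ
  pos : Fin width → ℚ
  layers : List (Layer width)
  head : Bool → Fin width → ℚ

namespace Transformer

variable {α : Type u}

/-- The number of layers. -/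
def depth (T : Transformer α) : ℕ := T.layers.length

/-- The residual stream before the first layer. -/
def initial (T : Transformer α) (mk : Masking) (w : List α) : ℕ → Fin T.width → ℝ :=
  fun i r => (T.embed (tokenAt w i) r : ℝ) + mk.posEnc i * (T.pos r : ℝ)

/-- The residual stream after the last layer, on the input `w` preceded by the
beginning-of-sequence token and followed by `p` padding tokens (`1 + |w| + p` tokens in all). -/
def final (T : Transformer α) (norm : NormKind) (mk : Masking) (w : List α) (p : ℕ) :
    ℕ → Fin T.width → ℝ :=
  T.layers.foldl (fun h L => L.apply norm mk (1 + w.length + p) h) (T.initial mk w)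

/-- The output logits at position `i`. -/
def logit (T : Transformer α) (norm : NormKind) (mk : Masking) (w : List α) (p i : ℕ)
    (b : Bool) : ℝ :=
  ∑ r, (T.head b r : ℝ) * T.final norm mk w p i r

/-- The output at position `i` (the unique argmax of the logits) is the truth value of `φ`. -/
def OutputsAt (T : Transformer α) (norm : NormKind) (mk : Masking) (w : List α) (p i : ℕ)
    (φ : Prop) : Prop :=
  (φ → T.logit norm mk w p i false < T.logit norm mk w p i true) ∧
  (¬ φ → T.logit norm mk w p i true < T.logit norm mk w p i false)

/-- With `p n` padding tokens on inputs of length `n`, the `n ^ k` padding tokens that follow the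
first `s n` padding tokens store the values of `P` under all assignments: the one with number
`∑ i, v i * n ^ i` stores the value of `P` under the assignment `i ↦ v i + 1`, for every
`v : Fin k → {0, …, n - 1}`. -/
def ComputesFormula {k : ℕ} (T : Transformer α) (norm : NormKind) (mk : Masking)
    (p s : ℕ → ℕ) (P : Formula α k) : Prop :=
  ∀ (w : List α) (v : Fin k → Fin w.length),
    T.OutputsAt norm mk w (p w.length)
      (1 + w.length + s w.length + (finFunctionFinEquiv v : Fin (w.length ^ k)).val)
      (P.Holds w (fun i => (v i : ℕ) + 1))

/-- With `p n` padding tokens on inputs of length `n`, the output at the last token tells whether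
the input is in `L`. -/
def Recognizes (T : Transformer α) (norm : NormKind) (mk : Masking) (p : ℕ → ℕ)
    (L : Language α) : Prop :=
  ∀ w : List α, T.OutputsAt norm mk w (p w.length) (w.length + p w.length) (w ∈ L)

end Transformer

end PaddedAHAT

end

/-!
The transformer stores one assignment of the `k` variables per padding token and evaluates all
subformulas of `P` for all assignments simultaneously, one level of the syntax tree after the other.
With causal masking the `n ^ k` assignments are repeated in `P.depth + 1` consecutive blocks, and
each block reads the values of the immediate subformulas in the block before it, which is completely
visible; without masking one block suffices.

**Residual streams as vector spaces of features.**  A `Feature` is a real number attached to every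
token of every run.  `Reach norm mk p t S` says that some `t` layers make exactly the features in
the rational space `S` linearly readable, and each building block enlarges `S`.  Both kinds of
layer-norm are brought to the same form: a vector that is written four times, with the signs
`1, 1, -1, -1`, has mean zero, and in a stream whose width is a perfect square its layer-norm is a
rational multiple of its Euclidean normalization (`NormKind.apply_place_balance`).  Queries, keys
and values are taken from families of features of constant norm (`Normable`), on which
normalization is harmless.

**The assignment of a padding token.** Padding token number `a` has to find the `k` lowest digits
of `a` in base `n`, and the number `⌊a / n ^ k⌋` of its block. From `1 / i` (which a causally
masked transformer obtains by attending uniformly to all tokens and reading off the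
beginning-of-sequence token) and `1 / (n + 1)` one gets, through normalizations of pairs of
features, approximations of `c a` and `c n a`, where the scale `c` is tiny and common to all
padding tokens (`exists_reach_scaled`). A pair `(x, 1)` has direction `(x, 1) / √(x² + 1)`, and the
inner product of two such directions is largest when they coincide. Since `x = ⌊q / n⌋` is the
number for which `n x` is nearest to `q - (n - 1) / 2`, attention finds the padding token with
number `⌊q / n⌋`; this gives all quotients `⌊a / n ^ r⌋` (`Reach.divide`, `Reach.quotients`) up to
small errors, and hence the digits. Attention once more, to the token whose number is nearest to
such a digit, replaces the approximation by an exact code and reads the symbol at that position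
(`Reach.lookup`). The codes are equal exactly if the numbers are, and they are ordered like the
numbers.

**One level.** A head whose queries and keys are the codes of the variables other than those bound
by the outermost connective, and of the block number, averages the truth value of an immediate
subformula over exactly the assignments that matter (`Assigned.attnFeature_eq`). For a quantifier
this average is the proportion of pairs of values that satisfy the subformula, a multiple of `1 /
n²`, and for a Boolean connective it is the truth value itself. Whether the formula holds is
decided by comparing a rational number computed from the averages with a threshold
(`Assigned.score_pos_iff`). The threshold is shifted by an irrational number smaller than `1 / (2
n²)` (`offset`), so that there are no ties and the comparison can be done by attention to the
beginning-of-sequence token (`Reach.threshold`). This takes three layers per level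
(`Assigned.exists_reach_evaluates`).
-/

noncomputable section

namespace PaddedAHAT

open Function

/-! ### Realizing features in a residual stream -/

section Realization

/-- A real-valued quantity attached to every token of the run on every input. -/
abbrev Feature (α : Type u) : Type u := List α → ℕ → ℝ

/-- The vector `x` divided by its Euclidean norm (and `0` if `x = 0`). -/
def unitVec {κ : Type*} [Fintype κ] (x : κ → ℝ) : κ → ℝ :=
  fun y => x y / Real.sqrt (∑ y', x y' ^ 2)

/-- The matrix `X` with its rows placed at the indices `a` and its columns at the indices `b`. -/
def liftMat {A B m n : Type*} [Fintype A] [Fintype B] [DecidableEq m] [DecidableEq n]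
    (a : A → m) (b : B → n) (X : A → B → ℚ) : Matrix m n ℚ :=
  fun r c => ∑ x, ∑ y, if a x = r ∧ b y = c then X x y else 0

/-- The vector `f` with its entries placed at the indices `e`. -/
def place {A m : Type*} [Fintype A] [DecidableEq m] (e : A → m) (f : A → ℝ) : m → ℝ :=
  fun r => ∑ x, if e x = r then f x else 0

lemma place_apply {A m : Type*} [Fintype A] [DecidableEq m] {e : A → m} (he : Injective e)
    (f : A → ℝ) (x : A) : place e f (e x) = f x := by
  classical
  simp [place, he.eq_iff]

lemma place_of_notMem {A m : Type*} [Fintype A] [DecidableEq m] {e : A → m}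
    (f : A → ℝ) {r : m} (hr : r ∉ Set.range e) : place e f r = 0 := by
  apply Finset.sum_eq_zero
  intro x _
  rw [if_neg]
  rintro rfl
  exact hr ⟨x, rfl⟩

lemma act_liftMat {A B : Type*} {m n : Type} [Fintype A] [Fintype B] [Fintype n] [DecidableEq m]
    [DecidableEq n] (a : A → m) (b : B → n) (X : A → B → ℚ) (h : n → ℝ) :
    act (liftMat a b X) h = place a (fun x => ∑ y, (X x y : ℝ) * h (b y)) := by
  funext r
  simp only [act, Matrix.mulVec, dotProduct, Matrix.map_apply, liftMat, place, Rat.cast_sum,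
    Finset.sum_mul]
  rw [Finset.sum_comm]
  refine Finset.sum_congr rfl fun x _ => ?_
  rw [Finset.sum_comm]
  by_cases hx : a x = r
  · simp only [hx, true_and, if_true]
    refine Finset.sum_congr rfl fun y _ => ?_
    rw [Finset.sum_eq_single (b y)]
    · simp
    · intro c _ hc
      rw [if_neg (Ne.symm hc)]
      simp
    · simp
  · simp [hx]

lemma act_zero {m n : Type} [Fintype n] (h : n → ℝ) : act (0 : Matrix m n ℚ) h = 0 := by
  funext r
  simp [act, Matrix.mulVec, dotProduct]

lemma sum_place_comp {A m : Type*} [Fintype A] [Fintype m] [DecidableEq m] {e : A → m}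
    (he : Injective e) (f : A → ℝ) (G : m → ℝ → ℝ) (hG : ∀ r, G r 0 = 0) :
    ∑ r, G r (place e f r) = ∑ x, G (e x) (f x) := by
  classical
  refine (Finset.sum_of_injOn e he.injOn (by simp) ?_ ?_).symm
  · intro r _ hr
    rw [place_of_notMem f (by simpa using hr), hG]
  · intro x _
    rw [place_apply he]

/-- The signs with which each coordinate is repeated, so that the mean vanishes. -/
def balance : Fin 4 → ℚ := ![1, 1, -1, -1]

/-- Writing a vector with the four signs `1, 1, -1, -1` into a stream whose width is a perfect
square makes both kinds of layer-norm a rational multiple of Euclidean normalization. -/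
lemma NormKind.apply_place_balance {κ : Type*} [Fintype κ] {D : ℕ}
    {c : κ × Fin 4 → Fin (D * D)} (hc : Injective c) (g : κ → ℝ) (norm : NormKind) (y : κ) :
    norm.apply (place c (fun q => (balance q.2 : ℝ) * g q.1)) (c (y, 0)) =
      (D : ℝ) / 2 * unitVec g y := by
  classical
  set x := place c (fun q => (balance q.2 : ℝ) * g q.1) with hx
  have hsum : ∑ r, x r = 0 := by
    rw [hx, sum_place_comp hc _ (fun _ t => t) (fun _ => rfl), Fintype.sum_prod_type]
    refine Finset.sum_eq_zero fun z _ => ?_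
    simp [Fin.sum_univ_four, balance]
  have hsq : ∑ r, x r ^ 2 = 4 * ∑ z, g z ^ 2 := by
    rw [hx, sum_place_comp hc _ (fun _ t => t ^ 2) (fun _ => by simp), Fintype.sum_prod_type,
      Finset.mul_sum]
    refine Finset.sum_congr rfl fun z _ => ?_
    simp [Fin.sum_univ_four, balance]
    ring
  have hxy : x (c (y, 0)) = g y := by
    rw [hx, place_apply hc]
    simp [balance]
  have key : g y / Real.sqrt ((4 * ∑ z, g z ^ 2) / ((D * D : ℕ) : ℝ)) =
      (D : ℝ) / 2 * unitVec g y := by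
    have h4 : (4 * ∑ z, g z ^ 2) / ((D * D : ℕ) : ℝ) = (2 / (D : ℝ)) ^ 2 * ∑ z, g z ^ 2 := by
      push_cast
      ring
    rw [h4, Real.sqrt_mul (sq_nonneg _), Real.sqrt_sq (by positivity), unitVec]
    rw [div_mul_eq_div_div, div_div_eq_mul_div]
    ring
  cases norm with
  | standard =>
    simp only [NormKind.apply, hsum, zero_div, sub_zero, hsq, hxy]
    exact key
  | rms =>
    simp only [NormKind.apply, hsq, hxy]
    exact key

variable {α : Type u}

/-- The number of tokens on the input `w`, with `p n` padding tokens on inputs of length `n`. -/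
def seqLen (p : ℕ → ℕ) (w : List α) : ℕ := 1 + w.length + p w.length

/-- The features `F` are, in every large enough perfect-square width and at every prescribed
choice of coordinates, the content of the residual stream of a transformer after `t` layers, all
other coordinates being `0`.  Quantifying over the width and over the coordinates leaves room for
further features without any change to the layers already built. -/
def Realizable (norm : NormKind) (mk : Masking) (p : ℕ → ℕ) (t : ℕ) {ι : Type*} [Fintype ι]
    (F : ι → Feature α) : Prop :=
  ∃ D₀ : ℕ, ∀ D, D₀ ≤ D → ∀ e : ι → Fin (D * D), Injective e →
    ∃ (embed : Token α → Fin (D * D) → ℚ) (pos : Fin (D * D) → ℚ)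
      (layers : List (Layer (D * D))), layers.length = t ∧ ∀ w i,
        layers.foldl (fun h L => L.apply norm mk (seqLen p w) h)
          (fun i r => (embed (tokenAt w i) r : ℝ) + mk.posEnc i * (pos r : ℝ)) i =
        place e (fun x => F x w i)

/-- The hard attention feature with queries `q`, keys `k` and value `v`. -/
def attnFeature (mk : Masking) (p : ℕ → ℕ) {Λ : Type*} [Fintype Λ] (q k : Λ → Feature α)
    (v : Feature α) : Feature α :=
  fun w i => (∑ j ∈ argmaxSet (mk.visible (seqLen p w) i) (fun j => ∑ l, q l w i * k l w j),
      v w j) /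
    ((argmaxSet (mk.visible (seqLen p w) i) (fun j => ∑ l, q l w i * k l w j)).card : ℝ)

/-- A matrix of rational coefficients acting on a family of features. -/
def combine {A B : Type*} [Fintype B] (X : A → B → ℚ) (F : B → Feature α) : A → Feature α :=
  fun x w i => ∑ y, (X x y : ℝ) * F y w i

/-- Tokenwise normalization of a family of features. -/
def unitFeature {κ : Type*} [Fintype κ] (g : κ → Feature α) : κ → Feature α :=
  fun y w i => unitVec (fun y' => g y' w i) y

variable {norm : NormKind} {mk : Masking} {p : ℕ → ℕ} {t : ℕ}

lemma exists_injective_fin {A : Type*} [Fintype A] {D : ℕ} (h : Fintype.card A ≤ D) :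
    ∃ f : A → Fin D, Injective f := by
  obtain ⟨f⟩ := Function.Embedding.nonempty_of_card_le (α := A) (β := Fin D) (by simpa using h)
  exact ⟨f, f.injective⟩

/-- The attention sublayer without effect. -/
def AttentionSublayer.idle (D : ℕ) : AttentionSublayer (D * D) where
  mask := 0
  heads := D
  headDim := D
  width_eq := rfl
  query := 0
  key := 0
  value := 0
  out := 0

/-- The feedforward sublayer without effect. -/
def FeedforwardSublayer.idle (d : ℕ) : FeedforwardSublayer d where
  mask := 0
  hidden := 0
  inner := 0
  outer := 0

lemma AttentionSublayer.apply_idle {D N : ℕ} (h : ℕ → Fin (D * D) → ℝ) :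
    (AttentionSublayer.idle D).apply norm mk N h = h := by
  funext i
  exact (congrArg (h i + ·) (act_zero _)).trans (add_zero _)

lemma FeedforwardSublayer.apply_idle {d : ℕ} (h : ℕ → Fin d → ℝ) :
    (FeedforwardSublayer.idle d).apply norm h = h := by
  funext i
  exact (congrArg (h i + ·) (act_zero _)).trans (add_zero _)

lemma place_sumElim {A B m : Type*} [Fintype A] [Fintype B] [DecidableEq m] (e : A ⊕ B → m)
    (f : A → ℝ) (g : B → ℝ) :
    place e (Sum.elim f g) = place (e ∘ Sum.inl) f + place (e ∘ Sum.inr) g := by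
  funext r
  simp [place]

/-- One feedforward sublayer adds features `ReLU (W z)`, where `z` is the normalization of
linear combinations of the old ones. -/
lemma Realizable.feedforward {ι κ χ : Type*} [Fintype ι] [Fintype κ] [Fintype χ]
    {F : ι → Feature α} (hF : Realizable norm mk p t F) (M : κ → ι → ℚ) (W : χ → κ → ℚ) :
    Realizable norm mk p (t + 1) (Sum.elim F (fun x w i =>
      max 0 (combine W (unitFeature (combine M F)) x w i))) := by
  classical
  obtain ⟨D₀, hD₀⟩ := hF
  refine ⟨D₀ + 4 * Fintype.card κ + 1, fun D hD e he => ?_⟩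
  obtain ⟨embed, pos, layers, hlen, hrun⟩ := hD₀ D (by omega) (e ∘ Sum.inl)
    (he.comp Sum.inl_injective)
  obtain ⟨c, hc⟩ := exists_injective_fin (A := κ × Fin 4) (D := D * D) (by
    rw [Fintype.card_prod, Fintype.card_fin]
    nlinarith)
  have hD1 : (D : ℝ) ≠ 0 := by
    have : D ≠ 0 := by omega
    exact_mod_cast this
  let ff : FeedforwardSublayer (D * D) :=
    { mask := liftMat c (e ∘ Sum.inl) (fun q x => balance q.2 * M q.1 x)
      hidden := Fintype.card χ
      inner := liftMat (Fintype.equivFin χ) (fun y => c (y, 0)) (fun x y => 2 / D * W x y)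
      outer := liftMat (e ∘ Sum.inr) (Fintype.equivFin χ) (fun x y => if x = y then 1 else 0) }
  refine ⟨embed, pos, layers ++ [⟨AttentionSublayer.idle D, ff⟩], by simp [hlen], fun w i => ?_⟩
  rw [List.foldl_append, funext (hrun w), List.foldl_cons, List.foldl_nil]
  simp only [Layer.apply, AttentionSublayer.apply_idle, FeedforwardSublayer.apply]
  have hmask : act ff.mask (place (e ∘ Sum.inl) fun x => F x w i) =
      place c (fun q => (balance q.2 : ℝ) * combine M F q.1 w i) := by
    simp only [ff, act_liftMat]
    congr 1
    funext q
    simp only [combine, Finset.mul_sum]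
    refine Finset.sum_congr rfl fun x _ => ?_
    rw [place_apply (he.comp Sum.inl_injective)]
    push_cast
    ring
  rw [hmask]
  have hsplit : (fun x : ι ⊕ χ => (Sum.elim F (fun x w i =>
      max 0 (combine W (unitFeature (combine M F)) x w i)) x : Feature α) w i) =
      Sum.elim (fun x => F x w i)
        (fun x => max 0 (combine W (unitFeature (combine M F)) x w i)) := by
    funext x
    cases x <;> rfl
  rw [hsplit, place_sumElim]
  congr 1
  simp only [ff, act_liftMat]
  congr 1
  funext x
  rw [Finset.sum_eq_single x]
  · rw [place_apply (Fintype.equivFin χ).injective]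
    simp only [if_true, Rat.cast_one, one_mul]
    congr 1
    change _ = ∑ y, (W x y : ℝ) * unitFeature (combine M F) y w i
    refine Finset.sum_congr rfl fun y _ => ?_
    have hn : norm.apply (place c (fun q => (balance q.2 : ℝ) * combine M F q.1 w i)) (c (y, 0)) =
        (D : ℝ) / 2 * unitFeature (combine M F) y w i :=
      NormKind.apply_place_balance hc (fun q => combine M F q w i) norm y
    rw [hn]
    push_cast
    field_simp
  · intro y _ hy
    rw [if_neg (Ne.symm hy), Rat.cast_zero, zero_mul]
  · simp

/-- One attention sublayer adds hard attention features whose queries, keys and values are linear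
combinations of normalized combinations of the old features. -/
lemma Realizable.attention {ι κ η Λ Ω : Type} [Fintype ι] [Fintype κ] [Fintype η] [Fintype Λ]
    [Fintype Ω] {F : ι → Feature α} (hF : Realizable norm mk p t F) (M : κ → ι → ℚ)
    (Q K : η → Λ → κ → ℚ) (V : η → Ω → κ → ℚ) :
    Realizable norm mk p (t + 1) (Sum.elim F (fun x : η × Ω =>
      attnFeature mk p (combine (Q x.1) (unitFeature (combine M F)))
        (combine (K x.1) (unitFeature (combine M F)))
        (combine (V x.1) (unitFeature (combine M F)) x.2))) := by
  classical
  obtain ⟨D₀, hD₀⟩ := hF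
  refine ⟨D₀ + 4 * Fintype.card κ + Fintype.card η + Fintype.card Λ + Fintype.card Ω + 1,
    fun D hD e he => ?_⟩
  obtain ⟨embed, pos, layers, hlen, hrun⟩ := hD₀ D (by omega) (e ∘ Sum.inl)
    (he.comp Sum.inl_injective)
  obtain ⟨c, hc⟩ := exists_injective_fin (A := κ × Fin 4) (D := D * D) (by
    rw [Fintype.card_prod, Fintype.card_fin]
    nlinarith)
  obtain ⟨eη, hη⟩ := exists_injective_fin (A := η) (D := D) (by omega)
  obtain ⟨eΛ, hΛ⟩ := exists_injective_fin (A := Λ) (D := D) (by omega)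
  obtain ⟨eΩ, hΩ⟩ := exists_injective_fin (A := Ω) (D := D) (by omega)
  have hD1 : (D : ℝ) ≠ 0 := by
    have : D ≠ 0 := by omega
    exact_mod_cast this
  let attn : AttentionSublayer (D * D) :=
    { mask := liftMat c (e ∘ Sum.inl) (fun q x => balance q.2 * M q.1 x)
      heads := D
      headDim := D
      width_eq := rfl
      query := extend eη
        (fun h => liftMat eΛ (fun y => c (y, 0)) (fun l y => 2 / D * Q h l y)) 0
      key := extend eη
        (fun h => liftMat eΛ (fun y => c (y, 0)) (fun l y => 2 / D * K h l y)) 0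
      value := extend eη
        (fun h => liftMat eΩ (fun y => c (y, 0)) (fun o y => 2 / D * V h o y)) 0
      out := liftMat (e ∘ Sum.inr) (fun x : η × Ω => (eη x.1, eΩ x.2))
        (fun x y => if x = y then 1 else 0) }
  refine ⟨embed, pos, layers ++ [⟨attn, FeedforwardSublayer.idle _⟩], by simp [hlen],
    fun w i => ?_⟩
  rw [List.foldl_append, funext (hrun w), List.foldl_cons, List.foldl_nil]
  simp only [Layer.apply, FeedforwardSublayer.apply_idle, AttentionSublayer.apply]
  have hmask : ∀ i, act attn.mask (place (e ∘ Sum.inl) fun x => F x w i) =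
      place c (fun q => (balance q.2 : ℝ) * combine M F q.1 w i) := by
    intro i
    simp only [attn, act_liftMat]
    congr 1
    funext q
    simp only [combine, Finset.mul_sum]
    refine Finset.sum_congr rfl fun x _ => ?_
    rw [place_apply (he.comp Sum.inl_injective)]
    push_cast
    ring
  simp only [hmask]
  -- Reading the normalized stream at the balanced coordinates undoes the factor `D / 2`.
  have hread : ∀ {B : Type} [Fintype B] (eB : B → Fin D) (X : η → B → κ → ℚ) (h : η) (i : ℕ),
      act (extend eη
        (fun h => liftMat eB (fun y => c (y, 0)) (fun l y => 2 / D * X h l y)) 0 (eη h))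
        (norm.apply (place c (fun q => (balance q.2 : ℝ) * combine M F q.1 w i))) =
      place eB (fun l => combine (X h) (unitFeature (combine M F)) l w i) := by
    intro B _ eB X h i
    rw [hη.extend_apply, act_liftMat]
    congr 1
    funext l
    change _ = ∑ y, (X h l y : ℝ) * unitFeature (combine M F) y w i
    refine Finset.sum_congr rfl fun y _ => ?_
    have hn : norm.apply (place c (fun q => (balance q.2 : ℝ) * combine M F q.1 w i)) (c (y, 0)) =
        (D : ℝ) / 2 * unitFeature (combine M F) y w i :=
      NormKind.apply_place_balance hc (fun q => combine M F q w i) norm y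
    rw [hn]
    push_cast
    field_simp
  have hsplit : (fun x : ι ⊕ η × Ω => (Sum.elim F (fun x : η × Ω =>
      attnFeature mk p (combine (Q x.1) (unitFeature (combine M F)))
        (combine (K x.1) (unitFeature (combine M F)))
        (combine (V x.1) (unitFeature (combine M F)) x.2)) x : Feature α) w i) =
      Sum.elim (fun x => F x w i) (fun x : η × Ω =>
      attnFeature mk p (combine (Q x.1) (unitFeature (combine M F)))
        (combine (K x.1) (unitFeature (combine M F)))
        (combine (V x.1) (unitFeature (combine M F)) x.2) w i) := by
    funext x
    cases x <;> rfl
  rw [hsplit, place_sumElim]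
  congr 1
  have hout : attn.out = liftMat (e ∘ Sum.inr) (fun x : η × Ω => (eη x.1, eΩ x.2))
        (fun x y => if x = y then 1 else 0) := rfl
  rw [hout, act_liftMat]
  congr 1
  funext x
  rw [Finset.sum_eq_single x]
  · simp only [if_true, Rat.cast_one, one_mul, hardAttention, attnFeature]
    have hscore : ∀ j, act (attn.query (eη x.1))
          (norm.apply (place c (fun q => (balance q.2 : ℝ) * combine M F q.1 w i))) ⬝ᵥ
        act (attn.key (eη x.1))
          (norm.apply (place c (fun q => (balance q.2 : ℝ) * combine M F q.1 w j))) =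
        ∑ l, combine (Q x.1) (unitFeature (combine M F)) l w i *
          combine (K x.1) (unitFeature (combine M F)) l w j := by
      intro j
      simp only [attn]
      rw [hread eΛ Q, hread eΛ K, dotProduct,
        sum_place_comp hΛ _ (fun r t => t * place eΛ _ r) (fun _ => by simp)]
      refine Finset.sum_congr rfl fun l _ => ?_
      rw [place_apply hΛ]
    have hval : ∀ j, act (attn.value (eη x.1))
          (norm.apply (place c (fun q => (balance q.2 : ℝ) * combine M F q.1 w j))) (eΩ x.2) =
        combine (V x.1) (unitFeature (combine M F)) x.2 w j := by
      intro j
      simp only [attn]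
      rw [hread eΩ V, place_apply hΩ]
    simp only [hscore, hval]
  · intro y _ hy
    rw [if_neg (Ne.symm hy), Rat.cast_zero, zero_mul]
  · simp

/-- The indicator of a token. -/
def tokenFeature (x : Token α) : Feature α :=
  open Classical in fun w i => if tokenAt w i = x then 1 else 0

/-- The position encoding. -/
def posFeature (mk : Masking) : Feature α := fun _ i => mk.posEnc i

lemma realizable_init {ι : Type*} [Fintype ι] (x : ι → Token α) :
    Realizable norm mk p 0
      (fun y : Option ι => y.elim (posFeature mk) (fun y => tokenFeature (x y))) := by
  classical
  refine ⟨0, fun D _ e he => ⟨fun s r => ∑ y, if e (some y) = r then (if s = x y then 1 else 0)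
    else 0, fun r => if e none = r then 1 else 0, [], rfl, fun w i => ?_⟩⟩
  funext r
  simp only [List.foldl_nil, place, Fintype.sum_option, Option.elim, tokenFeature, posFeature]
  push_cast
  rw [add_comm]
  congr 1
  · split_ifs <;> simp
  · exact Finset.sum_congr rfl fun y _ => by split_ifs <;> simp

end Realization

/-! ### Spaces of available features -/

section Reachability

variable {α : Type u} {norm : NormKind} {mk : Masking} {p : ℕ → ℕ} {t : ℕ}

/-- The features that agree, on the actual tokens of every run, with a rational linear
combination of `F`. -/
def combinations (p : ℕ → ℕ) {ι : Type*} [Fintype ι] (F : ι → Feature α) :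
    Submodule ℚ (Feature α) where
  carrier := {f | ∃ a : ι → ℚ, ∀ w i, i < seqLen p w → f w i = ∑ x, (a x : ℝ) * F x w i}
  add_mem' := by
    rintro f g ⟨a, ha⟩ ⟨b, hb⟩
    refine ⟨a + b, fun w i hi => ?_⟩
    simp [ha w i hi, hb w i hi, add_mul, Finset.sum_add_distrib]
  zero_mem' := ⟨0, fun w i _ => by simp⟩
  smul_mem' := by
    rintro q f ⟨a, ha⟩
    refine ⟨q • a, fun w i hi => ?_⟩
    simp [ha w i hi, Rat.smul_def, Finset.mul_sum, mul_assoc]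

/-- After `t` layers of some transformer, exactly the features in `S` can be read off linearly. -/
def Reach (norm : NormKind) (mk : Masking) (p : ℕ → ℕ) (t : ℕ) (S : Submodule ℚ (Feature α)) :
    Prop :=
  ∃ (ι : Type) (_ : Fintype ι) (F : ι → Feature α), Realizable norm mk p t F ∧
    S = combinations p F

/-- Two features agree on the tokens of every run. -/
def AgreeOn (p : ℕ → ℕ) (f g : Feature α) : Prop := ∀ w i, i < seqLen p w → f w i = g w i

/-- `f` belongs to a finite family of features in `S` whose values form a unit vector at every
token.  Concatenations of such families have constant norm, so that layer-norm acts on them as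
multiplication by a constant. -/
def Normable (p : ℕ → ℕ) (S : Submodule ℚ (Feature α)) (f : Feature α) : Prop :=
  ∃ (κ : Type) (_ : Fintype κ) (g : κ → Feature α), (∀ y, g y ∈ S) ∧ (∃ y, g y = f) ∧
    ∀ w i, i < seqLen p w → ∑ y, g y w i ^ 2 = 1

/-- The linear combinations of normable features. -/
def normableSpan (p : ℕ → ℕ) (S : Submodule ℚ (Feature α)) : Submodule ℚ (Feature α) :=
  Submodule.span ℚ {f | Normable p S f}

lemma Normable.mono {S S' : Submodule ℚ (Feature α)} (h : S ≤ S') {f : Feature α}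
    (hf : Normable p S f) : Normable p S' f := by
  obtain ⟨κ, i, g, h1, h2, h3⟩ := hf
  exact ⟨κ, i, g, fun y => h (h1 y), h2, h3⟩

lemma Normable.mem {S : Submodule ℚ (Feature α)} {f : Feature α} (hf : Normable p S f) :
    f ∈ normableSpan p S := Submodule.subset_span hf

lemma Normable.of_pair {S : Submodule ℚ (Feature α)} {f g : Feature α} (hf : f ∈ S) (hg : g ∈ S)
    (h : ∀ w i, i < seqLen p w → f w i ^ 2 + g w i ^ 2 = 1) : Normable p S f :=
  ⟨Bool, inferInstance, fun b => if b then f else g, fun b => by cases b <;> simpa, ⟨true, rfl⟩,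
    fun w i hi => by simpa using h w i hi⟩

lemma Normable.of_zero_or_one {S : Submodule ℚ (Feature α)} {f : Feature α} (hf : f ∈ S)
    (h1 : 1 ∈ S) (h : ∀ w i, i < seqLen p w → f w i = 0 ∨ f w i = 1) : Normable p S f :=
  Normable.of_pair hf (S.sub_mem h1 hf) fun w i hi => by
    rcases h w i hi with h | h <;> simp [h]

lemma normable_one {S : Submodule ℚ (Feature α)} (h1 : 1 ∈ S) : Normable p S 1 :=
  Normable.of_zero_or_one h1 h1 fun _ _ _ => Or.inr rfl

lemma Reach.mem_of_agreeOn {S : Submodule ℚ (Feature α)} (hS : Reach norm mk p t S)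
    {f g : Feature α} (hf : f ∈ S) (h : AgreeOn p g f) : g ∈ S := by
  obtain ⟨ι, _, F, _, rfl⟩ := hS
  obtain ⟨a, ha⟩ := hf
  exact ⟨a, fun w i hi => (h w i hi).trans (ha w i hi)⟩

lemma lt_of_mem_visible {N i j : ℕ} (hi : i < N) (hj : j ∈ mk.visible N i) : j < N := by
  cases mk <;> simp [Masking.visible] at hj <;> omega

lemma mem_visible_of_le {N i j : ℕ} (hi : i < N) (hj : j ≤ i) : j ∈ mk.visible N i := by
  cases mk <;> simp [Masking.visible] <;> omega

lemma combinations_le_sumElim {ι κ : Type*} [Fintype ι] [Fintype κ] (F : ι → Feature α)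
    (G : κ → Feature α) : combinations p F ≤ combinations p (Sum.elim F G) := by
  rintro f ⟨a, ha⟩
  exact ⟨Sum.elim a 0, fun w i hi => by simp [ha w i hi]⟩

lemma mem_combinations_sumElim {ι κ : Type*} [Fintype ι] [Fintype κ] (F : ι → Feature α)
    (G : κ → Feature α) (y : κ) : G y ∈ combinations p (Sum.elim F G) := by
  classical
  exact ⟨Sum.elim 0 (Pi.single y 1), fun w i _ => by
    simp [Pi.single_apply, apply_ite (Rat.cast : ℚ → ℝ)]⟩

/-! ### Feedforward sublayers -/

/-- A feedforward sublayer makes `ReLU (W z)` available, where `z` is the normalization of a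
family of available features. -/
lemma Reach.relu {S : Submodule ℚ (Feature α)} (hS : Reach norm mk p t S) {κ χ : Type}
    [Fintype κ] [Fintype χ] {g : κ → Feature α} (hg : ∀ y, g y ∈ S) (W : χ → κ → ℚ) :
    ∃ S', S ≤ S' ∧ Reach norm mk p (t + 1) S' ∧
      ∀ x, (fun w i => max 0 (combine W (unitFeature g) x w i)) ∈ S' := by
  obtain ⟨ι, _, F, hF, rfl⟩ := hS
  choose M hM using hg
  refine ⟨_, combinations_le_sumElim _ _, ⟨_, _, _, hF.feedforward M W, rfl⟩, fun x => ?_⟩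
  obtain ⟨a, ha⟩ := mem_combinations_sumElim (p := p) F (fun x w i =>
      max 0 (combine W (unitFeature (combine M F)) x w i)) x
  refine ⟨a, fun w i hi => ?_⟩
  rw [← ha w i hi]
  have : (fun y => g y w i) = fun y => combine M F y w i := funext fun y => hM y w i hi
  simp only [combine, unitFeature] at this ⊢
  rw [this]

lemma sum_unitVec_sq {κ : Type*} [Fintype κ] {x : κ → ℝ} (hx : ∑ y, x y ^ 2 ≠ 0) :
    ∑ y, unitVec x y ^ 2 = 1 := by
  simp only [unitVec, div_pow]
  rw [← Finset.sum_div, Real.sq_sqrt (Finset.sum_nonneg fun _ _ => sq_nonneg _), div_self hx]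

/-- A feedforward sublayer makes the normalization of a family of features available. -/
lemma Reach.normalize {S : Submodule ℚ (Feature α)} (hS : Reach norm mk p t S) {κ : Type}
    [Fintype κ] {g : κ → Feature α} (hg : ∀ y, g y ∈ S)
    (h0 : ∀ w i, i < seqLen p w → ∑ y, g y w i ^ 2 ≠ 0) :
    ∃ S', S ≤ S' ∧ Reach norm mk p (t + 1) S' ∧ ∀ y, unitFeature g y ∈ S' ∧
      Normable p S' (unitFeature g y) := by
  classical
  obtain ⟨S', hSS', hS', hW⟩ := hS.relu hg (χ := κ × Bool)
    (fun x y => if x.1 = y then (if x.2 then 1 else -1) else 0)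
  have hmem : ∀ y, unitFeature g y ∈ S' := by
    intro y
    have := S'.sub_mem (hW (y, true)) (hW (y, false))
    convert this using 1
    funext w i
    simp only [combine, Pi.sub_apply, apply_ite (Rat.cast : ℚ → ℝ), ite_mul, Rat.cast_zero,
      zero_mul, Finset.sum_ite_eq, Finset.mem_univ, if_true, Bool.false_eq_true, if_false,
      Rat.cast_one, Rat.cast_neg, one_mul, neg_mul]
    rcases le_total 0 (unitFeature g y w i) with h | h
    · rw [max_eq_right h, max_eq_left (by linarith), sub_zero]
    · rw [max_eq_left h, max_eq_right (by linarith)]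
      ring
  exact ⟨S', hSS', hS', fun y => ⟨hmem y, κ, inferInstance, unitFeature g, hmem, ⟨y, rfl⟩,
    fun w i hi => sum_unitVec_sq (h0 w i hi)⟩⟩

/-- The first coordinate of the normalization of `(x, y)`. -/
def unit₁ (x y : ℝ) : ℝ := x / √(x ^ 2 + y ^ 2)

/-- The second coordinate of the normalization of `(x, y)`. -/
def unit₂ (x y : ℝ) : ℝ := y / √(x ^ 2 + y ^ 2)

lemma unit_sq_add_sq {x y : ℝ} (h : 0 < y) : unit₁ x y ^ 2 + unit₂ x y ^ 2 = 1 := by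
  have : 0 < x ^ 2 + y ^ 2 := by positivity
  rw [unit₁, unit₂, div_pow, div_pow, ← add_div, Real.sq_sqrt this.le, div_self this.ne']

/-- Normalization of a pair of features. -/
lemma Reach.normalizePair {S : Submodule ℚ (Feature α)} (hS : Reach norm mk p t S)
    {f g : Feature α} (hf : f ∈ S) (hg : g ∈ S) (h0 : ∀ w i, i < seqLen p w → 0 < g w i) :
    ∃ S', S ≤ S' ∧ Reach norm mk p (t + 1) S' ∧
      (fun w i => unit₁ (f w i) (g w i)) ∈ S' ∧
      Normable p S' (fun w i => unit₁ (f w i) (g w i)) ∧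
      (fun w i => unit₂ (f w i) (g w i)) ∈ S' ∧
      Normable p S' (fun w i => unit₂ (f w i) (g w i)) := by
  obtain ⟨S', h1, h2, h3⟩ := hS.normalize (κ := Bool) (g := fun b => if b then f else g)
    (by intro b; cases b <;> simpa) (by
      intro w i hi
      have := h0 w i hi
      simp only [Fintype.sum_bool, if_true, Bool.false_eq_true, if_false]
      positivity)
  have e1 : unitFeature (fun b => if b then f else g) true =
      fun w i => unit₁ (f w i) (g w i) := by
    funext w i
    simp [unitFeature, unitVec, unit₁]
  have e2 : unitFeature (fun b => if b then f else g) false =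
      fun w i => unit₂ (f w i) (g w i) := by
    funext w i
    simp [unitFeature, unitVec, unit₂]
  have ht := h3 true
  have hf := h3 false
  rw [e1] at ht
  rw [e2] at hf
  exact ⟨S', h1, h2, ht.1, ht.2, hf.1, hf.2⟩

/-- Normalizing a single feature yields its sign: a feedforward sublayer decides `0 < f`. -/
lemma Reach.isPos {S : Submodule ℚ (Feature α)} (hS : Reach norm mk p t S) {f : Feature α}
    (hf : f ∈ S) :
    ∃ S', S ≤ S' ∧ Reach norm mk p (t + 1) S' ∧
      (fun w i => if 0 < f w i then 1 else 0) ∈ S' := by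
  obtain ⟨S', h1, h2, h3⟩ := hS.relu (κ := Unit) (χ := Unit) (g := fun _ => f) (fun _ => hf)
    (fun _ _ => 1)
  refine ⟨S', h1, h2, ?_⟩
  convert h3 () using 1
  funext w i
  simp only [combine, unitFeature, unitVec, Finset.univ_unique, Finset.sum_singleton,
    Rat.cast_one, one_mul, Real.sqrt_sq_eq_abs]
  split_ifs with h
  · rw [abs_of_pos h, div_self h.ne', max_eq_right zero_le_one]
  · rw [max_eq_left]
    exact div_nonpos_of_nonpos_of_nonneg (not_lt.1 h) (abs_nonneg _)

/-! ### Attention sublayers -/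

/-- Finitely many features in the span of the normable ones are combinations of one finite family
of constant norm, and constant features fill the norm up to an integer. -/
lemma exists_family_of_mem_normableSpan {S : Submodule ℚ (Feature α)} (h1 : 1 ∈ S) {A : Type}
    [Fintype A] {f : A → Feature α} (hf : ∀ a, f a ∈ normableSpan p S) :
    ∃ (κ : Type) (_ : Fintype κ) (g : κ → Feature α) (m : ℕ), 0 < m ∧ (∀ y, g y ∈ S) ∧
      (∀ w i, i < seqLen p w → ∑ y, g y w i ^ 2 = (m : ℝ) ^ 2) ∧
      ∃ X : A → κ → ℚ, ∀ a, f a = combine X g a := by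
  have single : ∀ a, ∃ (κ : Type) (_ : Fintype κ) (g : κ → Feature α) (m : ℕ),
      (∀ y, g y ∈ S) ∧ (∀ w i, i < seqLen p w → ∑ y, g y w i ^ 2 = (m : ℝ)) ∧
      ∃ X : κ → ℚ, f a = fun w i => ∑ y, (X y : ℝ) * g y w i := by
    intro a
    refine Submodule.span_induction (p := fun f _ => ∃ (κ : Type) (_ : Fintype κ)
      (g : κ → Feature α) (m : ℕ),
      (∀ y, g y ∈ S) ∧ (∀ w i, i < seqLen p w → ∑ y, g y w i ^ 2 = (m : ℝ)) ∧
      ∃ X : κ → ℚ, f = fun w i => ∑ y, (X y : ℝ) * g y w i) ?_ ?_ ?_ ?_ (hf a)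
    · classical
      rintro f ⟨κ, _, g, hg, ⟨y, rfl⟩, hsum⟩
      refine ⟨κ, inferInstance, g, 1, hg, by simpa using hsum, Pi.single y 1, ?_⟩
      funext w i
      simp [Pi.single_apply, apply_ite (Rat.cast : ℚ → ℝ)]
    · exact ⟨Empty, inferInstance, Empty.elim, 0, by simp, by simp, 0, by funext; simp⟩
    · rintro f f' _ _ ⟨κ, _, g, m, hg, hm, X, rfl⟩ ⟨κ', _, g', m', hg', hm', X', rfl⟩
      refine ⟨κ ⊕ κ', inferInstance, Sum.elim g g', m + m', ?_, ?_, Sum.elim X X', ?_⟩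
      · rintro (y | y)
        exacts [hg y, hg' y]
      · intro w i hi
        simp [hm w i hi, hm' w i hi]
      · funext w i
        simp
    · rintro c f _ ⟨κ, _, g, m, hg, hm, X, rfl⟩
      refine ⟨κ, inferInstance, g, m, hg, hm, c • X, ?_⟩
      funext w i
      simp [Rat.smul_def, Finset.mul_sum, mul_assoc]
  choose κ iκ g m hg hm X hX using single
  obtain ⟨n, hn⟩ : ∃ n, n = ∑ a, m a := ⟨_, rfl⟩
  refine ⟨(Σ a, κ a) ⊕ Fin ((n + 1) ^ 2 - n), inferInstance,
    Sum.elim (fun y => g y.1 y.2) (fun _ => 1), n + 1, by omega, ?_, ?_, ?_⟩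
  · rintro (y | y)
    exacts [hg _ _, h1]
  · intro w i hi
    have hle : n ≤ (n + 1) ^ 2 := by nlinarith
    rw [Fintype.sum_sum_type]
    simp only [Sum.elim_inl, Sum.elim_inr, Fintype.sum_sigma, hm _ w i hi, Pi.one_apply, one_pow,
      Finset.sum_const, Finset.card_univ, Fintype.card_fin, nsmul_eq_mul, mul_one]
    rw [Nat.cast_sub hle, ← Nat.cast_sum, ← hn]
    push_cast
    ring
  · classical
    refine ⟨fun a => Sum.elim (fun y => if h : a = y.1 then X a (h ▸ y.2) else 0) 0, fun a => ?_⟩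
    rw [hX a]
    funext w i
    simp only [combine, Fintype.sum_sum_type, Sum.elim_inl, Sum.elim_inr, Fintype.sum_sigma]
    rw [Finset.sum_eq_single a]
    · simp
    · intro b _ hb
      simp [Ne.symm hb]
    · simp

lemma attnFeature_congr {Λ : Type*} [Fintype Λ] {q k q' k' : Λ → Feature α} {v v' : Feature α}
    {w : List α} {i : ℕ} (hi : i < seqLen p w)
    (hq : ∀ l, q l w i = q' l w i) (hk : ∀ l j, j < seqLen p w → k l w j = k' l w j)
    (hv : ∀ j, j < seqLen p w → v w j = v' w j) :
    attnFeature mk p q k v w i = attnFeature mk p q' k' v' w i := by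
  classical
  have hset : argmaxSet (mk.visible (seqLen p w) i) (fun j => ∑ l, q l w i * k l w j) =
      argmaxSet (mk.visible (seqLen p w) i) (fun j => ∑ l, q' l w i * k' l w j) := by
    have hs : ∀ j ∈ mk.visible (seqLen p w) i,
        ∑ l, q l w i * k l w j = ∑ l, q' l w i * k' l w j := fun j hj =>
      Finset.sum_congr rfl fun l _ => by rw [hq, hk l j (lt_of_mem_visible hi hj)]
    unfold argmaxSet
    refine Finset.filter_congr fun j hj => ?_
    constructor <;> intro h j' hj' <;> beta_reduce
    · rw [← hs j hj, ← hs j' hj']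
      exact h j' hj'
    · rw [hs j hj, hs j' hj']
      exact h j' hj'
  unfold attnFeature
  rw [hset]
  congr 1
  exact Finset.sum_congr rfl fun j hj =>
    hv j (lt_of_mem_visible hi (Finset.mem_filter.1 hj).1)

/-- An attention sublayer makes available all hard attention features whose queries, keys and
values are combinations of normable features. -/
lemma Reach.attention {S : Submodule ℚ (Feature α)} (hS : Reach norm mk p t S) (h1 : 1 ∈ S)
    {η Λ Ω : Type} [Fintype η] [Fintype Λ] [Fintype Ω] {q k : η → Λ → Feature α}
    {v : η → Ω → Feature α} (hq : ∀ h l, q h l ∈ normableSpan p S)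
    (hk : ∀ h l, k h l ∈ normableSpan p S) (hv : ∀ h o, v h o ∈ normableSpan p S) :
    ∃ S', S ≤ S' ∧ Reach norm mk p (t + 1) S' ∧
      ∀ h o, attnFeature mk p (q h) (k h) (v h o) ∈ S' := by
  obtain ⟨κ, _, g, m, hm, hg, hsum, X, hX⟩ := exists_family_of_mem_normableSpan (p := p) h1
    (A := (η × Λ) ⊕ (η × Λ) ⊕ (η × Ω))
    (f := Sum.elim (fun x => q x.1 x.2) (Sum.elim (fun x => k x.1 x.2) (fun x => v x.1 x.2)))
    (by rintro (x | x | x); exacts [hq _ _, hk _ _, hv _ _])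
  obtain ⟨ι, _, F, hF, rfl⟩ := hS
  choose M hM using hg
  have hunit : ∀ y w i, i < seqLen p w → g y w i = m * unitFeature (combine M F) y w i := by
    intro y w i hi
    have hy : ∀ y, combine M F y w i = g y w i := fun y => (hM y w i hi).symm
    have hm' : (m : ℝ) ≠ 0 := by exact_mod_cast hm.ne'
    simp only [unitFeature, unitVec, hy, hsum w i hi]
    rw [Real.sqrt_sq (by positivity)]
    field_simp
  have hread : ∀ {B : Type} (Y : B → κ → ℚ) (b : B) w i, i < seqLen p w →
      combine (fun b y => m * Y b y) (unitFeature (combine M F)) b w i = combine Y g b w i := by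
    intro B Y b w i hi
    simp only [combine]
    refine Finset.sum_congr rfl fun y _ => ?_
    rw [hunit y w i hi]
    push_cast
    ring
  refine ⟨_, combinations_le_sumElim _ _, ⟨_, _, _, hF.attention M
    (fun h l y => m * X (Sum.inl (h, l)) y) (fun h l y => m * X (Sum.inr (Sum.inl (h, l))) y)
    (fun h o y => m * X (Sum.inr (Sum.inr (h, o))) y), rfl⟩, fun h o => ?_⟩
  obtain ⟨a, ha⟩ := mem_combinations_sumElim (p := p) F (fun x : η × Ω =>
      attnFeature mk p
        (combine (fun l y => m * X (Sum.inl (x.1, l)) y) (unitFeature (combine M F)))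
        (combine (fun l y => m * X (Sum.inr (Sum.inl (x.1, l))) y) (unitFeature (combine M F)))
        (combine (fun o y => m * X (Sum.inr (Sum.inr (x.1, o))) y)
          (unitFeature (combine M F)) x.2)) (h, o)
  refine ⟨a, fun w i hi => ?_⟩
  rw [← ha w i hi]
  refine attnFeature_congr hi (fun l => ?_) (fun l j hj => ?_) (fun j hj => ?_)
  · rw [hread _ _ w i hi]
    exact congrFun (congrFun (hX (Sum.inl (h, l))) w) i
  · rw [hread _ _ w j hj]
    exact congrFun (congrFun (hX (Sum.inr (Sum.inl (h, l)))) w) j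
  · rw [hread _ _ w j hj]
    exact congrFun (congrFun (hX (Sum.inr (Sum.inr (h, o)))) w) j

section Argmax

variable {Λ : Type*} [Fintype Λ] {q k : Λ → Feature α} {v : Feature α} {w : List α} {i : ℕ}

lemma attnFeature_eq_average {A : Finset ℕ} {c : ℝ} (hA : A ⊆ mk.visible (seqLen p w) i)
    (hne : A.Nonempty) (heq : ∀ j ∈ A, ∑ l, q l w i * k l w j = c)
    (hlt : ∀ j ∈ mk.visible (seqLen p w) i, j ∉ A → ∑ l, q l w i * k l w j < c) :
    attnFeature mk p q k v w i = (∑ j ∈ A, v w j) / (A.card : ℝ) := by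
  classical
  have hset : argmaxSet (mk.visible (seqLen p w) i) (fun j => ∑ l, q l w i * k l w j) = A := by
    ext j
    simp only [argmaxSet, Finset.mem_filter]
    constructor
    · rintro ⟨hj, hmax⟩
      by_contra hjA
      obtain ⟨a, ha⟩ := hne
      have := hmax a (hA ha)
      have := hlt j hj hjA
      rw [heq a ha] at *
      linarith
    · intro hj
      refine ⟨hA hj, fun j' hj' => ?_⟩
      rw [heq j hj]
      by_cases h : j' ∈ A
      · exact (heq j' h).le
      · exact (hlt j' hj' h).le
  rw [attnFeature, hset]

lemma attnFeature_eq_of_unique {j₀ : ℕ} (hj₀ : j₀ ∈ mk.visible (seqLen p w) i)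
    (hlt : ∀ j ∈ mk.visible (seqLen p w) i, j ≠ j₀ →
      ∑ l, q l w i * k l w j < ∑ l, q l w i * k l w j₀) :
    attnFeature mk p q k v w i = v w j₀ := by
  rw [attnFeature_eq_average (A := {j₀}) (c := ∑ l, q l w i * k l w j₀)] <;> simp_all

lemma attnFeature_rational (hi : i < seqLen p w)
    (hv : ∀ j, j < seqLen p w → ∃ x : ℚ, v w j = x) :
    ∃ x : ℚ, attnFeature mk p q k v w i = x := by
  classical
  choose! f hf using hv
  refine ⟨(∑ j ∈ argmaxSet (mk.visible (seqLen p w) i) (fun j => ∑ l, q l w i * k l w j), f j) /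
    ((argmaxSet (mk.visible (seqLen p w) i) (fun j => ∑ l, q l w i * k l w j)).card : ℚ), ?_⟩
  unfold attnFeature
  push_cast
  congr 1
  exact Finset.sum_congr rfl fun j hj =>
    hf j (lt_of_mem_visible hi (Finset.mem_filter.1 hj).1)

end Argmax

/-- The indicator of the beginning-of-sequence token. -/
def bosFeature : Feature α := fun _ i => if i = 0 then 1 else 0

/-- Thresholds in two layers, for any number of features in parallel: each token attends to the
beginning-of-sequence token if the feature is positive and to all other tokens if it is
negative. -/
lemma Reach.threshold {S : Submodule ℚ (Feature α)} (hS : Reach norm mk p t S) (h1 : 1 ∈ S)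
    (hb : bosFeature ∈ S) {η : Type} [Fintype η] {a : η → Feature α} (ha : ∀ h, a h ∈ S) :
    ∃ S', S ≤ S' ∧ Reach norm mk p (t + 2) S' ∧ ∃ T : η → Feature α, (∀ h, T h ∈ S') ∧
      ∀ h w i, i < seqLen p w → a h w i ≠ 0 → (T h w i = 0 ∨ T h w i = 1) ∧
        (0 < i → T h w i = if 0 < a h w i then 1 else 0) := by
  set g : Option η → Feature α := fun x => x.elim 1 a with hg
  have hgpos : ∀ w i, 0 < ∑ y, g y w i ^ 2 := by
    intro w i
    have : 0 ≤ ∑ x, a x w i ^ 2 := Finset.sum_nonneg fun _ _ => sq_nonneg _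
    simp only [Fintype.sum_option, hg, Option.elim, Pi.one_apply]
    linarith
  obtain ⟨S₁, hS₁, hR₁, hz⟩ := hS.normalize (g := g)
    (by rintro (_ | x); exacts [h1, ha x]) (fun w i _ => (hgpos w i).ne')
  have hbn : bosFeature ∈ normableSpan p S₁ :=
    (Normable.of_zero_or_one (hS₁ hb) (hS₁ h1) fun w i _ => by
      unfold bosFeature; split_ifs <;> simp).mem
  obtain ⟨S₂, hS₂, hR₂, hT⟩ := hR₁.attention (hS₁ h1) (η := η) (Λ := Unit) (Ω := Unit)
    (q := fun h _ => unitFeature g (some h)) (k := fun _ _ => bosFeature)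
    (v := fun _ _ => bosFeature) (fun h _ => (hz (some h)).2.mem) (fun _ _ => hbn)
    (fun _ _ => hbn)
  refine ⟨S₂, hS₁.trans hS₂, hR₂, _, fun h => hT h (), fun h w i hi hne => ?_⟩
  have hzi : unitFeature g (some h) w i = a h w i / √(∑ y, g y w i ^ 2) := rfl
  have hroot := Real.sqrt_pos.2 (hgpos w i)
  have h0 : 0 ∈ mk.visible (seqLen p w) i := mem_visible_of_le hi (Nat.zero_le _)
  rcases lt_or_gt_of_ne hne with hneg | hpos
  · have hlt : unitFeature g (some h) w i < 0 := by
      rw [hzi]; exact div_neg_of_neg_of_pos hneg hroot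
    by_cases hvis : ((mk.visible (seqLen p w) i).erase 0).Nonempty
    · have : attnFeature mk p (fun _ : Unit => unitFeature g (some h)) (fun _ => bosFeature)
          bosFeature w i = 0 := by
        rw [attnFeature_eq_average (c := 0) (Finset.erase_subset _ _) hvis]
        · rw [Finset.sum_eq_zero, zero_div]
          intro j hj
          simp [bosFeature, Finset.ne_of_mem_erase hj]
        · intro j hj
          simp [bosFeature, Finset.ne_of_mem_erase hj]
        · intro j hj hj'
          have : j = 0 := by
            by_contra h
            exact hj' (Finset.mem_erase.2 ⟨h, hj⟩)
          simpa [bosFeature, this] using hlt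
      exact ⟨Or.inl this, fun _ => by rw [this, if_neg (not_lt.2 hneg.le)]⟩
    · have hall : ∀ j ∈ mk.visible (seqLen p w) i, j = 0 := by
        intro j hj
        by_contra h
        exact hvis ⟨j, Finset.mem_erase.2 ⟨h, hj⟩⟩
      refine ⟨Or.inr ?_, fun hi0 => absurd (hall i (mem_visible_of_le hi le_rfl)) hi0.ne'⟩
      rw [attnFeature_eq_of_unique h0 fun j hj hj0 => absurd (hall j hj) hj0]
      simp [bosFeature]
  · have hgt : 0 < unitFeature g (some h) w i := by
      rw [hzi]; exact div_pos hpos hroot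
    have : attnFeature mk p (fun _ : Unit => unitFeature g (some h)) (fun _ => bosFeature)
          bosFeature w i = 1 := by
      rw [attnFeature_eq_of_unique h0]
      · simp [bosFeature]
      · intro j _ hj0
        simpa [bosFeature, hj0] using hgt
    exact ⟨Or.inr this, fun _ => by rw [this, if_pos hpos]⟩

/-- Constructions of `τ` layers each, for finitely many objects, can be performed one after the
other. -/
lemma Reach.forall_finset {X : Type*} {P : X → Submodule ℚ (Feature α) → Prop}
    (hmono : ∀ x S S', S ≤ S' → P x S → P x S') {S : Submodule ℚ (Feature α)} {τ : ℕ}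
    (step : ∀ x t S', S ≤ S' → Reach norm mk p t S' →
      ∃ S'', S' ≤ S'' ∧ Reach norm mk p (t + τ) S'' ∧ P x S'')
    (hS : Reach norm mk p t S) (s : Finset X) :
    ∃ S', S ≤ S' ∧ Reach norm mk p (t + τ * s.card) S' ∧ ∀ x ∈ s, P x S' := by
  classical
  induction s using Finset.induction_on with
  | empty => exact ⟨S, le_rfl, by simpa using hS, by simp⟩
  | insert x s hx ih =>
    obtain ⟨S₁, h1, hR, hP⟩ := ih
    obtain ⟨S₂, h2, hR₂, hP₂⟩ := step x _ S₁ h1 hR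
    refine ⟨S₂, h1.trans h2, ?_, ?_⟩
    · rw [Finset.card_insert_of_notMem hx, Nat.mul_succ, ← add_assoc]
      exact hR₂
    · intro y hy
      rcases Finset.mem_insert.1 hy with rfl | hy
      · exact hP₂
      · exact hmono y _ _ h2 (hP y hy)

end Reachability

/-! ### Unit vectors in the plane -/

section RealEstimates

lemma unit₁_eq_ratio {x y : ℝ} (hy : 0 < y) : unit₁ x y = unit₁ (x / y) 1 := by
  have : x ^ 2 + y ^ 2 = y ^ 2 * ((x / y) ^ 2 + 1 ^ 2) := by field_simp
  rw [unit₁, unit₁, this, Real.sqrt_mul (sq_nonneg _), Real.sqrt_sq hy.le, div_mul_eq_div_div]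

lemma unit₂_eq_ratio {x y : ℝ} (hy : 0 < y) : unit₂ x y = unit₂ (x / y) 1 := by
  have : x ^ 2 + y ^ 2 = y ^ 2 * ((x / y) ^ 2 + 1 ^ 2) := by field_simp
  rw [unit₂, unit₂, this, Real.sqrt_mul (sq_nonneg _), Real.sqrt_sq hy.le, div_mul_eq_div_div,
    div_self hy.ne']

lemma unit₁_pos {x y : ℝ} (hx : 0 < x) : 0 < unit₁ x y := by
  unfold unit₁; positivity

lemma unit₂_pos {x y : ℝ} (hy : 0 < y) : 0 < unit₂ x y := by
  unfold unit₂; positivity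

/-- For `x` small compared with `y`, the first coordinate of the normalization of `(x, y)` is
nearly `x / y`: in this way layer-norm divides. -/
lemma abs_unit₁_sub_le {x y : ℝ} (hy : 0 < y) : |unit₁ x y - x / y| ≤ |x / y| ^ 3 := by
  rw [unit₁_eq_ratio hy]
  generalize x / y = z
  have h1 : 1 ≤ √(z ^ 2 + 1 ^ 2) := by
    rw [Real.one_le_sqrt]; nlinarith [sq_nonneg z]
  have h2 : √(z ^ 2 + 1 ^ 2) ≤ 1 + z ^ 2 := by
    rw [Real.sqrt_le_iff]
    constructor
    · positivity
    · nlinarith [sq_nonneg z, sq_nonneg (z ^ 2)]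
  have h3 : 1 - z ^ 2 ≤ 1 / √(z ^ 2 + 1 ^ 2) := by
    rw [le_div_iff₀ (by linarith)]
    rcases le_total (1 - z ^ 2) 0 with h | h
    · nlinarith
    · nlinarith [sq_nonneg (z ^ 2)]
  have h4 : 1 / √(z ^ 2 + 1 ^ 2) ≤ 1 := by
    rw [div_le_one (by linarith)]; exact h1
  have h5 : unit₁ z 1 - z = z * (1 / √(z ^ 2 + 1 ^ 2) - 1) := by
    unfold unit₁; ring
  rw [h5, abs_mul, pow_succ' |z|, sq_abs]
  refine mul_le_mul_of_nonneg_left ?_ (abs_nonneg _)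
  rw [abs_le]
  constructor <;> linarith [sq_nonneg z]

lemma unit₁_lt_unit₁ {x y : ℝ} (hx : 0 ≤ x) (hxy : x < y) : unit₁ x 1 < unit₁ y 1 := by
  have hy : 0 < y := lt_of_le_of_lt hx hxy
  unfold unit₁
  rw [div_lt_div_iff₀ (by positivity) (by positivity)]
  refine lt_of_pow_lt_pow_left₀ 2 (by positivity) ?_
  rw [mul_pow, mul_pow, Real.sq_sqrt (by positivity), Real.sq_sqrt (by positivity)]
  nlinarith

/-- The inner product of the unit vectors in the directions `(y, 1)` and `(b, 1)`. -/
def dirDot (y b : ℝ) : ℝ := unit₁ y 1 * unit₁ b 1 + unit₂ y 1 * unit₂ b 1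

lemma dirDot_eq (y b : ℝ) :
    dirDot y b = (y * b + 1) / (√(y ^ 2 + 1) * √(b ^ 2 + 1)) := by
  unfold dirDot unit₁ unit₂
  rw [one_pow]
  field_simp

/-- Comparison of angular distances, by `(yb + 1)² = (y² + 1)(b² + 1) - (y - b)²`. -/
lemma dirDot_lt {y b b₀ : ℝ} (h0 : 0 < y * b₀ + 1)
    (h : (y - b₀) ^ 2 * (b ^ 2 + 1) < (y - b) ^ 2 * (b₀ ^ 2 + 1)) :
    dirDot y b < dirDot y b₀ := by
  have hy : 0 < √(y ^ 2 + 1) := Real.sqrt_pos.2 (by positivity)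
  rw [dirDot_eq, dirDot_eq, mul_comm _ (√(b ^ 2 + 1)), mul_comm _ (√(b₀ ^ 2 + 1)),
    div_mul_eq_div_div, div_mul_eq_div_div]
  refine div_lt_div_of_pos_right ?_ hy
  rw [div_lt_div_iff₀ (by positivity) (by positivity)]
  refine lt_of_pow_lt_pow_left₀ 2 (by positivity) ?_
  rw [mul_pow, mul_pow, Real.sq_sqrt (by positivity), Real.sq_sqrt (by positivity)]
  nlinarith

lemma dirDot_self (y : ℝ) : dirDot y y = 1 := by
  have : 0 < y ^ 2 + 1 := by positivity
  rw [dirDot_eq, ← pow_two, ← pow_two, Real.sq_sqrt this.le, div_self this.ne']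

lemma dirDot_lt_one {y b : ℝ} (h : b ≠ y) : dirDot y b < 1 := by
  rw [← dirDot_self y]
  refine dirDot_lt (by nlinarith [sq_nonneg y]) ?_
  have : 0 < (y - b) ^ 2 := by
    have : y - b ≠ 0 := sub_ne_zero.2 (Ne.symm h)
    positivity
  simp only [sub_self]
  nlinarith [sq_nonneg y]

/-- Among the directions of positive integers, the closest to that of `y` is the integer `x`
closest to `y`, provided `y` is within `1/4` of it. -/
lemma dirDot_lt_of_near_nat {y : ℝ} {x b : ℕ} (hb : b ≠ x) (hy : |y - x| ≤ 1 / 4) :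
    dirDot y b < dirDot y x := by
  have hx : (0 : ℝ) ≤ x := Nat.cast_nonneg x
  have hb0 : (0 : ℝ) ≤ b := Nat.cast_nonneg b
  obtain ⟨h1, h2⟩ := abs_le.1 hy
  refine dirDot_lt ?_ ?_
  · rcases Nat.eq_zero_or_pos x with rfl | hx1
    · simp
    · have : (1 : ℝ) ≤ x := by exact_mod_cast hx1
      nlinarith
  · have hd : (1 : ℝ) ≤ ((b : ℝ) - x) ^ 2 := by
      have h : 1 ≤ ((b : ℤ) - x) ^ 2 := by
        have : (b : ℤ) - x ≠ 0 := by omega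
        have := sq_pos_of_ne_zero this
        omega
      exact_mod_cast h
    set d : ℝ := (b : ℝ) - x
    have hbd : (b : ℝ) = x + d := by simp [d]
    set e : ℝ := y - x
    have he : e ^ 2 ≤ 1 / 16 := by nlinarith
    have hyb : y - b = e - d := by simp only [e, d]; ring
    have h3 : (9 / 16) * d ^ 2 ≤ (y - b) ^ 2 := by
      rw [hyb]
      rcases le_total 0 d with hd0 | hd0
      · have : 1 ≤ d := by nlinarith
        nlinarith
      · have : d ≤ -1 := by nlinarith
        nlinarith
    have h4 : (b : ℝ) ^ 2 + 1 ≤ 2 * x ^ 2 + 2 * d ^ 2 + 1 := by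
      rw [hbd]; nlinarith [sq_nonneg ((x : ℝ) - d)]
    have h5 : e ^ 2 * ((b : ℝ) ^ 2 + 1) ≤ 1 / 16 * (2 * x ^ 2 + 2 * d ^ 2 + 1) :=
      mul_le_mul he h4 (by positivity) (by norm_num)
    have h6 : (9 / 16) * d ^ 2 * ((x : ℝ) ^ 2 + 1) ≤ (y - b) ^ 2 * ((x : ℝ) ^ 2 + 1) :=
      mul_le_mul_of_nonneg_right h3 (by positivity)
    nlinarith [mul_le_mul_of_nonneg_right hd (sq_nonneg (x : ℝ))]

/-- Division with remainder by rounding: if `Y ≈ c (n x₀ + v - (n - 1) / 2)` with `v < n`, the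
direction of `Y` is closer to that of `B₀ ≈ c n x₀` than to that of `B ≈ c n x`, as long as these
numbers are so small that the arc is almost straight. -/
lemma dirDot_lt_of_div {n x x₀ v : ℕ} {c Y B B₀ : ℝ} (hv : v < n) (hx : x ≠ x₀) (hc : 0 < c)
    (hY : |Y - c * (n * x₀ + v - ((n : ℝ) - 1) / 2)| ≤ c / 16)
    (hB₀ : |B₀ - c * (n * x₀)| ≤ c / 16) (hB : |B - c * (n * x)| ≤ c / 16)
    (hn : n * B ^ 2 ≤ 1) (hsmall : |Y| ≤ 1 / 2) (hsmall₀ : |B₀| ≤ 1 / 2) :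
    dirDot Y B < dirDot Y B₀ := by
  have hvn : (v : ℝ) ≤ n - 1 := by
    have : (v : ℝ) + 1 ≤ n := by exact_mod_cast hv
    linarith
  have hv0 : (0 : ℝ) ≤ v := Nat.cast_nonneg v
  obtain ⟨y1, y2⟩ := abs_le.1 hY
  obtain ⟨p1, p2⟩ := abs_le.1 hB₀
  obtain ⟨q1, q2⟩ := abs_le.1 hB
  have hn1 : (1 : ℝ) ≤ n := by exact_mod_cast (by omega : 1 ≤ n)
  have hcv : c * v ≤ c * (n - 1) := mul_le_mul_of_nonneg_left hvn hc.le
  have hcv0 : 0 ≤ c * v := by positivity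
  have hprod : |Y * B₀| ≤ 1 / 2 * (1 / 2) := by
    rw [abs_mul]
    exact mul_le_mul hsmall hsmall₀ (abs_nonneg _) (by norm_num)
  refine dirDot_lt (by linarith [neg_abs_le (Y * B₀)]) ?_
  have near : (Y - B₀) ^ 2 ≤ (c * (n / 2 - 3 / 8)) ^ 2 := by
    rw [sq_le_sq, abs_of_nonneg (a := c * (n / 2 - 3 / 8)) (by
      refine mul_nonneg hc.le ?_; linarith), abs_le]
    constructor <;> linarith
  have far : (c * (n / 2 + 3 / 8)) ^ 2 ≤ (Y - B) ^ 2 := by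
    rw [sq_le_sq, abs_of_nonneg (a := c * (n / 2 + 3 / 8)) (by positivity), le_abs]
    rcases lt_or_gt_of_ne hx with h | h
    · left
      have h1 : (x : ℝ) + 1 ≤ x₀ := by exact_mod_cast h
      have h2 : c * (n * (x + 1)) ≤ c * (n * (x₀ : ℝ)) := by gcongr
      linarith
    · right
      have h1 : (x₀ : ℝ) + 1 ≤ x := by exact_mod_cast h
      have h2 : c * (n * (x₀ + 1)) ≤ c * (n * (x : ℝ)) := by gcongr
      linarith
  have straight : (n / 2 - 3 / 8) ^ 2 * (B ^ 2 + 1) < ((n : ℝ) / 2 + 3 / 8) ^ 2 := by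
    have h3 : ((n : ℝ) / 2 - 3 / 8) ^ 2 * B ^ 2 ≤ n / 4 := by
      have h4 : ((n : ℝ) / 2 - 3 / 8) ^ 2 ≤ n / 4 * n := by nlinarith
      calc ((n : ℝ) / 2 - 3 / 8) ^ 2 * B ^ 2 ≤ n / 4 * n * B ^ 2 :=
            mul_le_mul_of_nonneg_right h4 (sq_nonneg _)
        _ = n / 4 * (n * B ^ 2) := by ring
        _ ≤ n / 4 * 1 := mul_le_mul_of_nonneg_left hn (by positivity)
        _ = n / 4 := mul_one _
    linarith
  have hc2 : 0 < c ^ 2 := by positivity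
  calc (Y - B₀) ^ 2 * (B ^ 2 + 1) ≤ (c * (n / 2 - 3 / 8)) ^ 2 * (B ^ 2 + 1) :=
        mul_le_mul_of_nonneg_right near (by positivity)
    _ = c ^ 2 * ((n / 2 - 3 / 8) ^ 2 * (B ^ 2 + 1)) := by ring
    _ < c ^ 2 * (n / 2 + 3 / 8) ^ 2 := mul_lt_mul_of_pos_left straight hc2
    _ = (c * (n / 2 + 3 / 8)) ^ 2 := by ring
    _ ≤ (Y - B) ^ 2 := far
    _ ≤ (Y - B) ^ 2 * (B₀ ^ 2 + 1) :=
        le_mul_of_one_le_right (sq_nonneg _) (by linarith [sq_nonneg B₀])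

lemma unit₂_natCast_irrational (x : ℕ) (hx : 1 ≤ x) : Irrational (unit₂ (x : ℝ) 1) := by
  have h : unit₂ (x : ℝ) 1 = (√((x ^ 2 + 1 : ℕ) : ℝ))⁻¹ := by
    unfold unit₂
    push_cast
    rw [one_pow, one_div]
  rw [h, irrational_inv_iff, irrational_sqrt_natCast_iff]
  rintro ⟨r, hr⟩
  have h1 : x < r := by nlinarith
  nlinarith

lemma unit₁_natCast_irrational (x : ℕ) (hx : 1 ≤ x) : Irrational (unit₁ (x : ℝ) 1) := by
  have h : unit₁ (x : ℝ) 1 = x * unit₂ (x : ℝ) 1 := by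
    unfold unit₁ unit₂
    ring
  rw [h]
  exact (unit₂_natCast_irrational x hx).natCast_mul (by omega)

lemma one_sub_unit₁_mem {x : ℝ} (hx : 0 < x) :
    0 < 1 - unit₁ x 1 ∧ 2 * x ^ 2 * (1 - unit₁ x 1) ≤ 1 := by
  have h := unit_sq_add_sq (x := x) one_pos
  have hroot : 0 < √(x ^ 2 + 1 ^ 2) := Real.sqrt_pos.2 (by positivity)
  have hu : 0 < unit₁ x 1 := div_pos hx hroot
  have hv : 0 < unit₂ x 1 := div_pos one_pos hroot
  have hxv : unit₁ x 1 = x * unit₂ x 1 := by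
    unfold unit₁ unit₂
    ring
  set u := unit₁ x 1
  set v := unit₂ x 1
  have h1 : u < 1 := by nlinarith
  refine ⟨by linarith, ?_⟩
  have h2 : 2 * x ^ 2 * (1 - u) * (1 + u) = 2 * u ^ 2 := by
    have : (1 - u) * (1 + u) = v ^ 2 := by linarith
    rw [mul_assoc, this, hxv]
    ring
  have h3 : 2 * u ^ 2 ≤ 1 * (1 + u) := by nlinarith
  exact le_of_mul_le_mul_right (h2.trans_le h3) (by linarith)

/-! ### Small numbers -/

/-- A number of the order of `x² / 2`. -/
def shrink (x : ℝ) : ℝ := 1 - unit₂ x 1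

lemma shrink_pos {x : ℝ} (hx : 0 < x) : 0 < shrink x := by
  have : 1 < √(x ^ 2 + 1 ^ 2) := by
    rw [Real.lt_sqrt zero_le_one]
    nlinarith [sq_pos_of_pos hx]
  rw [shrink, unit₂, sub_pos, div_lt_one (by linarith)]
  exact this

lemma shrink_le_sq (x : ℝ) : shrink x ≤ x ^ 2 := by
  have h1 : 1 ≤ √(x ^ 2 + 1 ^ 2) := by
    rw [Real.one_le_sqrt]; nlinarith [sq_nonneg x]
  have h2 : √(x ^ 2 + 1 ^ 2) ≤ 1 + x ^ 2 := by
    rw [Real.sqrt_le_iff]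
    constructor
    · positivity
    · nlinarith [sq_nonneg x, sq_nonneg (x ^ 2)]
  have h3 : 1 - x ^ 2 ≤ 1 / √(x ^ 2 + 1 ^ 2) := by
    rw [le_div_iff₀ (by linarith)]
    rcases le_total (1 - x ^ 2) 0 with h | h
    · nlinarith
    · nlinarith [sq_nonneg (x ^ 2)]
  rw [shrink, unit₂]
  linarith

lemma shrink_iterate_pos {x : ℝ} (hx : 0 < x) (m : ℕ) : 0 < shrink^[m] x := by
  induction m with
  | zero => exact hx
  | succ m ih => rw [Function.iterate_succ_apply']; exact shrink_pos ih

lemma shrink_iterate_le {x : ℝ} (hx : 0 < x) (hx1 : x ≤ 1) (m : ℕ) :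
    shrink^[m] x ≤ x ^ (m + 1) := by
  induction m with
  | zero => simp
  | succ m ih =>
    rw [Function.iterate_succ_apply']
    have h0 := shrink_iterate_pos hx m
    calc shrink (shrink^[m] x) ≤ (shrink^[m] x) ^ 2 := shrink_le_sq _
      _ ≤ (x ^ (m + 1)) ^ 2 := by gcongr
      _ = x ^ (2 * m + 2) := by ring
      _ ≤ x ^ (m + 1 + 1) := pow_le_pow_of_le_one hx.le hx1 (by omega)

/-- Approximations to multiples of a very small number `c`, obtained from `c`, `s = 1 / (n + 1)`
and `u = 1 / y` by four approximate divisions: `A ≈ c a`, `B ≈ c n a` and `E ≈ c n`, where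
`a = y - n - 2`. -/
lemma approx_multiples {n y : ℕ} {c L : ℝ} (hc : 0 < c) (hn : (n : ℝ) + 1 ≤ L)
    (hy1 : 1 ≤ y) (hy : (y : ℝ) ≤ L) (hL : c * L ^ 3 ≤ 1 / 64) {s u e₁ e₂ P P' : ℝ}
    (hs : s = 1 / ((n : ℝ) + 1)) (hu : u = 1 / (y : ℝ)) (he₁ : e₁ = unit₁ c s)
    (he₂ : e₂ = unit₁ e₁ s) (hP : P = unit₁ c u) (hP' : P' = unit₁ e₁ u) :
    |P - e₁ - c - c * ((y : ℝ) - n - 2)| ≤ c / 64 ∧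
      |P' - e₂ - P + c - c * (n * ((y : ℝ) - n - 2))| ≤ c / 64 ∧
      |e₁ - c - c * n| ≤ c / 64 := by
  have hn0 : (0 : ℝ) ≤ n := Nat.cast_nonneg n
  have hy0 : (1 : ℝ) ≤ y := by exact_mod_cast hy1
  have hL1 : 1 ≤ L := by linarith
  have hspos : 0 < s := by rw [hs]; positivity
  have hupos : 0 < u := by rw [hu]; positivity
  have hcs : ∀ x : ℝ, x / s = x * (n + 1) := by intro x; rw [hs]; field_simp
  have hcu : ∀ x : ℝ, x / u = x * y := by intro x; rw [hu]; field_simp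
  have hpow : (c * L ^ 3) ^ 2 ≤ 1 / 4096 := by
    calc (c * L ^ 3) ^ 2 ≤ (1 / 64) ^ 2 := by gcongr
      _ = 1 / 4096 := by norm_num
  have big : c ^ 3 * L ^ 6 ≤ c / 4096 := by
    have : c ^ 3 * L ^ 6 = c * (c * L ^ 3) ^ 2 := by ring
    rw [this, div_eq_mul_one_div]
    exact mul_le_mul_of_nonneg_left hpow hc.le
  have low : ∀ m ≤ 6, c ^ 3 * L ^ m ≤ c / 4096 := fun m hm =>
    (mul_le_mul_of_nonneg_left (pow_le_pow_right₀ hL1 hm) (by positivity)).trans big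
  have cube : ∀ {z r : ℝ}, 0 ≤ z → z ≤ r → |z| ^ 3 ≤ r ^ 3 := by
    intro z r hz hzr
    rw [abs_of_nonneg hz]
    gcongr
  have b₁ : |e₁ - c * (n + 1)| ≤ c ^ 3 * L ^ 3 := by
    have h := abs_unit₁_sub_le (x := c) hspos
    rw [← he₁, hcs] at h
    refine h.trans ((cube (by positivity) (mul_le_mul_of_nonneg_left hn hc.le)).trans ?_)
    rw [mul_pow]
  have bP : |P - c * y| ≤ c ^ 3 * L ^ 3 := by
    have h := abs_unit₁_sub_le (x := c) hupos
    rw [← hP, hcu] at h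
    refine h.trans ((cube (by positivity) (mul_le_mul_of_nonneg_left hy hc.le)).trans ?_)
    rw [mul_pow]
  have e₁pos : 0 < e₁ := by rw [he₁]; exact unit₁_pos hc
  have e₁le : e₁ ≤ c * L := by
    rw [he₁, unit₁_eq_ratio hspos, hcs]
    have h : unit₁ (c * (n + 1)) 1 ≤ c * (n + 1) := by
      unfold unit₁
      refine div_le_self (by positivity) ?_
      rw [Real.one_le_sqrt]
      nlinarith [sq_nonneg (c * ((n : ℝ) + 1))]
    exact h.trans (mul_le_mul_of_nonneg_left hn hc.le)
  have gen : ∀ {z r : ℝ}, 0 ≤ r → r ≤ L → |z - e₁ * r| ≤ |e₁ * r| ^ 3 →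
      |z - c * ((n + 1) * r)| ≤ c / 2048 := by
    intro z r hr hrL hz
    have h1 : |e₁ * r| ^ 3 ≤ c ^ 3 * L ^ 6 := by
      refine (cube (by positivity) (mul_le_mul e₁le hrL hr (by positivity))).trans ?_
      exact le_of_eq (by ring)
    have h2 : |e₁ * r - c * ((n + 1) * r)| ≤ c ^ 3 * L ^ 4 := by
      have : e₁ * r - c * ((n + 1) * r) = (e₁ - c * (n + 1)) * r := by ring
      rw [this, abs_mul, abs_of_nonneg hr]
      calc |e₁ - c * (n + 1)| * r ≤ c ^ 3 * L ^ 3 * L :=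
            mul_le_mul b₁ hrL hr (by positivity)
        _ = c ^ 3 * L ^ 4 := by ring
    have h3 := abs_sub_le z (e₁ * r) (c * ((n + 1) * r))
    have := low 4 (by norm_num)
    linarith
  have b₂ : |e₂ - c * (((n : ℝ) + 1) * (n + 1))| ≤ c / 2048 := by
    refine gen (by positivity) hn ?_
    have h := abs_unit₁_sub_le (x := e₁) hspos
    rwa [← he₂, hcs] at h
  have bP' : |P' - c * (((n : ℝ) + 1) * y)| ≤ c / 2048 := by
    refine gen (by positivity) hy ?_
    have h := abs_unit₁_sub_le (x := e₁) hupos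
    rwa [← hP', hcu] at h
  have h3 := low 3 (by norm_num)
  obtain ⟨c1, c2⟩ := abs_le.1 b₁
  obtain ⟨c3, c4⟩ := abs_le.1 bP
  obtain ⟨c5, c6⟩ := abs_le.1 b₂
  obtain ⟨c7, c8⟩ := abs_le.1 bP'
  refine ⟨abs_le.2 ⟨?_, ?_⟩, abs_le.2 ⟨?_, ?_⟩, abs_le.2 ⟨?_, ?_⟩⟩ <;> linarith

/-- Normalizing a small number `z ≈ c r` together with `1` changes it very little. -/
lemma abs_unit₁_one_sub_le {c L r z : ℝ} (hc : 0 < c) (hL1 : 1 ≤ L) (hL : c * L ^ 3 ≤ 1 / 64)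
    (hr0 : 0 ≤ r) (hr : r ≤ L ^ 2) (hz : |z - c * r| ≤ c / 64) :
    |unit₁ z 1 - c * r| ≤ c / 32 ∧ |z| ≤ 2 * c * L ^ 2 := by
  have hcr : c * r ≤ c * L ^ 2 := mul_le_mul_of_nonneg_left hr hc.le
  have hcr0 : 0 ≤ c * r := by positivity
  have hcL : c ≤ c * L ^ 2 := le_mul_of_one_le_right hc.le (one_le_pow₀ hL1)
  obtain ⟨h1, h2⟩ := abs_le.1 hz
  have hz2 : |z| ≤ 2 * c * L ^ 2 := abs_le.2 ⟨by linarith, by linarith⟩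
  refine ⟨?_, hz2⟩
  have h3 := abs_unit₁_sub_le (x := z) one_pos
  rw [div_one] at h3
  have h4 : |z| ^ 3 ≤ c / 512 := by
    calc |z| ^ 3 ≤ (2 * c * L ^ 2) ^ 3 := by gcongr
      _ = 8 * c * (c * L ^ 3) ^ 2 := by ring
      _ ≤ 8 * c * (1 / 64) ^ 2 := by gcongr
      _ = c / 512 := by ring
  have h5 := abs_sub_le (unit₁ z 1) z (c * r)
  linarith

end RealEstimates

/-! ### Token indicators and positions -/

section Positions

variable {α : Type u} {norm : NormKind} {mk : Masking} {p : ℕ → ℕ} {t : ℕ}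

/-- The indicator of the padding tokens. -/
def padFeature : Feature α := fun w i => if w.length < i then 1 else 0

lemma tokenAt_eq_bos_iff (w : List α) (i : ℕ) : tokenAt w i = Token.bos ↔ i = 0 := by
  rcases i with _ | i
  · simp [tokenAt]
  · rcases lt_or_ge i w.length with h | h <;> simp [tokenAt, List.getD, h]

lemma tokenAt_eq_pad_iff (w : List α) (i : ℕ) : tokenAt w i = Token.pad ↔ w.length < i := by
  rcases i with _ | i
  · simp [tokenAt]
  · rcases lt_or_ge i w.length with h | h <;> simp [tokenAt, List.getD, h]

lemma tokenAt_eq_sym_iff (w : List α) (i : ℕ) (a : α) :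
    tokenAt w i = Token.sym a ↔ 1 ≤ i ∧ w[i - 1]? = some a := by
  rcases i with _ | i
  · simp [tokenAt]
  · rcases lt_or_ge i w.length with h | h <;> simp [tokenAt, List.getD, h]

/-- The space `S` contains the constants and the indicators of the kinds of tokens. -/
structure HasTokens (S : Submodule ℚ (Feature α)) : Prop where
  one : 1 ∈ S
  bos : bosFeature ∈ S
  pad : padFeature ∈ S
  sym : ∀ a : α, tokenFeature (Token.sym a) ∈ S

lemma HasTokens.mono {S S' : Submodule ℚ (Feature α)} (h : S ≤ S') (hS : HasTokens S) :
    HasTokens S' :=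
  ⟨h hS.one, h hS.bos, h hS.pad, fun a => h (hS.sym a)⟩

lemma HasTokens.normable_bos {S : Submodule ℚ (Feature α)} (hS : HasTokens S) :
    Normable p S bosFeature :=
  Normable.of_zero_or_one hS.bos hS.one fun w i _ => by unfold bosFeature; split_ifs <;> simp

lemma HasTokens.normable_pad {S : Submodule ℚ (Feature α)} (hS : HasTokens S) :
    Normable p S padFeature :=
  Normable.of_zero_or_one hS.pad hS.one fun w i _ => by unfold padFeature; split_ifs <;> simp

lemma tokenFeature_zero_or_one (x : Token α) (w : List α) (i : ℕ) :
    tokenFeature x w i = 0 ∨ tokenFeature x w i = 1 := by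
  unfold tokenFeature; split_ifs <;> simp

lemma HasTokens.normable_sym {S : Submodule ℚ (Feature α)} (hS : HasTokens S) (a : α) :
    Normable p S (tokenFeature (Token.sym a)) :=
  Normable.of_zero_or_one (hS.sym a) hS.one fun w i _ => tokenFeature_zero_or_one _ w i

/-- Before the first layer, the token embedding provides the indicators of the tokens. -/
lemma exists_reach_tokens [Finite α] :
    ∃ S : Submodule ℚ (Feature α), Reach norm mk p 0 S ∧ HasTokens S ∧ posFeature mk ∈ S := by
  classical
  obtain ⟨m, ⟨e⟩⟩ := Finite.exists_equiv_fin α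
  let x : Option (Option (Fin m)) → Token α :=
    fun y => y.elim Token.bos fun y => y.elim Token.pad fun y => Token.sym (e.symm y)
  set F : Option (Option (Option (Fin m))) → Feature α :=
    fun y => y.elim (posFeature mk) (fun y => tokenFeature (x y)) with hF
  have gen : ∀ y, F y ∈ combinations p F := fun y =>
    ⟨Pi.single y 1, fun w i _ => by simp [Pi.single_apply, apply_ite (Rat.cast : ℚ → ℝ)]⟩
  refine ⟨_, ⟨_, _, F, realizable_init x, rfl⟩, ⟨?_, ?_, ?_, ?_⟩, gen none⟩
  · refine ⟨fun y => y.elim 0 fun _ => 1, fun w i _ => ?_⟩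
    have hx : ∃ y, tokenAt w i = x y := by
      cases tokenAt w i with
      | bos => exact ⟨none, rfl⟩
      | pad => exact ⟨some none, rfl⟩
      | sym a => exact ⟨some (some (e a)), by simp [x]⟩
    have hinj : Injective x := by
      rintro (_ | _ | y) (_ | _ | z) h <;> simp_all [x]
    obtain ⟨y, hy⟩ := hx
    simp [hF, tokenFeature, hy, hinj.eq_iff]
  · convert gen (some none) using 1
    funext w i
    simp [hF, bosFeature, tokenFeature, x, tokenAt_eq_bos_iff]
  · convert gen (some (some none)) using 1
    funext w i
    simp [hF, padFeature, tokenFeature, x, tokenAt_eq_pad_iff]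
  · intro a
    convert gen (some (some (some (e a)))) using 1
    simp [hF, x]

/-- The reciprocal of the (1-based) position. -/
def recipFeature : Feature α := fun _ i => 1 / ((i : ℝ) + 1)

/-- With causal masking the reciprocal of the position is the average of the indicator of the
beginning-of-sequence token. -/
lemma exists_reach_recip [Finite α] :
    ∃ S : Submodule ℚ (Feature α), Reach norm mk p 1 S ∧ HasTokens S ∧ recipFeature ∈ S := by
  obtain ⟨S, hS, hT, hpos⟩ := exists_reach_tokens (α := α) (norm := norm) (mk := mk) (p := p)
  obtain ⟨S', hSS', hS', hv⟩ := hS.attention hT.one (η := Unit) (Λ := Empty) (Ω := Unit)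
    (q := fun _ l => l.elim) (k := fun _ l => l.elim) (v := fun _ _ => bosFeature)
    (fun _ l => l.elim) (fun _ l => l.elim) (fun _ _ => hT.normable_bos.mem)
  refine ⟨S', hS', hT.mono hSS', ?_⟩
  cases mk with
  | unmasked => exact hSS' hpos
  | causal =>
    refine hS'.mem_of_agreeOn (hv () ()) fun w i hi => ?_
    rw [attnFeature_eq_average (mk := Masking.causal) (p := p) (w := w) (i := i)
      (A := Finset.range (i + 1)) (c := 0) (fun _ h => h) ⟨0, by simp⟩
      (fun _ _ => Finset.sum_of_isEmpty _) (fun j hj hj' => absurd hj hj')]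
    simp [bosFeature, recipFeature]

/-- The reciprocal of `n + 1`, at the padding tokens: the average of the indicator of the
beginning-of-sequence token over all visible tokens that are not padding. -/
def invLengthFeature (mk : Masking) (p : ℕ → ℕ) : Feature α :=
  attnFeature mk p (fun _ : Unit => 1) (fun _ : Unit => -padFeature) bosFeature

lemma invLengthFeature_spec {w : List α} {i : ℕ} (hi : i < seqLen p w) :
    0 < invLengthFeature mk p w i ∧
      (w.length < i → invLengthFeature mk p w i = 1 / ((w.length : ℝ) + 1)) := by
  classical
  have h0 : 0 ∈ (mk.visible (seqLen p w) i).filter (· ≤ w.length) :=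
    Finset.mem_filter.2 ⟨mem_visible_of_le hi (Nat.zero_le _), Nat.zero_le _⟩
  have key : invLengthFeature mk p w i =
      1 / (((mk.visible (seqLen p w) i).filter (· ≤ w.length)).card : ℝ) := by
    rw [invLengthFeature, attnFeature_eq_average
      (A := (mk.visible (seqLen p w) i).filter (· ≤ w.length)) (c := 0)
      (Finset.filter_subset _ _) ⟨0, h0⟩]
    · congr 1
      simp only [bosFeature]
      rw [Finset.sum_ite_eq' _ 0, if_pos h0]
    · intro j hj
      simp [padFeature, (Finset.mem_filter.1 hj).2]
    · intro j hj hj'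
      have : w.length < j := by
        by_contra h
        exact hj' (Finset.mem_filter.2 ⟨hj, not_lt.1 h⟩)
      simp [padFeature, this]
  refine ⟨?_, fun hw => ?_⟩
  · rw [key]
    have := Finset.card_pos.2 ⟨0, h0⟩
    positivity
  · have : (mk.visible (seqLen p w) i).filter (· ≤ w.length) = Finset.range (w.length + 1) := by
      ext j
      simp only [Finset.mem_filter, Finset.mem_range]
      constructor
      · rintro ⟨_, h⟩
        omega
      · intro h
        exact ⟨mem_visible_of_le hi (by omega), by omega⟩
    rw [key, this, Finset.card_range]
    push_cast
    rfl

lemma Reach.invLength {S : Submodule ℚ (Feature α)} (hS : Reach norm mk p t S)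
    (hT : HasTokens S) :
    ∃ S', S ≤ S' ∧ Reach norm mk p (t + 1) S' ∧ invLengthFeature mk p ∈ S' := by
  obtain ⟨S', h1, h2, h3⟩ := hS.attention hT.one (η := Unit) (Λ := Unit) (Ω := Unit)
    (q := fun _ _ => 1) (k := fun _ _ => -padFeature) (v := fun _ _ => bosFeature)
    (fun _ _ => (normable_one hT.one).mem) (fun _ _ => Submodule.neg_mem _ hT.normable_pad.mem)
    (fun _ _ => hT.normable_bos.mem)
  exact ⟨S', h1, h2, h3 () ()⟩

/-- One normalization per step, of the pair `(x, 1)`. -/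
lemma Reach.shrink_iterate {S : Submodule ℚ (Feature α)} (hS : Reach norm mk p t S)
    (h1 : 1 ∈ S) {f : Feature α} (hf : f ∈ S) (m : ℕ) :
    ∃ S', S ≤ S' ∧ Reach norm mk p (t + m) S' ∧ (fun w i => shrink^[m] (f w i)) ∈ S' := by
  induction m with
  | zero => exact ⟨S, le_rfl, hS, hf⟩
  | succ m ih =>
    obtain ⟨S₁, hS₁, hR₁, hm⟩ := ih
    obtain ⟨S₂, hS₂, hR₂, _, _, h2, _⟩ := hR₁.normalizePair hm (hS₁ h1)
      (fun _ _ _ => one_pos)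
    refine ⟨S₂, hS₁.trans hS₂, hR₂, ?_⟩
    convert S₂.sub_mem (hS₂ (hS₁ h1)) h2 using 1
    funext w i
    rw [iterate_succ_apply']
    rfl

/-! ### Approximate arithmetic at the padding tokens -/

/-- The position of the padding token number `a` (counting from `0`). -/
def padPos (w : List α) (a : ℕ) : ℕ := w.length + 1 + a

lemma padPos_lt {w : List α} {a : ℕ} (ha : a < p w.length) : padPos w a < seqLen p w := by
  unfold padPos seqLen; omega

/-- In the space `S` there are a scale `c`, the same at all padding tokens of a run and tiny
compared with its length, and approximations `A ≈ c a`, `B ≈ c n a`, `E ≈ c n` at the padding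
token number `a`.  Of `A` and `B`, the directions of `(A, 1)` and `(B, 1)` are available. -/
structure Scaled (mk : Masking) (p : ℕ → ℕ) (S : Submodule ℚ (Feature α))
    (c A B E : Feature α) (cv : List α → ℝ) : Prop where
  tokens : HasTokens S
  invLength : invLengthFeature mk p ∈ S
  c_mem : c ∈ S
  E_mem : E ∈ S
  A₁ : (fun w i => unit₁ (A w i) 1) ∈ S
  A₁_normable : Normable p S (fun w i => unit₁ (A w i) 1)
  B₁ : (fun w i => unit₁ (B w i) 1) ∈ S
  B₁_normable : Normable p S (fun w i => unit₁ (B w i) 1)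
  B₂_normable : Normable p S (fun w i => unit₂ (B w i) 1)
  pos₁ : (fun (_ : List α) (i : ℕ) => unit₁ ((i : ℝ) + 1) 1) ∈ S
  pos₁_normable : Normable p S (fun (_ : List α) i => unit₁ ((i : ℝ) + 1) 1)
  pos₂_normable : Normable p S (fun (_ : List α) i => unit₂ ((i : ℝ) + 1) 1)
  c_pos : ∀ w i, i < seqLen p w → 0 < c w i
  cv_small : ∀ w, 0 < p w.length → 0 < cv w ∧ cv w * (seqLen p w : ℝ) ^ 3 ≤ 1 / 64
  c_eq : ∀ w a, a < p w.length → c w (padPos w a) = cv w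
  A_approx : ∀ w a, a < p w.length → |A w (padPos w a) - cv w * a| ≤ cv w / 64
  B_approx : ∀ w a, a < p w.length →
    |B w (padPos w a) - cv w * ((w.length : ℝ) * a)| ≤ cv w / 64
  E_approx : ∀ w a, a < p w.length → |E w (padPos w a) - cv w * w.length| ≤ cv w / 64

lemma Scaled.mono {S S' : Submodule ℚ (Feature α)} {c A B E : Feature α} {cv : List α → ℝ}
    (h : S ≤ S') (hS : Scaled mk p S c A B E cv) : Scaled mk p S' c A B E cv where
  tokens := hS.tokens.mono h
  invLength := h hS.invLength
  c_mem := h hS.c_mem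
  E_mem := h hS.E_mem
  A₁ := h hS.A₁
  A₁_normable := hS.A₁_normable.mono h
  B₁ := h hS.B₁
  B₁_normable := hS.B₁_normable.mono h
  B₂_normable := hS.B₂_normable.mono h
  pos₁ := h hS.pos₁
  pos₁_normable := hS.pos₁_normable.mono h
  pos₂_normable := hS.pos₂_normable.mono h
  c_pos := hS.c_pos
  cv_small := hS.cv_small
  c_eq := hS.c_eq
  A_approx := hS.A_approx
  B_approx := hS.B_approx
  E_approx := hS.E_approx

lemma seqLen_le {k K : ℕ} (hk : 1 ≤ k) (w : List α) :
    seqLen (fun n => (K + 1) * n ^ k) w ≤ (K + 2) * (w.length + 1) ^ k := by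
  have h1 : w.length + 1 ≤ (w.length + 1) ^ k := Nat.le_self_pow (by omega) _
  have h2 : (K + 1) * w.length ^ k ≤ (K + 1) * (w.length + 1) ^ k :=
    Nat.mul_le_mul_left _ (Nat.pow_le_pow_left (by omega) _)
  change 1 + w.length + (K + 1) * w.length ^ k ≤ _
  have : (K + 2) * (w.length + 1) ^ k = (K + 1) * (w.length + 1) ^ k + (w.length + 1) ^ k := by
    ring
  omega

/-- Since `c` is tiny, the direction of `(c, s)` with `s = 1 / (n + 1)` has first coordinate about
`c (n + 1)`, and that of `(c, u)` with `u = 1 / (i + 1)` has first coordinate about `c (i + 1)`.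
In this way products with `n + 1` and with `i + 1` are formed without a multiplication; at the
padding token number `a`, `i + 1 = n + 1 + (a + 1)`. -/
lemma exists_reach_scaled [Finite α] {k : ℕ} (hk : 1 ≤ k) (K : ℕ) :
    ∃ (S : Submodule ℚ (Feature α)) (c A B E : Feature α) (cv : List α → ℝ),
      Reach norm mk (fun n => (K + 1) * n ^ k) (3 * k + 9) S ∧
      Scaled mk (fun n => (K + 1) * n ^ k) S c A B E cv := by
  set p : ℕ → ℕ := fun n => (K + 1) * n ^ k with hp
  obtain ⟨S₀, hR₀, hT₀, hu₀⟩ := exists_reach_recip (α := α) (norm := norm) (mk := mk) (p := p)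
  obtain ⟨S₁, hS₁, hR₁, hs₁⟩ := hR₀.invLength hT₀
  obtain ⟨S₂, hS₂, hR₂, hc₂⟩ := hR₁.shrink_iterate (hS₁ hT₀.one) hs₁ (3 * k)
  -- The scale has to be small compared with a power of the number of tokens, which is at most
  -- `(K + 2) (n + 1) ^ k`.
  set r : ℚ := 1 / (64 * (K + 2) ^ 3) with hr
  set s : Feature α := invLengthFeature mk p with hs
  set c : Feature α := fun w i => (r : ℝ) * shrink^[3 * k] (s w i) with hc
  have hrpos : 0 < (r : ℝ) := by
    rw [hr]; push_cast; positivity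
  have hspos : ∀ w i, i < seqLen p w → 0 < s w i := fun w i hi => (invLengthFeature_spec hi).1
  have hupos : ∀ w i, i < seqLen p w → 0 < (recipFeature : Feature α) w i := fun w i _ => by
    unfold recipFeature; positivity
  have hcpos : ∀ w i, i < seqLen p w → 0 < c w i := fun w i hi =>
    mul_pos hrpos (shrink_iterate_pos (hspos w i hi) _)
  have hcmem : c ∈ S₂ := by
    convert S₂.smul_mem r hc₂ using 1
    funext w i
    simp [hc, Rat.smul_def]
  have hs₂ := hS₂ hs₁
  have hu₂ := hS₂ (hS₁ hu₀)
  obtain ⟨S₃, hS₃, hR₃, he₁, -⟩ := hR₂.normalizePair hcmem hs₂ hspos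
  set e₁ : Feature α := fun w i => unit₁ (c w i) (s w i) with he₁def
  obtain ⟨S₄, hS₄, hR₄, he₂, -⟩ := hR₃.normalizePair he₁ (hS₃ hs₂) hspos
  set e₂ : Feature α := fun w i => unit₁ (e₁ w i) (s w i) with he₂def
  obtain ⟨S₅, hS₅, hR₅, hP, -⟩ := hR₄.normalizePair (hS₄ (hS₃ hcmem)) (hS₄ (hS₃ hu₂)) hupos
  set P : Feature α := fun w i => unit₁ (c w i) (recipFeature w i) with hPdef
  obtain ⟨S₆, hS₆, hR₆, hP', -⟩ := hR₅.normalizePair (hS₅ (hS₄ he₁))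
    (hS₅ (hS₄ (hS₃ hu₂))) hupos
  set P' : Feature α := fun w i => unit₁ (e₁ w i) (recipFeature w i) with hP'def
  have hle₂ : S₂ ≤ S₆ := hS₃.trans (hS₄.trans (hS₅.trans hS₆))
  have hle₁ : S₀ ≤ S₆ := hS₁.trans (hS₂.trans hle₂)
  have he₁' : e₁ ∈ S₆ := hS₆ (hS₅ (hS₄ he₁))
  have hA : P - e₁ - c ∈ S₆ :=
    S₆.sub_mem (S₆.sub_mem (hS₆ hP) he₁') (hle₂ hcmem)
  have hB : P' - e₂ - P + c ∈ S₆ :=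
    S₆.add_mem (S₆.sub_mem (S₆.sub_mem hP' (hS₆ (hS₅ he₂))) (hS₆ hP)) (hle₂ hcmem)
  have hE : e₁ - c ∈ S₆ := S₆.sub_mem he₁' (hle₂ hcmem)
  obtain ⟨S₇, hS₇, hR₇, hA₁, hA₁n, -⟩ := hR₆.normalizePair hA (hle₁ hT₀.one)
    (fun _ _ _ => one_pos)
  obtain ⟨S₈, hS₈, hR₈, hB₁, hB₁n, -, hB₂n⟩ := hR₇.normalizePair (hS₇ hB)
    (hS₇ (hle₁ hT₀.one)) (fun _ _ _ => one_pos)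
  obtain ⟨S₉, hS₉, hR₉, hφ₁, hφ₁n, -, hφ₂n⟩ := hR₈.normalizePair
    (hS₈ (hS₇ (hle₁ hT₀.one))) (hS₈ (hS₇ (hle₂ hu₂))) hupos
  have hle : S₆ ≤ S₉ := hS₇.trans (hS₈.trans hS₉)
  have ratio : ∀ i : ℕ, (1 : ℝ) / (1 / ((i : ℝ) + 1)) = (i : ℝ) + 1 := fun i => by
    rw [one_div_one_div]
  have e1 : (fun w i => unit₁ ((1 : Feature α) w i) (recipFeature w i)) =
      fun (_ : List α) (i : ℕ) => unit₁ ((i : ℝ) + 1) 1 := by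
    funext w i
    rw [unit₁_eq_ratio (by unfold recipFeature; positivity)]
    simp [recipFeature]
  have e2 : (fun w i => unit₂ ((1 : Feature α) w i) (recipFeature w i)) =
      fun (_ : List α) (i : ℕ) => unit₂ ((i : ℝ) + 1) 1 := by
    funext w i
    rw [unit₂_eq_ratio (by unfold recipFeature; positivity)]
    simp [recipFeature]
  rw [e1] at hφ₁ hφ₁n
  rw [e2] at hφ₂n
  set cv : List α → ℝ := fun w => (r : ℝ) * shrink^[3 * k] (1 / ((w.length : ℝ) + 1)) with hcv
  have hspad : ∀ w a, a < p w.length → s w (padPos w a) = 1 / ((w.length : ℝ) + 1) :=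
    fun w a ha => (invLengthFeature_spec (padPos_lt ha)).2 (by unfold padPos; omega)
  have hcvpos : ∀ w, 0 < cv w := fun w => mul_pos hrpos (shrink_iterate_pos (by positivity) _)
  have hceq : ∀ w a, a < p w.length → c w (padPos w a) = cv w := fun w a ha => by
    simp only [hc, hcv, hspad w a ha]
  have hcvsmall : ∀ w, cv w * (seqLen p w : ℝ) ^ 3 ≤ 1 / 64 := by
    intro w
    have hn : (1 : ℝ) ≤ (w.length : ℝ) + 1 := by
      have : (0 : ℝ) ≤ w.length := Nat.cast_nonneg _
      linarith
    have h1 : cv w ≤ r * (1 / ((w.length : ℝ) + 1)) ^ (3 * k) := by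
      refine mul_le_mul_of_nonneg_left ?_ hrpos.le
      refine (shrink_iterate_le (by positivity) ?_ _).trans ?_
      · rw [div_le_one (by positivity)]; exact hn
      · refine pow_le_pow_of_le_one (by positivity) ?_ (by omega)
        rw [div_le_one (by positivity)]; exact hn
    have h2 : (seqLen p w : ℝ) ≤ (K + 2) * ((w.length : ℝ) + 1) ^ k := by
      exact_mod_cast seqLen_le hk w
    calc cv w * (seqLen p w : ℝ) ^ 3
        ≤ r * (1 / ((w.length : ℝ) + 1)) ^ (3 * k) * ((K + 2) * ((w.length : ℝ) + 1) ^ k) ^ 3 := by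
          gcongr
      _ = 1 / 64 := by
          rw [hr]
          push_cast
          rw [mul_pow, ← pow_mul, mul_comm k 3, one_div_pow]
          field_simp
  have approx := fun (w : List α) (a : ℕ) (ha : a < p w.length) =>
    approx_multiples (n := w.length) (y := padPos w a + 1) (c := cv w) (L := seqLen p w)
      (s := s w (padPos w a)) (u := (recipFeature : Feature α) w (padPos w a))
      (e₁ := e₁ w (padPos w a)) (e₂ := e₂ w (padPos w a)) (P := P w (padPos w a))
      (P' := P' w (padPos w a)) (hcvpos w)
      (by
        have : w.length + 1 ≤ seqLen p w := by unfold seqLen; omega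
        exact_mod_cast this)
      (by omega) (by exact_mod_cast padPos_lt ha) (hcvsmall w) (hspad w a ha)
      (by simp [recipFeature]) (by simp only [he₁def, hceq w a ha]) rfl
      (by simp only [hPdef, hceq w a ha]) rfl
  have hpos : ∀ (w : List α) (a : ℕ), ((padPos w a + 1 : ℕ) : ℝ) - w.length - 2 = a := by
    intro w a
    unfold padPos
    push_cast
    ring
  refine ⟨S₉, c, P - e₁ - c, P' - e₂ - P + c, e₁ - c, cv, ?_, ?_⟩
  · have : 3 * k + 9 = 1 + 1 + 3 * k + 1 + 1 + 1 + 1 + 1 + 1 + 1 := by ring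
    rw [this]
    exact hR₉
  · exact
    { tokens := hT₀.mono (hle₁.trans hle)
      invLength := hle (hle₂ hs₂)
      c_mem := hle (hle₂ hcmem)
      E_mem := hle hE
      A₁ := hS₉ (hS₈ hA₁)
      A₁_normable := (hA₁n.mono hS₈).mono hS₉
      B₁ := hS₉ hB₁
      B₁_normable := hB₁n.mono hS₉
      B₂_normable := hB₂n.mono hS₉
      pos₁ := hφ₁
      pos₁_normable := hφ₁n
      pos₂_normable := hφ₂n
      c_pos := hcpos
      cv_small := fun w _ => ⟨hcvpos w, hcvsmall w⟩
      c_eq := hceq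
      A_approx := fun w a ha => by
        have := (approx w a ha).1
        rw [hpos] at this
        simpa only [Pi.sub_apply, hceq w a ha] using this
      B_approx := fun w a ha => by
        have := (approx w a ha).2.1
        rw [hpos] at this
        simpa only [Pi.sub_apply, Pi.add_apply, hceq w a ha] using this
      E_approx := fun w a ha => by
        have := (approx w a ha).2.2
        simpa only [Pi.sub_apply, hceq w a ha] using this }

end Positions

/-! ### Division with remainder -/

section Quotients

variable {α : Type u} {norm : NormKind} {mk : Masking} {p : ℕ → ℕ} {t : ℕ}

lemma exists_padPos_of_lt {w : List α} {j : ℕ} (hj : j < seqLen p w) (hw : w.length < j) :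
    ∃ x, x < p w.length ∧ j = padPos w x :=
  ⟨j - (w.length + 1), by unfold seqLen at hj; omega, by unfold padPos; omega⟩

lemma abs_dot_unit_le_one {a b c d : ℝ} (h1 : a ^ 2 + b ^ 2 = 1) (h2 : c ^ 2 + d ^ 2 = 1) :
    |a * c + b * d| ≤ 1 := by
  rw [abs_le]
  constructor <;> nlinarith [sq_nonneg (a + c), sq_nonneg (b + d), sq_nonneg (a - c),
    sq_nonneg (b - d)]

lemma abs_dirDot_le_one (y b : ℝ) : |dirDot y b| ≤ 1 :=
  abs_dot_unit_le_one (unit_sq_add_sq one_pos) (unit_sq_add_sq one_pos)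

/-- The features `X ≈ c q` and `X' ≈ c n q` for the quotient `q` of `a` by `n ^ r`. -/
structure ApproxQuotient (p : ℕ → ℕ) (S : Submodule ℚ (Feature α)) (cv : List α → ℝ) (r : ℕ)
    (X X' : Feature α) : Prop where
  mem : X ∈ S
  mem' : X' ∈ S
  approx : ∀ w a, a < p w.length →
    |X w (padPos w a) - cv w * (a / w.length ^ r : ℕ)| ≤ cv w / 32
  approx' : ∀ w a, a < p w.length →
    |X' w (padPos w a) - cv w * (w.length * (a / w.length ^ r : ℕ))| ≤ cv w / 32

lemma ApproxQuotient.mono {S S' : Submodule ℚ (Feature α)} (h : S ≤ S') {cv : List α → ℝ} {r : ℕ}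
    {X X' : Feature α} (hX : ApproxQuotient p S cv r X X') : ApproxQuotient p S' cv r X X' :=
  ⟨h hX.mem, h hX.mem', hX.approx, hX.approx'⟩

variable {S : Submodule ℚ (Feature α)} {c A B E : Feature α} {cv : List α → ℝ}

/-- As the numbers `A` and `B` are tiny, they differ from the first coordinates of the directions of
`(A, 1)` and `(B, 1)` by much less than the scale. -/
lemma Scaled.unit_approx (h : Scaled mk p S c A B E cv) {w : List α} {a : ℕ}
    (ha : a < p w.length) :
    |unit₁ (A w (padPos w a)) 1 - cv w * a| ≤ cv w / 32 ∧
    |unit₁ (B w (padPos w a)) 1 - cv w * (w.length * a)| ≤ cv w / 32 ∧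
    |B w (padPos w a)| ≤ 2 * cv w * (seqLen p w : ℝ) ^ 2 := by
  obtain ⟨hc, hL⟩ := h.cv_small w (by omega)
  have haL : (a : ℝ) ≤ seqLen p w := by
    have : a ≤ seqLen p w := by unfold seqLen; omega
    exact_mod_cast this
  have hnL : (w.length : ℝ) ≤ seqLen p w := by
    have : w.length ≤ seqLen p w := by unfold seqLen; omega
    exact_mod_cast this
  have hL1 : (1 : ℝ) ≤ seqLen p w := by
    have : 1 ≤ seqLen p w := by unfold seqLen; omega
    exact_mod_cast this
  have ha0 : (0 : ℝ) ≤ a := Nat.cast_nonneg _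
  have hn0 : (0 : ℝ) ≤ w.length := Nat.cast_nonneg _
  have h1 := abs_unit₁_one_sub_le hc hL1 hL ha0
    (haL.trans (le_self_pow₀ hL1 two_ne_zero)) (h.A_approx w a ha)
  have h2 := abs_unit₁_one_sub_le hc hL1 hL (mul_nonneg hn0 ha0)
    (by rw [pow_two]; exact mul_le_mul hnL haL ha0 (by positivity)) (h.B_approx w a ha)
  exact ⟨h1.1, h2.1, h2.2⟩

/-- Division by `n` in two layers: the padding token whose current number is `q` attends to the
padding token number `q / n`, which is found by rounding. -/
lemma Reach.divide (hS : Reach norm mk p t S) (h : Scaled mk p S c A B E cv)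
    (hp : ∀ n, 0 < p n → 0 < n) {r : ℕ} {X X' : Feature α} (hX : ApproxQuotient p S cv r X X') :
    ∃ S', S ≤ S' ∧ Reach norm mk p (t + 2) S' ∧
      ∃ Z Z', ApproxQuotient p S' cv (r + 1) Z Z' := by
  set Y : Feature α := X - (1 / 2 : ℚ) • (E - c) with hY
  have hYmem : Y ∈ S := S.sub_mem hX.mem (S.smul_mem _ (S.sub_mem h.E_mem h.c_mem))
  obtain ⟨S₁, hS₁, hR₁, -, hY₁, -, hY₂⟩ := hS.normalizePair hYmem h.tokens.one
    (fun _ _ _ => one_pos)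
  have h' := h.mono hS₁
  have hone := (normable_one (p := p) h'.tokens.one).mem
  obtain ⟨S₂, hS₂, hR₂, hv⟩ := hR₁.attention h'.tokens.one (η := Unit) (Λ := Fin 3) (Ω := Bool)
    (q := fun _ => ![fun w i => unit₁ (Y w i) 1, fun w i => unit₂ (Y w i) 1, 1])
    (k := fun _ => ![fun w i => unit₁ (B w i) 1, fun w i => unit₂ (B w i) 1,
      (4 : ℚ) • (padFeature - 1)])
    (v := fun _ b => if b then fun w i => unit₁ (A w i) 1 else fun w i => unit₁ (B w i) 1)
    (by intro _ l; fin_cases l; exacts [hY₁.mem, hY₂.mem, hone])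
    (by
      intro _ l
      fin_cases l
      exacts [h'.B₁_normable.mem, h'.B₂_normable.mem, Submodule.smul_mem _ _
        (Submodule.sub_mem _ h'.tokens.normable_pad.mem hone)])
    (by
      intro _ b
      cases b
      exacts [h'.B₁_normable.mem, h'.A₁_normable.mem])
  have key : ∀ (v : Feature α) w a, a < p w.length →
      attnFeature mk p ![fun w i => unit₁ (Y w i) 1, fun w i => unit₂ (Y w i) 1, 1]
        ![fun w i => unit₁ (B w i) 1, fun w i => unit₂ (B w i) 1, (4 : ℚ) • (padFeature - 1)]
        v w (padPos w a) = v w (padPos w (a / w.length ^ (r + 1))) := by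
    intro v w a ha
    obtain ⟨hc, hL⟩ := h.cv_small w (by omega)
    have hn : 0 < w.length := hp _ (by omega)
    have hdiv : a / w.length ^ (r + 1) = a / w.length ^ r / w.length := by
      rw [pow_succ, Nat.div_div_eq_div_mul]
    have hle : a / w.length ^ (r + 1) ≤ a := Nat.div_le_self _ _
    have hqle : a / w.length ^ r ≤ a := Nat.div_le_self _ _
    set q := a / w.length ^ r with hq
    set x₀ := a / w.length ^ (r + 1) with hx₀
    have score : ∀ j, ∑ l : Fin 3,
        (![fun w i => unit₁ (Y w i) 1, fun w i => unit₂ (Y w i) 1, 1] : Fin 3 → Feature α) l w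
            (padPos w a) *
          (![fun w i => unit₁ (B w i) 1, fun w i => unit₂ (B w i) 1,
            (4 : ℚ) • (padFeature - 1)] : Fin 3 → Feature α) l w j =
        dirDot (Y w (padPos w a)) (B w j) + 4 * (padFeature w j - 1) := by
      intro j
      simp [Fin.sum_univ_three, dirDot, Rat.smul_def]
    have hpad : ∀ x, (padFeature : Feature α) w (padPos w x) = 1 := by
      intro x
      exact if_pos (by unfold padPos; omega)
    set i := padPos w a with hi
    have hL1 : (1 : ℝ) ≤ seqLen p w := by
      have : 1 ≤ seqLen p w := by unfold seqLen; omega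
      exact_mod_cast this
    have haL : (a : ℝ) ≤ seqLen p w := by
      have : a ≤ seqLen p w := by unfold seqLen; omega
      exact_mod_cast this
    have hnL : (w.length : ℝ) ≤ seqLen p w := by
      have : w.length ≤ seqLen p w := by unfold seqLen; omega
      exact_mod_cast this
    have hn1 : (1 : ℝ) ≤ w.length := by exact_mod_cast hn
    have hqL : (q : ℝ) ≤ seqLen p w := le_trans (by exact_mod_cast hqle) haL
    have hq0 : (0 : ℝ) ≤ q := Nat.cast_nonneg _
    set L : ℝ := (seqLen p w : ℝ) with hLdef
    have hcL3 : cv w * L ≤ 1 / 64 :=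
      (mul_le_mul_of_nonneg_left (le_self_pow₀ hL1 (by norm_num)) hc.le).trans hL
    have hcL2 : cv w * L ^ 2 ≤ 1 / 64 :=
      (mul_le_mul_of_nonneg_left (pow_le_pow_right₀ hL1 (by norm_num)) hc.le).trans hL
    have hc64 : cv w ≤ 1 / 64 := (le_mul_of_one_le_right hc.le hL1).trans hcL3
    have hYval : Y w i = X w i - 1 / 2 * (E w i - cv w) := by
      rw [← h.c_eq w a ha]
      simp [hY, Rat.smul_def, hi]
    obtain ⟨x1, x2⟩ := abs_le.1 (hX.approx w a ha)
    obtain ⟨e1, e2⟩ := abs_le.1 (h.E_approx w a ha)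
    have hmod : (q : ℝ) = w.length * x₀ + (q % w.length : ℕ) := by
      rw [hdiv]
      exact_mod_cast (Nat.div_add_mod q w.length).symm
    have hYapprox : |Y w i - cv w * (w.length * x₀ + (q % w.length : ℕ) -
        ((w.length : ℝ) - 1) / 2)| ≤ cv w / 16 := by
      rw [← hmod, hYval, abs_le]
      constructor <;> linarith
    have hYsmall : |Y w i| ≤ 1 / 2 := by
      have h1 : cv w * q ≤ 1 / 64 := (mul_le_mul_of_nonneg_left hqL hc.le).trans hcL3
      have h2 : cv w * w.length ≤ 1 / 64 := (mul_le_mul_of_nonneg_left hnL hc.le).trans hcL3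
      have h3 : 0 ≤ cv w * q := by positivity
      have h4 : 0 ≤ cv w * w.length := by positivity
      rw [hYval, abs_le]
      constructor <;> linarith
    have hBsmall : ∀ x, x < p w.length → |B w (padPos w x)| ≤ 1 / 32 := by
      intro x hx
      have := (h.unit_approx hx).2.2
      linarith
    have hBapprox : ∀ x, x < p w.length →
        |B w (padPos w x) - cv w * (w.length * x)| ≤ cv w / 16 := by
      intro x hx
      have := h.B_approx w x hx
      linarith
    have hx₀p : x₀ < p w.length := by omega
    refine attnFeature_eq_of_unique (mem_visible_of_le (padPos_lt ha) (by
      simp only [hi, padPos]; omega)) fun j hj hj0 => ?_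
    rw [score, score, hpad]
    have hjN := lt_of_mem_visible (padPos_lt ha) hj
    rcases lt_or_ge w.length j with hwj | hwj
    · obtain ⟨x, hx, rfl⟩ := exists_padPos_of_lt hjN hwj
      rw [hpad]
      have hxne : x ≠ x₀ := by
        rintro rfl
        exact hj0 rfl
      have hnB : w.length * B w (padPos w x) ^ 2 ≤ 1 := by
        have h1 := (h.unit_approx hx).2.2
        calc w.length * B w (padPos w x) ^ 2 ≤ L * (2 * cv w * L ^ 2) ^ 2 := by
              refine mul_le_mul hnL ?_ (sq_nonneg _) (by positivity)
              rw [← sq_abs]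
              gcongr
          _ = 4 * (cv w * L ^ 3) * (cv w * L ^ 2) := by ring
          _ ≤ 4 * (1 / 64) * (1 / 64) := by gcongr
          _ ≤ 1 := by norm_num
      have := dirDot_lt_of_div (Nat.mod_lt q hn) hxne hc hYapprox (hBapprox x₀ hx₀p)
        (hBapprox x hx) hnB hYsmall ((hBsmall x₀ hx₀p).trans (by norm_num))
      linarith
    · have hz : (padFeature : Feature α) w j = 0 := if_neg (by omega)
      rw [hz]
      have h1 := (abs_le.1 (abs_dirDot_le_one (Y w i) (B w j))).2
      have h2 := (abs_le.1 (abs_dirDot_le_one (Y w i) (B w (padPos w x₀)))).1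
      linarith
  refine ⟨S₂, hS₁.trans hS₂, hR₂, _, _, hv () true, hv () false, fun w a ha => ?_,
    fun w a ha => ?_⟩
  · rw [key _ w a ha]
    exact (h.unit_approx (lt_of_le_of_lt (Nat.div_le_self _ _) ha)).1
  · rw [key _ w a ha]
    exact (h.unit_approx (lt_of_le_of_lt (Nat.div_le_self _ _) ha)).2.1

/-- All the quotients of `a` by `n ^ r`, for `r ≤ m`. -/
lemma Reach.quotients (hS : Reach norm mk p t S) (h : Scaled mk p S c A B E cv)
    (hp : ∀ n, 0 < p n → 0 < n) (m : ℕ) :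
    ∃ S', S ≤ S' ∧ Reach norm mk p (t + 2 * m) S' ∧
      ∀ r ≤ m, ∃ X X', ApproxQuotient p S' cv r X X' := by
  induction m with
  | zero =>
    refine ⟨S, le_rfl, hS, fun r hr => ⟨_, _, h.A₁, h.B₁, fun w a ha => ?_, fun w a ha => ?_⟩⟩
    · obtain rfl : r = 0 := by omega
      simpa using (h.unit_approx ha).1
    · obtain rfl : r = 0 := by omega
      simpa using (h.unit_approx ha).2.1
  | succ m ih =>
    obtain ⟨S₁, hS₁, hR₁, hX⟩ := ih
    obtain ⟨X, X', hm⟩ := hX m le_rfl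
    obtain ⟨S₂, hS₂, hR₂, Z, Z', hZ⟩ := hR₁.divide (h.mono hS₁) hp hm
    refine ⟨S₂, hS₁.trans hS₂, hR₂, fun r hr => ?_⟩
    rcases Nat.lt_or_ge m r with hlt | hge
    · obtain rfl : r = m + 1 := by omega
      exact ⟨Z, Z', hZ⟩
    · obtain ⟨Z, Z', hZ⟩ := hX r hge
      exact ⟨Z, Z', hZ.mono hS₂⟩

/-! ### Canonical codes of numbers -/

/-- The unit vector in the direction `(m + 1, 1)`, the code of the number `m`. -/
def code (m : ℕ) (b : Bool) : ℝ := if b then unit₁ ((m : ℝ) + 1) 1 else unit₂ ((m : ℝ) + 1) 1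

lemma sum_code_mul_code (m m' : ℕ) :
    code m true * code m' true + code m false * code m' false =
      dirDot ((m : ℝ) + 1) ((m' : ℝ) + 1) := rfl

lemma attnFeature_pos {Λ : Type*} [Fintype Λ] {q k : Λ → Feature α} {v : Feature α} {w : List α}
    {i : ℕ} (hi : i < seqLen p w) (hv : ∀ j, j < seqLen p w → 0 < v w j) :
    0 < attnFeature mk p q k v w i := by
  classical
  have hne : (argmaxSet (mk.visible (seqLen p w) i)
      (fun j => ∑ l, q l w i * k l w j)).Nonempty := by
    obtain ⟨j, hj, hmax⟩ := Finset.exists_max_image (mk.visible (seqLen p w) i)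
      (fun j => ∑ l, q l w i * k l w j) ⟨0, mem_visible_of_le hi (Nat.zero_le _)⟩
    exact ⟨j, Finset.mem_filter.2 ⟨hj, hmax⟩⟩
  refine div_pos (Finset.sum_pos (fun j hj => hv j ?_) hne) ?_
  · exact lt_of_mem_visible hi (Finset.mem_filter.1 hj).1
  · exact_mod_cast Finset.card_pos.2 hne

/-- At every padding token, `ID` is the code of the number `m`, and `SY a` tells whether the token
at the (0-based) position `m` is the symbol `a`. -/
structure Pointer (p : ℕ → ℕ) (S : Submodule ℚ (Feature α)) (m : List α → ℕ → ℕ)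
    (ID : Bool → Feature α) (SY : α → Feature α) : Prop where
  normable : ∀ b, Normable p S (ID b)
  mem : ∀ b, ID b ∈ S
  unit : ∀ w i, i < seqLen p w → ID true w i ^ 2 + ID false w i ^ 2 = 1
  sym_mem : ∀ a, SY a ∈ S
  sym_rational : ∀ a w i, i < seqLen p w → ∃ x : ℚ, SY a w i = x
  code : ∀ w a, a < p w.length → ∀ b, ID b w (padPos w a) = code (m w a) b
  sym : ∀ w a, a < p w.length → ∀ σ, SY σ w (padPos w a) =
    tokenFeature (Token.sym σ) w (m w a)

lemma Pointer.mono {S' : Submodule ℚ (Feature α)} (hSS' : S ≤ S') {m : List α → ℕ → ℕ}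
    {ID : Bool → Feature α} {SY : α → Feature α} (h : Pointer p S m ID SY) :
    Pointer p S' m ID SY :=
  ⟨fun b => (h.normable b).mono hSS', fun b => hSS' (h.mem b), h.unit, fun a => hSS' (h.sym_mem a),
    h.sym_rational, h.code, h.sym⟩

/-- If a number `m` is known approximately as a ratio of features, the token at position `m` can
be looked up in three layers. -/
lemma Reach.lookup [Finite α] (hS : Reach norm mk p t S) (h : Scaled mk p S c A B E cv)
    {f g : Feature α} (hf : f ∈ S) (hg : g ∈ S) (hpos : ∀ w i, i < seqLen p w → 0 < g w i)
    {m : List α → ℕ → ℕ} (hm : ∀ w a, a < p w.length → m w a ≤ padPos w a)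
    (hfg : ∀ w a, a < p w.length →
      |f w (padPos w a) / g w (padPos w a) - (m w a + 1 : ℕ)| ≤ 1 / 4) :
    ∃ S', S ≤ S' ∧ Reach norm mk p (t + 3) S' ∧ ∃ ID SY, Pointer p S' m ID SY := by
  obtain ⟨κ, ⟨e⟩⟩ := Finite.exists_equiv_fin α
  obtain ⟨S₁, hS₁, hR₁, -, hq₁, -, hq₂⟩ := hS.normalizePair hf hg hpos
  have h' := h.mono hS₁
  set Q : Bool → Feature α := fun b =>
    if b then fun w i => unit₁ (f w i) (g w i) else fun w i => unit₂ (f w i) (g w i) with hQ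
  set Kf : Bool → Feature α := fun b _ i => code i b with hKf
  have hK : ∀ b, Normable p S₁ (Kf b) := by
    intro b
    cases b
    exacts [h'.pos₂_normable, h'.pos₁_normable]
  obtain ⟨S₂, hS₂, hR₂, hv⟩ := hR₁.attention h'.tokens.one (η := Unit) (Λ := Bool)
    (Ω := Bool ⊕ Fin κ) (q := fun _ => Q) (k := fun _ => Kf)
    (v := fun _ => Sum.elim Kf (fun x => tokenFeature (Token.sym (e.symm x))))
    (by intro _ b; cases b; exacts [hq₂.mem, hq₁.mem]) (fun _ b => (hK b).mem)
    (by
      rintro _ (b | x)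
      exacts [(hK b).mem, (h'.tokens.normable_sym _).mem])
  have key : ∀ (v : Feature α) w a, a < p w.length →
      attnFeature mk p Q Kf v w (padPos w a) = v w (m w a) := by
    intro v w a ha
    have hi := padPos_lt ha
    have hgi := hpos w _ hi
    have score : ∀ j, ∑ b, Q b w (padPos w a) * Kf b w j =
        dirDot (f w (padPos w a) / g w (padPos w a)) ((j + 1 : ℕ) : ℝ) := by
      intro j
      simp only [Fintype.sum_bool, hQ, hKf, code, if_true, Bool.false_eq_true, if_false]
      rw [unit₁_eq_ratio hgi, unit₂_eq_ratio hgi, dirDot]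
      push_cast
      rfl
    refine attnFeature_eq_of_unique (mem_visible_of_le hi (hm w a ha)) fun j _ hj => ?_
    rw [score, score]
    exact dirDot_lt_of_near_nat (by omega) (hfg w a ha)
  have hKpos : ∀ w j, 0 < Kf false w j := fun w j => unit₂_pos one_pos
  have hid₁ := hv () (Sum.inl true)
  have hid₂ := hv () (Sum.inl false)
  have hidpos : ∀ w i, i < seqLen p w → 0 < attnFeature mk p Q Kf (Kf false) w i :=
    fun w i hi => attnFeature_pos hi fun j _ => hKpos w j
  -- The looked-up code is normalized again, because at other tokens it may be an average.
  obtain ⟨S₃, hS₃, hR₃, h₁, h₁n, h₂, h₂n⟩ := hR₂.normalizePair hid₁ hid₂ hidpos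
  refine ⟨S₃, hS₁.trans (hS₂.trans hS₃), hR₃, fun b => if b
      then fun w i => unit₁ (attnFeature mk p Q Kf (Kf true) w i)
        (attnFeature mk p Q Kf (Kf false) w i)
      else fun w i => unit₂ (attnFeature mk p Q Kf (Kf true) w i)
        (attnFeature mk p Q Kf (Kf false) w i),
    fun σ => attnFeature mk p Q Kf (tokenFeature (Token.sym σ)),
    ⟨fun b => ?_, fun b => ?_, fun w i hi => ?_, fun σ => ?_, fun σ w i hi => ?_,
      fun w a ha b => ?_, fun w a ha σ => key _ w a ha⟩⟩
  · cases b
    exacts [h₂n, h₁n]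
  · cases b
    exacts [h₂, h₁]
  · exact unit_sq_add_sq (hidpos w i hi)
  · have := hS₃ (hv () (Sum.inr (e σ)))
    simpa using this
  · refine attnFeature_rational hi fun j _ => ?_
    rcases tokenFeature_zero_or_one (Token.sym σ) w j with h | h
    · exact ⟨0, by simp [h]⟩
    · exact ⟨1, by simp [h]⟩
  · have hsq : code (m w a) true ^ 2 + code (m w a) false ^ 2 = 1 := unit_sq_add_sq one_pos
    have e1 : attnFeature mk p Q Kf (Kf true) w (padPos w a) = code (m w a) true := key _ w a ha
    have e2 : attnFeature mk p Q Kf (Kf false) w (padPos w a) = code (m w a) false := key _ w a ha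
    cases b
    · change unit₂ (attnFeature mk p Q Kf (Kf true) w (padPos w a))
        (attnFeature mk p Q Kf (Kf false) w (padPos w a)) = _
      rw [e1, e2, unit₂, hsq, Real.sqrt_one, div_one]
    · change unit₁ (attnFeature mk p Q Kf (Kf true) w (padPos w a))
        (attnFeature mk p Q Kf (Kf false) w (padPos w a)) = _
      rw [e1, e2, unit₁, hsq, Real.sqrt_one, div_one]

end Quotients

/-! ### What a padding token knows about its assignment -/

section Assignments

variable {α : Type u} {norm : NormKind} {mk : Masking} {p : ℕ → ℕ} {t : ℕ}
variable {S : Submodule ℚ (Feature α)} {c A B E : Feature α} {cv : List α → ℝ}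

/-- How many blocks of padding tokens back a token looks for the values of subformulas: with
causal masking only earlier blocks are completely visible. -/
def Masking.lag : Masking → ℕ
  | .unmasked => 0
  | .causal => 1

/-- The numbers that padding token number `a` has to know: one more than each of its digits (the
values of the variables), the constants `1` and `n`, and one more than the numbers of its block and
of the block it looks at. -/
def slotValue {k : ℕ} (mk : Masking) : Fin k ⊕ Fin 4 → List α → ℕ → ℕ
  | .inl r, w, a => a / w.length ^ (r : ℕ) % w.length + 1
  | .inr 0, _, _ => 1
  | .inr 1, w, _ => w.length
  | .inr 2, w, a => a / w.length ^ k + 1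
  | .inr 3, w, a => a / w.length ^ k + 1 - mk.lag

lemma abs_div_sub_le {x y m : ℝ} (hy : 0 < y) (h : |x - y * m| ≤ y / 4) : |x / y - m| ≤ 1 / 4 := by
  have : x / y - m = (x - y * m) / y := by field_simp
  rw [this, abs_div, abs_of_pos hy, div_le_iff₀ hy]
  linarith

/-- Each of these numbers is approximately a ratio of available features. -/
lemma exists_ratio_slotValue {k : ℕ} (h : Scaled mk p S c A B E cv) (hp : ∀ n, 0 < p n → 0 < n)
    (hX : ∀ r ≤ k, ∃ X X', ApproxQuotient p S cv r X X') (x : Fin k ⊕ Fin 4) :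
    ∃ f g : Feature α, f ∈ S ∧ g ∈ S ∧ (∀ w i, i < seqLen p w → 0 < g w i) ∧
      ∀ w a, a < p w.length → slotValue mk x w a ≤ padPos w a ∧
        |f w (padPos w a) / g w (padPos w a) - (slotValue mk x w a + 1 : ℕ)| ≤ 1 / 4 := by
  have two : (2 : ℚ) • (1 : Feature α) ∈ S := S.smul_mem _ h.tokens.one
  match x with
  | .inl r =>
    obtain ⟨X, _, hX₁⟩ := hX r r.2.le
    obtain ⟨_, Z, hZ⟩ := hX (r + 1) r.2
    refine ⟨X - Z + (2 : ℚ) • c, c, S.add_mem (S.sub_mem hX₁.mem hZ.mem')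
      (S.smul_mem _ h.c_mem), h.c_mem, h.c_pos, fun w a ha => ⟨?_, ?_⟩⟩
    · have hn := hp _ (lt_of_le_of_lt (Nat.zero_le _) ha)
      have := Nat.mod_lt (a / w.length ^ (r : ℕ)) hn
      simp only [slotValue, padPos]
      omega
    · have hcv := (h.cv_small w (by omega)).1
      rw [h.c_eq w a ha]
      refine abs_div_sub_le hcv ?_
      obtain ⟨x1, x2⟩ := abs_le.1 (hX₁.approx w a ha)
      obtain ⟨z1, z2⟩ := abs_le.1 (hZ.approx' w a ha)
      have hmod : ((a / w.length ^ (r : ℕ) : ℕ) : ℝ) =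
          w.length * (a / w.length ^ ((r : ℕ) + 1) : ℕ) +
            (a / w.length ^ (r : ℕ) % w.length : ℕ) := by
        rw [pow_succ, ← Nat.div_div_eq_div_mul]
        exact_mod_cast (Nat.div_add_mod _ w.length).symm
      have hval : (X - Z + (2 : ℚ) • c) w (padPos w a) =
          X w (padPos w a) - Z w (padPos w a) + 2 * cv w := by
        simp [Rat.smul_def, h.c_eq w a ha]
      rw [hval, abs_le]
      rw [hmod] at x1 x2
      simp only [slotValue]
      push_cast
      constructor <;> linarith
  | .inr 0 =>
    refine ⟨(2 : ℚ) • 1, 1, two, h.tokens.one, fun _ _ _ => one_pos, fun w a _ => ⟨?_, ?_⟩⟩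
    · simp only [slotValue, padPos]; omega
    · simp only [slotValue]
      norm_num [Rat.smul_def]
  | .inr 1 =>
    refine ⟨1, invLengthFeature mk p, h.tokens.one, h.invLength,
      fun w i hi => (invLengthFeature_spec hi).1, fun w a ha => ⟨?_, ?_⟩⟩
    · simp only [slotValue, padPos]; omega
    · rw [(invLengthFeature_spec (padPos_lt ha)).2 (by unfold padPos; omega)]
      simp [slotValue]
  | .inr 2 =>
    obtain ⟨X, _, hX₁⟩ := hX k le_rfl
    refine ⟨X + (2 : ℚ) • c, c, S.add_mem hX₁.mem (S.smul_mem _ h.c_mem), h.c_mem, h.c_pos,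
      fun w a ha => ⟨?_, ?_⟩⟩
    · have := Nat.div_le_self a (w.length ^ k)
      simp only [slotValue, padPos]
      omega
    · have hcv := (h.cv_small w (by omega)).1
      rw [h.c_eq w a ha]
      refine abs_div_sub_le hcv ?_
      obtain ⟨x1, x2⟩ := abs_le.1 (hX₁.approx w a ha)
      have hval : (X + (2 : ℚ) • c) w (padPos w a) = X w (padPos w a) + 2 * cv w := by
        simp [Rat.smul_def, h.c_eq w a ha]
      rw [hval, abs_le]
      simp only [slotValue]
      push_cast
      constructor <;> linarith
  | .inr 3 =>
    obtain ⟨X, _, hX₁⟩ := hX k le_rfl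
    refine ⟨X + (2 - mk.lag : ℚ) • c, c, S.add_mem hX₁.mem (S.smul_mem _ h.c_mem), h.c_mem,
      h.c_pos, fun w a ha => ⟨?_, ?_⟩⟩
    · have := Nat.div_le_self a (w.length ^ k)
      simp only [slotValue, padPos]
      omega
    · have hcv := (h.cv_small w (by omega)).1
      rw [h.c_eq w a ha]
      refine abs_div_sub_le hcv ?_
      obtain ⟨x1, x2⟩ := abs_le.1 (hX₁.approx w a ha)
      have hval : (X + (2 - mk.lag : ℚ) • c) w (padPos w a) =
          X w (padPos w a) + (2 - mk.lag) * cv w := by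
        simp [Rat.smul_def, h.c_eq w a ha]
      have hlag : mk.lag ≤ a / w.length ^ k + 1 := by
        cases mk <;> simp [Masking.lag]
      have hcast : ((slotValue mk (.inr 3 : Fin k ⊕ Fin 4) w a + 1 : ℕ) : ℝ) =
          (a / w.length ^ k : ℕ) + (2 - mk.lag) := by
        simp only [slotValue]
        rw [Nat.cast_add, Nat.cast_sub hlag]
        push_cast
        ring
      rw [hval, hcast, abs_le]
      constructor <;> linarith

/-- Everything that the padding tokens need to know about the assignments that they store: the
codes of the numbers above, the symbols at these positions, and the order of these numbers. -/
structure Assigned (mk : Masking) (p : ℕ → ℕ) (k : ℕ) (S : Submodule ℚ (Feature α))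
    (ID : Fin k ⊕ Fin 4 → Bool → Feature α) (SY : Fin k ⊕ Fin 4 → α → Feature α)
    (LT : Fin k ⊕ Fin 4 → Fin k ⊕ Fin 4 → Feature α) : Prop where
  tokens : HasTokens S
  pos₁ : (fun (_ : List α) (i : ℕ) => unit₁ ((i : ℝ) + 1) 1) ∈ S
  pointer : ∀ x, Pointer p S (slotValue mk x) (ID x) (SY x)
  lt_mem : ∀ x y, LT x y ∈ S
  lt_rational : ∀ x y w i, i < seqLen p w → ∃ r : ℚ, LT x y w i = r
  lt_spec : ∀ x y w a, a < p w.length → LT x y w (padPos w a) =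
    if slotValue mk x w a < slotValue mk y w a then 1 else 0

lemma Assigned.mono {k : ℕ} {S' : Submodule ℚ (Feature α)} (hSS' : S ≤ S')
    {ID : Fin k ⊕ Fin 4 → Bool → Feature α} {SY : Fin k ⊕ Fin 4 → α → Feature α}
    {LT : Fin k ⊕ Fin 4 → Fin k ⊕ Fin 4 → Feature α} (h : Assigned mk p k S ID SY LT) :
    Assigned mk p k S' ID SY LT :=
  ⟨h.tokens.mono hSS', hSS' h.pos₁, fun x => (h.pointer x).mono hSS',
    fun x y => hSS' (h.lt_mem x y), h.lt_rational, h.lt_spec⟩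

/-- The number of layers that prepare the evaluation of formulas with `k` variables. -/
def setupDepth (k : ℕ) : ℕ := 3 * k + 9 + 2 * k + 3 * (k + 4) + (k + 4) * (k + 4)

/-- The order of two numbers is decided by the sign of the difference of the first coordinates of
their codes. -/
lemma exists_reach_assigned [Finite α] {k : ℕ} (hk : 1 ≤ k) (K : ℕ) :
    ∃ (S : Submodule ℚ (Feature α)) (ID : Fin k ⊕ Fin 4 → Bool → Feature α)
      (SY : Fin k ⊕ Fin 4 → α → Feature α) (LT : Fin k ⊕ Fin 4 → Fin k ⊕ Fin 4 → Feature α),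
      Reach norm mk (fun n => (K + 1) * n ^ k) (setupDepth k) S ∧
      Assigned mk (fun n => (K + 1) * n ^ k) k S ID SY LT := by
  obtain ⟨S₀, c, A, B, E, cv, hR₀, h₀⟩ :=
    exists_reach_scaled (α := α) (norm := norm) (mk := mk) hk K
  set p : ℕ → ℕ := fun n => (K + 1) * n ^ k with hpdef
  have hp : ∀ n, 0 < p n → 0 < n := by
    intro n hn
    rcases Nat.eq_zero_or_pos n with rfl | h
    · simp [hpdef, zero_pow (by omega : k ≠ 0)] at hn
    · exact h
  obtain ⟨S₁, hS₁, hR₁, hX⟩ := hR₀.quotients h₀ hp k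
  have h₁ := h₀.mono hS₁
  obtain ⟨S₂, hS₂, hR₂, hptr⟩ := Reach.forall_finset (X := Fin k ⊕ Fin 4) (τ := 3)
    (P := fun x S => ∃ ID SY, Pointer p S (slotValue mk x) ID SY)
    (fun x S S' hSS' ⟨ID, SY, h⟩ => ⟨ID, SY, h.mono hSS'⟩)
    (fun x t S' hS' hR' => by
      obtain ⟨f, g, hf, hg, hpos, hspec⟩ := exists_ratio_slotValue h₁ hp hX x
      exact hR'.lookup (h₁.mono hS') (hS' hf) (hS' hg) hpos (fun w a ha => (hspec w a ha).1)
        (fun w a ha => (hspec w a ha).2))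
    hR₁ Finset.univ
  choose ID SY hptr using fun x => hptr x (Finset.mem_univ x)
  obtain ⟨S₃, hS₃, hR₃, hlt⟩ := Reach.forall_finset
    (X := (Fin k ⊕ Fin 4) × (Fin k ⊕ Fin 4)) (τ := 1)
    (P := fun x S => (fun w i => if 0 < (ID x.2 true - ID x.1 true) w i then 1 else 0) ∈ S)
    (fun x S S' hSS' h => hSS' h)
    (fun x t S' hS' hR' => hR'.isPos (S'.sub_mem (hS' ((hptr x.2).mem true))
      (hS' ((hptr x.1).mem true))))
    hR₂ Finset.univ
  refine ⟨S₃, ID, SY, _, ?_, h₁.tokens.mono (hS₂.trans hS₃), hS₃ (hS₂ h₁.pos₁),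
    fun x => (hptr x).mono hS₃, fun x y => hlt (x, y) (Finset.mem_univ _), ?_, ?_⟩
  · convert hR₃ using 1
    simp [setupDepth, Fintype.card_prod]
  · intro x y w i _
    by_cases h : 0 < (ID y true - ID x true) w i
    · exact ⟨1, by simp only [if_pos h, Rat.cast_one]⟩
    · exact ⟨0, by simp only [if_neg h, Rat.cast_zero]⟩
  · intro x y w a ha
    simp only [Pi.sub_apply, (hptr _).code w a ha, sub_pos, code, if_true]
    refine if_congr ?_ rfl rfl
    constructor
    · intro h
      by_contra hle
      rcases (not_lt.1 hle).lt_or_eq with h' | h'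
      · have : ((slotValue mk y w a : ℕ) : ℝ) + 1 < (slotValue mk x w a : ℕ) + 1 := by
          exact_mod_cast Nat.succ_lt_succ h'
        exact lt_asymm h (unit₁_lt_unit₁ (by positivity) this)
      · rw [h'] at h
        exact lt_irrefl _ h
    · intro h
      refine unit₁_lt_unit₁ (by positivity) ?_
      exact_mod_cast Nat.succ_lt_succ h

end Assignments

/-! ### Assignments and their numbers -/

section Blocks

variable {α : Type u} {norm : NormKind} {mk : Masking} {p : ℕ → ℕ} {t : ℕ}

/-- The number of the padding token that stores the assignment `d` in block number `b`. -/
def blockIndex {n k : ℕ} (b : ℕ) (d : Fin k → Fin n) : ℕ :=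
  b * n ^ k + (finFunctionFinEquiv d : Fin (n ^ k))

section Digits

variable {n k : ℕ}

lemma blockIndex_lt (b : ℕ) (d : Fin k → Fin n) : blockIndex b d < (b + 1) * n ^ k := by
  have := (finFunctionFinEquiv d).isLt
  unfold blockIndex
  linarith

lemma blockIndex_lt_of_le {b K : ℕ} (hb : b ≤ K) (d : Fin k → Fin n) :
    blockIndex b d < (K + 1) * n ^ k :=
  (blockIndex_lt b d).trans_le (Nat.mul_le_mul_right _ (by omega))

lemma blockIndex_div (b : ℕ) (d : Fin k → Fin n) : blockIndex b d / n ^ k = b := by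
  have h := (finFunctionFinEquiv d).isLt
  rw [blockIndex, mul_comm, Nat.mul_add_div (by omega), Nat.div_eq_of_lt h, add_zero]

lemma blockIndex_digit (b : ℕ) (d : Fin k → Fin n) (r : Fin k) :
    blockIndex b d / n ^ (r : ℕ) % n = d r := by
  have h := (finFunctionFinEquiv d).isLt
  have hn : 0 < n := (Nat.zero_le _).trans_lt (d r).isLt
  have hpow : b * n ^ k = n ^ (r : ℕ) * (n * (b * n ^ (k - r - 1))) := by
    have : k = r + (1 + (k - r - 1)) := by omega
    conv_lhs => rw [this, pow_add, pow_add, pow_one]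
    ring
  rw [blockIndex, hpow, Nat.mul_add_div (by positivity), Nat.mul_add_mod]
  have := congrFun (finFunctionFinEquiv.symm_apply_apply d) r
  exact congrArg Fin.val this

lemma exists_blockIndex (hn : 0 < n) (a : ℕ) :
    ∃ d : Fin k → Fin n, a = blockIndex (a / n ^ k) d := by
  refine ⟨finFunctionFinEquiv.symm ⟨a % n ^ k, Nat.mod_lt _ (by positivity)⟩, ?_⟩
  rw [blockIndex, Equiv.apply_symm_apply]
  exact (Nat.div_add_mod' a _).symm

lemma blockIndex_injective (b : ℕ) : Injective (blockIndex (n := n) (k := k) b) := by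
  intro d d' h
  exact finFunctionFinEquiv.injective (Fin.ext (Nat.add_left_cancel h))

/-- The assignments that agree with `d` on the variables in `U`. -/
def agreeing (U : Finset (Fin k)) (d : Fin k → Fin n) : Finset (Fin k → Fin n) :=
  Finset.univ.filter fun d' => ∀ r ∈ U, d' r = d r

lemma agreeing_univ (d : Fin k → Fin n) : agreeing Finset.univ d = {d} := by
  ext d'
  simp [agreeing, funext_iff]

lemma self_mem_agreeing (U : Finset (Fin k)) (d : Fin k → Fin n) : d ∈ agreeing U d := by
  simp [agreeing]

/-- Averages do not change under a map all of whose fibers have the same size. -/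
lemma sum_div_card_of_fiber {X Y : Type*} [Fintype X] [DecidableEq Y] {A : Finset Y} {g : X → Y}
    {N : ℕ} (hN : 0 < N) (hg : ∀ x, g x ∈ A)
    (hfib : ∀ y ∈ A, (Finset.univ.filter fun x => g x = y).card = N) (φ : Y → ℝ) :
    (∑ y ∈ A, φ y) / A.card = (∑ x, φ (g x)) / Fintype.card X := by
  have h1 : ∑ x, φ (g x) = N * ∑ y ∈ A, φ y := by
    rw [← Finset.sum_fiberwise_of_maps_to (s := Finset.univ) (t := A) (fun x _ => hg x),
      Finset.mul_sum]
    refine Finset.sum_congr rfl fun y hy => ?_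
    rw [Finset.sum_congr rfl (g := fun _ => φ y) (fun x hx => by
      rw [(Finset.mem_filter.1 hx).2]), Finset.sum_const, hfib y hy, nsmul_eq_mul]
  have h2 : Fintype.card X = N * A.card := by
    rw [← Finset.card_univ, Finset.card_eq_sum_card_fiberwise (t := A) (fun x _ => hg x),
      Finset.sum_congr rfl hfib, Finset.sum_const, smul_eq_mul, mul_comm]
  have : (N : ℝ) ≠ 0 := by exact_mod_cast hN.ne'
  rw [h1, h2, Nat.cast_mul, mul_div_mul_left _ _ this]

/-- The average over the assignments that differ from `d` at most at two variables, which may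
coincide, is an average over pairs of values. -/
lemma sum_agreeing_div_card (i j : Fin k) (d : Fin k → Fin n) (φ : (Fin k → Fin n) → ℝ) :
    (∑ d' ∈ agreeing ((Finset.univ.erase i).erase j) d, φ d') /
        (agreeing ((Finset.univ.erase i).erase j) d).card =
      (∑ m : Fin n × Fin n, φ (update (update d i m.1) j m.2)) / (n : ℝ) ^ 2 := by
  classical
  have hn : 0 < n := (Nat.zero_le _).trans_lt (d i).isLt
  rw [sum_div_card_of_fiber (X := Fin n × Fin n)
    (g := fun m => update (update d i m.1) j m.2) (N := if i = j then n else 1)]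
  · simp [sq]
  · split_ifs <;> omega
  · intro m
    simp only [agreeing, Finset.mem_filter, Finset.mem_univ, true_and, Finset.mem_erase, and_true]
    rintro r ⟨hj, hi⟩
    rw [update_of_ne hj, update_of_ne hi]
  · intro d' hd'
    simp only [agreeing, Finset.mem_filter, Finset.mem_univ, true_and, Finset.mem_erase,
      and_true] at hd'
    have key : ∀ m : Fin n × Fin n, update (update d i m.1) j m.2 = d' ↔
        (i = j ∨ m.1 = d' i) ∧ m.2 = d' j := by
      intro m
      constructor
      · rintro rfl
        refine ⟨?_, by simp⟩
        by_cases hij : i = j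
        · exact Or.inl hij
        · right
          rw [update_of_ne hij, update_self]
      · rintro ⟨h1, h2⟩
        funext r
        rcases eq_or_ne r j with rfl | hj
        · rw [update_self, h2]
        · rw [update_of_ne hj]
          rcases eq_or_ne r i with rfl | hi
          · rw [update_self]
            exact h1.resolve_left hj
          · rw [update_of_ne hi, hd' r ⟨hj, hi⟩]
    simp only [key]
    split_ifs with hij
    · have : (Finset.univ.filter fun m : Fin n × Fin n => (i = j ∨ m.1 = d' i) ∧ m.2 = d' j) =
          Finset.univ ×ˢ {d' j} := by
        ext m
        simp only [Finset.mem_filter, Finset.mem_univ, hij, true_or, true_and,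
          Finset.mem_product, Finset.mem_singleton]
      rw [this, Finset.card_product]
      simp
    · have : (Finset.univ.filter fun m : Fin n × Fin n => (i = j ∨ m.1 = d' i) ∧ m.2 = d' j) =
          {(d' i, d' j)} := by
        ext m
        simp [hij, Prod.ext_iff]
      rw [this, Finset.card_singleton]

end Digits

/-! ### Quantifiers as counting of pairs -/

section Counting

variable {k : ℕ}

/-- The values (between `1` and `n`) of the variables under the assignment `d`. -/
def values {n : ℕ} (d : Fin k → Fin n) : Fin k → ℕ := fun r => (d r : ℕ) + 1

lemma values_update {n : ℕ} (d : Fin k → Fin n) (i : Fin k) (m : Fin n) :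
    values (update d i m) = update (values d) i (m + 1) := by
  funext r
  rcases eq_or_ne r i with rfl | h
  · simp [values]
  · simp [values, h]

open Classical in
/-- The number of pairs of values of the variables `i` and `j` (only the second one counts if
`i = j`) that satisfy `P`. -/
def pairCount (w : List α) (P : Formula α k) (i j : Fin k) (d : Fin k → Fin w.length) : ℕ :=
  (Finset.univ.filter fun m : Fin w.length × Fin w.length =>
    P.Holds w (values (update (update d i m.1) j m.2))).card

variable (w : List α) (P : Formula α k) (i j : Fin k) (d : Fin k → Fin w.length)

lemma pairCount_le : pairCount w P i j d ≤ w.length ^ 2 := by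
  classical
  refine (Finset.card_filter_le _ _).trans ?_
  simp [sq]

lemma holds_ex_iff : (Formula.ex i P).Holds w (values d) ↔ 0 < pairCount w P i i d := by
  classical
  simp only [pairCount, Finset.card_pos, Formula.Holds, Finset.Nonempty, Finset.mem_filter,
    Finset.mem_univ, true_and, update_idem, values_update, Finset.mem_Icc, Prod.exists]
  constructor
  · rintro ⟨m, ⟨h1, h2⟩, h⟩
    refine ⟨d i, ⟨m - 1, by omega⟩, ?_⟩
    simpa [Nat.sub_add_cancel h1] using h
  · rintro ⟨_, m, h⟩
    exact ⟨m + 1, by omega, h⟩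

lemma holds_all_iff :
    (Formula.all i P).Holds w (values d) ↔ pairCount w P i i d = w.length ^ 2 := by
  classical
  have hcard : w.length ^ 2 = (Finset.univ : Finset (Fin w.length × Fin w.length)).card := by
    simp [sq]
  rw [pairCount, hcard, Finset.card_filter_eq_iff]
  simp only [Formula.Holds, Finset.mem_univ, true_imp_iff, update_idem, values_update,
    Finset.mem_Icc, Prod.forall]
  constructor
  · intro h _ m
    exact h (m + 1) (by omega)
  · rintro h m ⟨h1, h2⟩
    have := h (d i) ⟨m - 1, by omega⟩
    simpa [Nat.sub_add_cancel h1] using this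

lemma holds_maj_iff :
    (Formula.maj i j P).Holds w (values d) ↔ w.length ^ 2 < 2 * pairCount w P i j d := by
  classical
  simp only [Formula.Holds]
  have : ((Finset.Icc 1 w.length ×ˢ Finset.Icc 1 w.length).filter
      (fun m => P.Holds w (update (update (values d) i m.1) j m.2))).card =
      pairCount w P i j d := by
    symm
    refine Finset.card_bij (fun m _ => ((m.1 : ℕ) + 1, (m.2 : ℕ) + 1)) ?_ ?_ ?_
    · intro m hm
      simp only [Finset.mem_filter, Finset.mem_univ, true_and, values_update] at hm
      simp only [Finset.mem_filter, Finset.mem_product, Finset.mem_Icc]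
      exact ⟨by omega, hm⟩
    · intro m _ m' _ h
      simp only [Prod.mk.injEq, Nat.add_right_cancel_iff] at h
      exact Prod.ext (Fin.ext h.1) (Fin.ext h.2)
    · rintro ⟨x, y⟩ h
      simp only [Finset.mem_filter, Finset.mem_product, Finset.mem_Icc] at h
      refine ⟨(⟨x - 1, by omega⟩, ⟨y - 1, by omega⟩), ?_, ?_⟩
      · simp only [Finset.mem_filter, Finset.mem_univ, true_and, values_update]
        simpa [Nat.sub_add_cancel h.1.1.1, Nat.sub_add_cancel h.1.2.1] using h.2
      · simp [Nat.sub_add_cancel h.1.1.1, Nat.sub_add_cancel h.1.2.1]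
  rw [← this]

open Classical in
lemma average_holds_eq : (∑ d' ∈ agreeing ((Finset.univ.erase i).erase j) d,
      (if P.Holds w (values d') then 1 else 0 : ℝ)) /
        (agreeing ((Finset.univ.erase i).erase j) d).card =
      pairCount w P i j d / (w.length : ℝ) ^ 2 := by
  rw [sum_agreeing_div_card i j d (fun d' => if P.Holds w (values d') then 1 else 0), pairCount,
    Finset.sum_boole]

end Counting

end Blocks

/-! ### Evaluation of one more level of a formula -/

section Levels

variable {α : Type u} {norm : NormKind} {mk : Masking} {p : ℕ → ℕ} {t : ℕ}

section Subformulas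

variable {k : ℕ}

/-- The immediate subformulas, the first (`true`) and the second (`false`).  If there is only one,
it is given twice, and an atomic formula is given back. -/
def Formula.child : Formula α k → Bool → Formula α k
  | .neg P, _ => P
  | .and P Q, b => if b then P else Q
  | .or P Q, b => if b then P else Q
  | .ex _ P, _ => P
  | .all _ P, _ => P
  | .maj _ _ P, _ => P
  | P, _ => P

/-- The variables whose values are the same for a formula and for its immediate subformulas. -/
def Formula.kept : Formula α k → Finset (Fin k)
  | .ex i _ => (Finset.univ.erase i).erase i
  | .all i _ => (Finset.univ.erase i).erase i
  | .maj i j _ => (Finset.univ.erase i).erase j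
  | _ => Finset.univ

/-- The number that an index denotes, among those known to the padding tokens. -/
def Index.slot : Index k → Fin k ⊕ Fin 4
  | .one => .inr 0
  | .last => .inr 1
  | .var r => .inl r

lemma slotValue_slot (s : Index k) (w : List α) (b : ℕ) (d : Fin k → Fin w.length) :
    slotValue mk s.slot w (blockIndex b d) = s.val w.length (values d) := by
  cases s with
  | one => rfl
  | last => rfl
  | var r => simp [Index.slot, slotValue, Index.val, values, blockIndex_digit]

end Subformulas

variable {k : ℕ} {S : Submodule ℚ (Feature α)} {ID : Fin k ⊕ Fin 4 → Bool → Feature α}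
  {SY : Fin k ⊕ Fin 4 → α → Feature α} {LT : Fin k ⊕ Fin 4 → Fin k ⊕ Fin 4 → Feature α}

/-- The queries by which a padding token finds the assignments that agree with its own on the
variables in `U`, in the block that it looks at. -/
def agreeQuery (ID : Fin k ⊕ Fin 4 → Bool → Feature α) (U : Finset (Fin k)) :
    Option (Option (Fin k) × Bool) → Feature α
  | none => 1
  | some (none, b) => ID (.inr 3) b
  | some (some r, b) => if r ∈ U then ID (.inl r) b else 0

/-- The keys that go with `agreeQuery`. -/
def agreeKey (ID : Fin k ⊕ Fin 4 → Bool → Feature α) :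
    Option (Option (Fin k) × Bool) → Feature α
  | none => padFeature - 1
  | some (none, b) => ID (.inr 2) b
  | some (some r, b) => ID (.inl r) b

lemma sum_agreeQuery_mul_agreeKey (U : Finset (Fin k)) (w : List α) (i j : ℕ) :
    ∑ l, agreeQuery ID U l w i * agreeKey ID l w j =
      (padFeature (α := α) w j - 1) + (∑ b, ID (.inr 3) b w i * ID (.inr 2) b w j +
        ∑ r ∈ U, ∑ b, ID (.inl r) b w i * ID (.inl r) b w j) := by
  rw [Fintype.sum_option, Fintype.sum_prod_type, Fintype.sum_option]
  simp only [agreeQuery, agreeKey, Pi.one_apply, one_mul, Pi.sub_apply]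
  congr 2
  rw [← Finset.sum_filter_add_sum_filter_not Finset.univ (· ∈ U), Finset.filter_mem_eq_inter,
    Finset.univ_inter, add_eq_left.2]
  · exact Finset.sum_congr rfl fun r hr => by simp [hr]
  · refine Finset.sum_eq_zero fun r hr => ?_
    simp [(Finset.mem_filter.1 hr).2]

/-- The attention with these queries and keys averages over the assignments that agree with the
one of the query on the variables in `U`. -/
lemma Assigned.attnFeature_eq {K : ℕ}
    (h : Assigned mk (fun n => (K + 1) * n ^ k) k S ID SY LT) (U : Finset (Fin k)) (v : Feature α)
    {w : List α} (hw : 0 < w.length) {b : ℕ} (hbK : b ≤ K) (hb : mk.lag ≤ b)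
    (d : Fin k → Fin w.length) :
    attnFeature mk (fun n => (K + 1) * n ^ k) (agreeQuery ID U) (agreeKey ID) v w
        (padPos w (blockIndex b d)) =
      (∑ d' ∈ agreeing U d, v w (padPos w (blockIndex (b - mk.lag) d'))) /
        (agreeing U d).card := by
  classical
  set p : ℕ → ℕ := fun n => (K + 1) * n ^ k with hp
  set i := padPos w (blockIndex b d) with hi
  have hbi : blockIndex b d < p w.length := blockIndex_lt_of_le hbK d
  have hinj : Injective fun d' : Fin k → Fin w.length =>
      padPos w (blockIndex (b - mk.lag) d') := by
    intro d₁ d₂ h12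
    exact blockIndex_injective _ (Nat.add_left_cancel h12)
  have hunit : ∀ x x' j, j < seqLen p w → ∑ b, ID x b w i * ID x' b w j ≤ 1 := by
    intro x x' j hj
    rw [Fintype.sum_bool]
    exact (abs_le.1 (abs_dot_unit_le_one ((h.pointer x).unit w i (padPos_lt hbi))
      ((h.pointer x').unit w j hj))).2
  have hdot : ∀ x x' a', a' < p w.length → ∑ b, ID x b w i * ID x' b w (padPos w a') =
      dirDot ((slotValue mk x w (blockIndex b d) : ℕ) + 1) ((slotValue mk x' w a' : ℕ) + 1) := by
    intro x x' a' ha'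
    rw [Fintype.sum_bool, ← sum_code_mul_code]
    simp only [(h.pointer x).code w _ hbi, (h.pointer x').code w a' ha', hi]
  have hpad : ∀ a', (padFeature (α := α) w (padPos w a')) = 1 := fun a' =>
    if_pos (by unfold padPos; omega)
  have hs3 : slotValue mk (.inr 3 : Fin k ⊕ Fin 4) w (blockIndex b d) = b - mk.lag + 1 := by
    simp only [slotValue, blockIndex_div]
    omega
  have hs2 : ∀ a', slotValue mk (.inr 2 : Fin k ⊕ Fin 4) w a' = a' / w.length ^ k + 1 :=
    fun a' => rfl
  rw [attnFeature_eq_average (c := 1 + U.card)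
    (A := (agreeing U d).image fun d' => padPos w (blockIndex (b - mk.lag) d'))]
  · rw [Finset.sum_image fun x _ y _ hxy => hinj hxy, Finset.card_image_of_injective _ hinj]
  · intro j hj
    obtain ⟨d', _, rfl⟩ := Finset.mem_image.1 hj
    have hlt : blockIndex (b - mk.lag) d' < p w.length :=
      blockIndex_lt_of_le ((Nat.sub_le _ _).trans hbK) d'
    cases mk with
    | unmasked => exact Finset.mem_range.2 (padPos_lt hlt)
    | causal =>
      simp only [Masking.lag] at hb
      have h1 := blockIndex_lt (b - 1) d'
      rw [Nat.sub_add_cancel hb] at h1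
      have h2 : b * w.length ^ k ≤ blockIndex b d := Nat.le_add_right _ _
      simp only [Masking.visible, Masking.lag, Finset.mem_range, hi, padPos]
      omega
  · exact (Finset.image_nonempty).2 ⟨d, self_mem_agreeing U d⟩
  · intro j hj
    obtain ⟨d', hd', rfl⟩ := Finset.mem_image.1 hj
    have hlt : blockIndex (b - mk.lag) d' < p w.length :=
      blockIndex_lt_of_le ((Nat.sub_le _ _).trans hbK) d'
    rw [sum_agreeQuery_mul_agreeKey, hpad, hdot _ _ _ hlt, hs3, hs2, blockIndex_div, dirDot_self,
      Finset.sum_congr rfl (g := fun _ => (1 : ℝ))]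
    · simp
    · intro r hr
      have : (d' r : ℕ) = d r := by
        simp only [agreeing, Finset.mem_filter] at hd'
        rw [hd'.2 r hr]
      rw [hdot _ _ _ hlt]
      simp only [slotValue, blockIndex_digit, this, dirDot_self]
  · intro j hj hjA
    have hjN := lt_of_mem_visible (padPos_lt hbi) hj
    rw [sum_agreeQuery_mul_agreeKey]
    have h3 := hunit (.inr 3) (.inr 2) j hjN
    have hU : ∑ r ∈ U, ∑ b, ID (.inl r) b w i * ID (.inl r) b w j ≤ U.card := by
      refine (Finset.sum_le_card_nsmul _ _ 1 fun r _ => hunit _ _ j hjN).trans ?_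
      simp
    rcases lt_or_ge w.length j with hwj | hwj
    · obtain ⟨a', ha', rfl⟩ := exists_padPos_of_lt hjN hwj
      rw [hpad, sub_self, zero_add]
      by_cases hblock : a' / w.length ^ k = b - mk.lag
      · obtain ⟨d', hd'⟩ := exists_blockIndex (k := k) hw a'
        rw [hblock] at hd'
        subst hd'
        have hd'' : d' ∉ agreeing U d := fun h => hjA (Finset.mem_image_of_mem _ h)
        simp only [agreeing, Finset.mem_filter, Finset.mem_univ, true_and, not_forall] at hd''
        obtain ⟨r, hr, hne⟩ := hd''
        have hUlt : ∑ r ∈ U, ∑ x, ID (.inl r) x w i *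
            ID (.inl r) x w (padPos w (blockIndex (b - mk.lag) d')) < ∑ r ∈ U, (1 : ℝ) := by
          refine Finset.sum_lt_sum (fun r _ => hunit _ _ _ hjN) ⟨r, hr, ?_⟩
          rw [hdot _ _ _ ha']
          refine dirDot_lt_one fun heq => hne ?_
          simp only [slotValue, blockIndex_digit] at heq
          have : (d' r : ℕ) + 1 + 1 = d r + 1 + 1 := by exact_mod_cast heq
          exact Fin.ext (by omega)
        rw [Finset.sum_const, nsmul_eq_mul, mul_one] at hUlt
        linarith
      · have : ∑ x, ID (.inr 3) x w i * ID (.inr 2) x w (padPos w a') < 1 := by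
          rw [hdot _ _ _ ha']
          refine dirDot_lt_one fun heq => hblock ?_
          rw [hs3, hs2] at heq
          have : a' / w.length ^ k + 1 + 1 = b - mk.lag + 1 + 1 := by exact_mod_cast heq
          omega
        linarith
    · have hz : (padFeature : Feature α) w j = 0 := if_neg (by omega)
      rw [hz]
      linarith

/-- A small positive irrational number, different for each position, by which the values at the
thresholds are shifted, so that ties are impossible. -/
def offset : Feature α := fun _ i => 1 - unit₁ ((i : ℝ) + 1) 1

lemma offset_irrational (w : List α) (i : ℕ) : Irrational (offset w i) := by
  have := unit₁_natCast_irrational (i + 1) (by omega)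
  push_cast at this
  simpa [offset] using this.ratCast_sub 1

lemma offset_padPos_mem (w : List α) (a : ℕ) :
    0 < offset w (padPos w a) ∧ 2 * (w.length + 2 : ℝ) ^ 2 * offset w (padPos w a) ≤ 1 := by
  have h := one_sub_unit₁_mem (x := (padPos w a : ℝ) + 1) (by positivity)
  have hle : (w.length + 2 : ℝ) ≤ (padPos w a : ℝ) + 1 := by
    have : w.length + 2 ≤ padPos w a + 1 := by unfold padPos; omega
    exact_mod_cast this
  refine ⟨h.1, le_trans ?_ h.2⟩
  have := h.1.le
  unfold offset
  gcongr

/-- The rational part of the quantity whose sign is the truth value of a formula; `f` gives the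
averages of the truth values of the immediate subformulas. -/
def scoreBase (SY : Fin k ⊕ Fin 4 → α → Feature α)
    (LT : Fin k ⊕ Fin 4 → Fin k ⊕ Fin 4 → Feature α)
    (f : Bool → Feature α) : Formula α k → Feature α
  | .sym a s => SY s.slot a - (1 / 2 : ℚ) • 1
  | .eq s t => (1 / 2 : ℚ) • 1 - LT s.slot t.slot - LT t.slot s.slot
  | .le s t => (1 / 2 : ℚ) • 1 - LT t.slot s.slot
  | .ge s t => (1 / 2 : ℚ) • 1 - LT s.slot t.slot
  | .neg _ => (1 / 2 : ℚ) • 1 - f true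
  | .and _ _ => f true + f false - (3 / 2 : ℚ) • 1
  | .or _ _ => f true + f false - (1 / 2 : ℚ) • 1
  | .ex _ _ => f true
  | .all _ _ => f true - 1
  | .maj _ _ _ => f true - (1 / 2 : ℚ) • 1

/-- The sign of the shift. -/
def scoreSign : Formula α k → ℚ
  | .all _ _ => 1
  | _ => -1

lemma Assigned.scoreBase_mem (h : Assigned mk p k S ID SY LT) {f : Bool → Feature α}
    (hf : ∀ b, f b ∈ S) (Q : Formula α k) : scoreBase SY LT f Q ∈ S := by
  have h1 : ∀ q : ℚ, q • (1 : Feature α) ∈ S := fun q => S.smul_mem _ h.tokens.one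
  cases Q
  case sym a s => exact S.sub_mem ((h.pointer _).sym_mem a) (h1 _)
  case eq s t => exact S.sub_mem (S.sub_mem (h1 _) (h.lt_mem _ _)) (h.lt_mem _ _)
  case le s t => exact S.sub_mem (h1 _) (h.lt_mem _ _)
  case ge s t => exact S.sub_mem (h1 _) (h.lt_mem _ _)
  case neg => exact S.sub_mem (h1 _) (hf _)
  case and => exact S.sub_mem (S.add_mem (hf _) (hf _)) (h1 _)
  case or => exact S.sub_mem (S.add_mem (hf _) (hf _)) (h1 _)
  case ex => exact hf _
  case all => exact S.sub_mem (hf _) h.tokens.one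
  case maj => exact S.sub_mem (hf _) (h1 _)

/-- This holds at all tokens, not only at those where the averages are meaningful, so that the
shifted score vanishes nowhere. -/
lemma Assigned.scoreBase_rational (h : Assigned mk p k S ID SY LT) {f : Bool → Feature α}
    {w : List α} {i : ℕ} (hi : i < seqLen p w) (hf : ∀ b, ∃ x : ℚ, f b w i = x)
    (Q : Formula α k) : ∃ x : ℚ, scoreBase SY LT f Q w i = x := by
  obtain ⟨x, hx⟩ := hf true
  obtain ⟨y, hy⟩ := hf false
  cases Q
  case sym a s =>
    obtain ⟨z, hz⟩ := (h.pointer s.slot).sym_rational a w i hi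
    exact ⟨z - 1 / 2, by simp [scoreBase, hz, Rat.smul_def]⟩
  case eq s t =>
    obtain ⟨z, hz⟩ := h.lt_rational s.slot t.slot w i hi
    obtain ⟨z', hz'⟩ := h.lt_rational t.slot s.slot w i hi
    exact ⟨1 / 2 - z - z', by simp [scoreBase, hz, hz', Rat.smul_def]⟩
  case le s t =>
    obtain ⟨z, hz⟩ := h.lt_rational t.slot s.slot w i hi
    exact ⟨1 / 2 - z, by simp [scoreBase, hz, Rat.smul_def]⟩
  case ge s t =>
    obtain ⟨z, hz⟩ := h.lt_rational s.slot t.slot w i hi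
    exact ⟨1 / 2 - z, by simp [scoreBase, hz, Rat.smul_def]⟩
  case neg => exact ⟨1 / 2 - x, by simp [scoreBase, hx, Rat.smul_def]⟩
  case and => exact ⟨x + y - 3 / 2, by simp [scoreBase, hx, hy, Rat.smul_def]⟩
  case or => exact ⟨x + y - 1 / 2, by simp [scoreBase, hx, hy, Rat.smul_def]⟩
  case ex => exact ⟨x, hx⟩
  case all => exact ⟨x - 1, by simp [scoreBase, hx]⟩
  case maj => exact ⟨x - 1 / 2, by simp [scoreBase, hx, Rat.smul_def]⟩

open Classical in
/-- A formula is true exactly if its score is positive. -/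
lemma Assigned.score_pos_iff (h : Assigned mk p k S ID SY LT) (hk : 1 ≤ k) {f : Bool → Feature α}
    {w : List α} {b : ℕ} {d : Fin k → Fin w.length} (hbp : blockIndex b d < p w.length)
    (Q : Formula α k)
    (hf : ∀ x, (Q.child x).depth < Q.depth →
      f x w (padPos w (blockIndex b d)) =
      (∑ d' ∈ agreeing Q.kept d, (if (Q.child x).Holds w (values d') then 1 else 0 : ℝ)) /
        (agreeing Q.kept d).card) :
    0 < (scoreBase SY LT f Q + scoreSign Q • offset : Feature α) w (padPos w (blockIndex b d)) ↔
      Q.Holds w (values d) := by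
  have hn : 1 ≤ w.length := (Nat.zero_le _).trans_lt (d ⟨0, hk⟩).isLt
  have hn' : (1 : ℝ) ≤ w.length := by exact_mod_cast hn
  obtain ⟨ho, ho2⟩ := offset_padPos_mem w (blockIndex b d)
  have hsym := fun s : Index k => (h.pointer s.slot).sym w (blockIndex b d) hbp
  have hlt := fun s t : Index k => h.lt_spec s.slot t.slot w (blockIndex b d) hbp
  simp only [slotValue_slot] at hlt hsym
  simp only [Pi.add_apply, Pi.smul_apply, Rat.smul_def]
  set i := padPos w (blockIndex b d)
  set o : ℝ := offset w i
  set N : ℝ := (w.length : ℝ) ^ 2 with hN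
  have hN1 : 1 ≤ N := one_le_pow₀ hn'
  have hoN : 2 * N * o < 1 := by nlinarith
  have ho12 : 2 * o < 1 := by nlinarith
  have hfiber : ∀ {P : Formula α k} {i' j'} (g : ℝ),
      g = (∑ d' ∈ agreeing ((Finset.univ.erase i').erase j') d,
      (if P.Holds w (values d') then 1 else 0 : ℝ)) /
        (agreeing ((Finset.univ.erase i').erase j') d).card →
      g * N = (pairCount w P i' j' d : ℝ) := by
    intro P i' j' g hg
    rw [hg, average_holds_eq, div_mul_cancel₀ _ (by positivity)]
  cases Q
  case sym a s =>
    have : tokenAt w (s.val w.length (values d)) = Token.sym a ↔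
      (Formula.sym a s).Holds w (values d) := tokenAt_eq_sym_iff _ _ _
    rw [← this]
    simp only [scoreBase, scoreSign, Pi.sub_apply, Pi.smul_apply, Pi.one_apply, Rat.smul_def, hsym,
      tokenFeature]
    split_ifs with hc
    · simp only [hc, iff_true]; push_cast; linarith
    · simp only [hc, iff_false]; push_cast; linarith
  case eq s t =>
    simp only [scoreBase, scoreSign, Pi.sub_apply, Pi.smul_apply, Pi.one_apply, Rat.smul_def, hlt,
      Formula.Holds]
    rcases lt_trichotomy (s.val w.length (values d)) (t.val w.length (values d)) with hc | hc | hc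
    · simp only [if_pos hc, if_neg hc.not_gt, hc.ne, iff_false]; push_cast; linarith
    · simp only [hc, lt_irrefl, if_false, iff_true]; push_cast; linarith
    · simp only [if_pos hc, if_neg hc.not_gt, hc.ne', iff_false]; push_cast; linarith
  case le s t =>
    simp only [scoreBase, scoreSign, Pi.sub_apply, Pi.smul_apply, Pi.one_apply, Rat.smul_def, hlt,
      Formula.Holds]
    split_ifs with hc
    · simp only [hc.not_ge, iff_false]; push_cast; linarith
    · simp only [not_lt.1 hc, iff_true]; push_cast; linarith
  case ge s t =>
    simp only [scoreBase, scoreSign, Pi.sub_apply, Pi.smul_apply, Pi.one_apply, Rat.smul_def, hlt,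
      Formula.Holds]
    split_ifs with hc
    · simp only [hc.not_ge, iff_false]; push_cast; linarith
    · simp only [not_lt.1 hc, iff_true]; push_cast; linarith
  case neg P =>
    have h1 := hf true (by simp [Formula.child, Formula.depth])
    simp only [Formula.kept, Formula.child, agreeing_univ, Finset.sum_singleton,
      Finset.card_singleton, Nat.cast_one, div_one] at h1
    simp only [scoreBase, scoreSign, Pi.sub_apply, Pi.smul_apply, Pi.one_apply, Rat.smul_def, h1,
      Formula.Holds]
    split_ifs with hc
    · simp only [hc, not_true, iff_false]; push_cast; linarith
    · simp only [hc, not_false_iff, iff_true]; push_cast; linarith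
  case and P Q =>
    have h1 := hf true (by simp [Formula.child, Formula.depth])
    have h2 := hf false (by simp [Formula.child, Formula.depth])
    simp only [Formula.kept, Formula.child, agreeing_univ, Finset.sum_singleton,
      Finset.card_singleton, Nat.cast_one, div_one, if_true, Bool.false_eq_true, if_false] at h1 h2
    simp only [scoreBase, scoreSign, Pi.sub_apply, Pi.add_apply, Pi.smul_apply, Pi.one_apply,
      Rat.smul_def, h1, h2, Formula.Holds]
    split_ifs with hc hc' hc'
    · simp only [hc, hc', and_self, iff_true]; push_cast; linarith
    · simp only [hc', and_false, iff_false]; push_cast; linarith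
    · simp only [hc, false_and, iff_false]; push_cast; linarith
    · simp only [hc, false_and, iff_false]; push_cast; linarith
  case or P Q =>
    have h1 := hf true (by simp [Formula.child, Formula.depth])
    have h2 := hf false (by simp [Formula.child, Formula.depth])
    simp only [Formula.kept, Formula.child, agreeing_univ, Finset.sum_singleton,
      Finset.card_singleton, Nat.cast_one, div_one, if_true, Bool.false_eq_true, if_false] at h1 h2
    simp only [scoreBase, scoreSign, Pi.sub_apply, Pi.add_apply, Pi.smul_apply, Pi.one_apply,
      Rat.smul_def, h1, h2, Formula.Holds]
    split_ifs with hc hc' hc'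
    · simp only [hc, true_or, iff_true]; push_cast; linarith
    · simp only [hc, true_or, iff_true]; push_cast; linarith
    · simp only [hc', or_true, iff_true]; push_cast; linarith
    · simp only [hc, hc', or_self, iff_false]; push_cast; linarith
  case ex i' P =>
    have h1 : f true w i * N = pairCount w P i' i' d :=
      hfiber _ (hf true (by simp [Formula.child, Formula.depth]))
    rw [holds_ex_iff]
    simp only [scoreBase, scoreSign]
    constructor
    · intro hpos
      rw [Nat.pos_iff_ne_zero]
      intro hc
      rw [hc, Nat.cast_zero] at h1
      have : f true w i = 0 := (mul_eq_zero.1 h1).resolve_right (by positivity)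
      rw [this] at hpos
      push_cast at hpos
      linarith
    · intro hc
      have hc' : (1 : ℝ) ≤ pairCount w P i' i' d := by exact_mod_cast hc
      push_cast
      by_contra hle
      nlinarith
  case all i' P =>
    have h1 : f true w i * N = pairCount w P i' i' d :=
      hfiber _ (hf true (by simp [Formula.child, Formula.depth]))
    rw [holds_all_iff]
    simp only [scoreBase, scoreSign, Pi.sub_apply, Pi.one_apply]
    push_cast
    constructor
    · intro hpos
      refine le_antisymm (pairCount_le w P i' i' d) (not_lt.1 fun hc => ?_)
      have hc' : (pairCount w P i' i' d : ℝ) + 1 ≤ N := by rw [hN]; exact_mod_cast hc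
      nlinarith
    · intro hc
      have hc' : (pairCount w P i' i' d : ℝ) = N := by rw [hN]; exact_mod_cast hc
      have : f true w i = 1 := by
        rw [hc'] at h1
        exact mul_right_cancel₀ (by positivity : N ≠ 0) (by rw [h1, one_mul])
      rw [this]
      linarith
  case maj i' j' P =>
    have h1 : f true w i * N = pairCount w P i' j' d :=
      hfiber _ (hf true (by simp [Formula.child, Formula.depth]))
    rw [holds_maj_iff]
    simp only [scoreBase, scoreSign, Pi.sub_apply, Pi.smul_apply, Pi.one_apply, Rat.smul_def]
    push_cast
    constructor
    · intro hpos
      by_contra hc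
      have hc' : 2 * (pairCount w P i' j' d : ℝ) ≤ N := by
        rw [hN]; exact_mod_cast not_lt.1 hc
      nlinarith
    · intro hc
      have hc' : N + 1 ≤ 2 * (pairCount w P i' j' d : ℝ) := by rw [hN]; exact_mod_cast hc
      by_contra hle
      nlinarith

end Levels

/-! ### Evaluation of formulas by induction on the depth -/

section Evaluation

variable {α : Type u} {norm : NormKind} {mk : Masking} {p : ℕ → ℕ} {t : ℕ}

section Induction

variable {k : ℕ} {S : Submodule ℚ (Feature α)} {ID : Fin k ⊕ Fin 4 → Bool → Feature α}
  {SY : Fin k ⊕ Fin 4 → α → Feature α} {LT : Fin k ⊕ Fin 4 → Fin k ⊕ Fin 4 → Feature α}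

open Classical in
/-- The feature `T` stores the truth values of `Q` in the blocks up to number `K`, apart from the
first `ℓ` blocks in the case of causal masking. -/
def Evaluates (mk : Masking) (K ℓ : ℕ) (Q : Formula α k) (T : Feature α) : Prop :=
  ∀ (w : List α) (b : ℕ) (d : Fin k → Fin w.length), b ≤ K → mk.lag * ℓ ≤ b →
    T w (padPos w (blockIndex b d)) = if Q.Holds w (values d) then 1 else 0

lemma Formula.depth_pos (Q : Formula α k) : 0 < Q.depth := by
  cases Q <;> simp [Formula.depth]

/-- Three layers per level of the syntax tree evaluate finitely many formulas simultaneously: one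
to average over the assignments that matter, and two for the comparison with a threshold. -/
lemma Assigned.exists_reach_evaluates {K : ℕ} (hk : 1 ≤ k)
    (h : Assigned mk (fun n => (K + 1) * n ^ k) k S ID SY LT)
    (hS : Reach norm mk (fun n => (K + 1) * n ^ k) t S) (ℓ : ℕ) :
    ∀ (ι : Type) [Fintype ι] (Q : ι → Formula α k), ∃ S', S ≤ S' ∧
      Reach norm mk (fun n => (K + 1) * n ^ k) (t + 3 * ℓ) S' ∧
      ∃ T : ι → Feature α, ∀ x, T x ∈ S' ∧
        (∀ w i, i < seqLen (fun n => (K + 1) * n ^ k) w → T x w i = 0 ∨ T x w i = 1) ∧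
        ((Q x).depth ≤ ℓ → Evaluates mk K ℓ (Q x) (T x)) := by
  set p : ℕ → ℕ := fun n => (K + 1) * n ^ k with hp
  classical
  induction ℓ with
  | zero =>
    intro ι _ Q
    exact ⟨S, le_rfl, hS, 0, fun x => ⟨S.zero_mem, fun _ _ _ => Or.inl rfl,
      fun hx => absurd hx (Q x).depth_pos.not_ge⟩⟩
  | succ ℓ ih =>
    intro ι _ Q
    obtain ⟨S₁, hS₁, hR₁, T₁, hT₁⟩ := ih (ι × Bool) fun x => (Q x.1).child x.2
    have h₁ := h.mono hS₁
    have hid : ∀ x b, ID x b ∈ normableSpan p S₁ := fun x b => ((h₁.pointer x).normable b).mem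
    have hone := (normable_one (p := p) h₁.tokens.one).mem
    obtain ⟨S₂, hS₂, hR₂, hf⟩ := hR₁.attention h₁.tokens.one (η := ι × Bool)
      (Λ := Option (Option (Fin k) × Bool)) (Ω := Unit)
      (q := fun x => agreeQuery ID (Q x.1).kept) (k := fun _ => agreeKey ID)
      (v := fun x _ => T₁ x)
      (by
        rintro x (_ | ⟨_ | r, b⟩)
        · exact hone
        · exact hid _ _
        · simp only [agreeQuery]
          split_ifs
          exacts [hid _ _, Submodule.zero_mem _])
      (by
        rintro x (_ | ⟨_ | r, b⟩)
        · exact Submodule.sub_mem _ h₁.tokens.normable_pad.mem hone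
        · exact hid _ _
        · exact hid _ _)
      (fun x _ => (Normable.of_zero_or_one (hT₁ x).1 h₁.tokens.one (hT₁ x).2.1).mem)
    have h₂ := h₁.mono hS₂
    set f : ι → Bool → Feature α := fun x b =>
      attnFeature mk p (agreeQuery ID (Q x).kept) (agreeKey ID) (T₁ (x, b)) with hfdef
    have hfS : ∀ x b, f x b ∈ S₂ := fun x b => hf (x, b) ()
    have hoff : (offset : Feature α) ∈ S₂ := S₂.sub_mem h₂.tokens.one h₂.pos₁
    obtain ⟨S₃, hS₃, hR₃, T, hTS, hT⟩ := hR₂.threshold h₂.tokens.one h₂.tokens.bos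
      (a := fun x => scoreBase SY LT (f x) (Q x) + scoreSign (Q x) • offset)
      (fun x => S₂.add_mem (h₂.scoreBase_mem (hfS x) _) (S₂.smul_mem _ hoff))
    have hne : ∀ x w i, i < seqLen p w →
        (scoreBase SY LT (f x) (Q x) + scoreSign (Q x) • offset : Feature α) w i ≠ 0 := by
      intro x w i hi
      obtain ⟨r, hr⟩ := h₂.scoreBase_rational (f := f x) hi (fun b =>
        attnFeature_rational hi fun j hj => by
          rcases (hT₁ (x, b)).2.1 w j hj with h0 | h0
          · exact ⟨0, by simp [h0]⟩
          · exact ⟨1, by simp [h0]⟩) (Q x)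
      have hsign : scoreSign (Q x) ≠ 0 := by
        unfold scoreSign
        split <;> norm_num
      simp only [Pi.add_apply, Pi.smul_apply, Rat.smul_def, hr]
      exact (((offset_irrational w i).ratCast_mul hsign).ratCast_add r).ne_zero
    refine ⟨S₃, hS₁.trans (hS₂.trans hS₃), (by convert hR₃ using 1; omega), T, fun x =>
      ⟨hTS x, fun w i hi => (hT x w i hi (hne x w i hi)).1, fun hx w b d hbK hb => ?_⟩⟩
    have hw : 0 < w.length := (Nat.zero_le _).trans_lt (d ⟨0, hk⟩).isLt
    have hbp : blockIndex b d < p w.length := blockIndex_lt_of_le hbK d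
    rw [(hT x w _ (padPos_lt hbp) (hne x w _ (padPos_lt hbp))).2 (by unfold padPos; omega)]
    refine if_congr (h₂.score_pos_iff hk hbp (Q x) fun c hc => ?_) rfl rfl
    rw [mul_add, mul_one] at hb
    rw [hfdef]
    beta_reduce
    rw [h₂.attnFeature_eq (Q x).kept _ hw hbK (by omega) d]
    congr 1
    refine Finset.sum_congr rfl fun d' _ => ?_
    exact (hT₁ (x, c)).2.2 (Nat.le_of_lt_succ (hc.trans_le hx)) w _ d' (by omega) (by omega)

end Induction

/-! ### Sentences -/

lemma Index.val_congr {k : ℕ} (s : Index k) (n : ℕ) {v v' : Fin k → ℕ}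
    (h : ∀ r ∈ s.vars, v r = v' r) : s.val n v = s.val n v' := by
  cases s with
  | one => rfl
  | last => rfl
  | var r => exact h r (by simp [Index.vars])

lemma Formula.holds_congr {k : ℕ} (w : List α) (P : Formula α k) {v v' : Fin k → ℕ}
    (h : ∀ r ∈ P.freeVars, v r = v' r) : P.Holds w v ↔ P.Holds w v' := by
  classical
  induction P generalizing v v' with
  | sym a s => simp only [Formula.Holds, s.val_congr _ h]
  | eq s t =>
    simp only [Formula.freeVars, Finset.mem_union] at h
    simp only [Formula.Holds, s.val_congr _ fun r hr => h r (Or.inl hr),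
      t.val_congr _ fun r hr => h r (Or.inr hr)]
  | le s t =>
    simp only [Formula.freeVars, Finset.mem_union] at h
    simp only [Formula.Holds, s.val_congr _ fun r hr => h r (Or.inl hr),
      t.val_congr _ fun r hr => h r (Or.inr hr)]
  | ge s t =>
    simp only [Formula.freeVars, Finset.mem_union] at h
    simp only [Formula.Holds, s.val_congr _ fun r hr => h r (Or.inl hr),
      t.val_congr _ fun r hr => h r (Or.inr hr)]
  | neg P ih => exact not_congr (ih h)
  | and P Q ihP ihQ =>
    simp only [Formula.freeVars, Finset.mem_union] at h
    exact and_congr (ihP fun r hr => h r (Or.inl hr)) (ihQ fun r hr => h r (Or.inr hr))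
  | or P Q ihP ihQ =>
    simp only [Formula.freeVars, Finset.mem_union] at h
    exact or_congr (ihP fun r hr => h r (Or.inl hr)) (ihQ fun r hr => h r (Or.inr hr))
  | ex i P ih =>
    refine exists_congr fun m => and_congr_right fun _ => ih fun r hr => ?_
    rcases eq_or_ne r i with rfl | hi
    · simp
    · simpa [hi] using h r (Finset.mem_erase.2 ⟨hi, hr⟩)
  | all i P ih =>
    refine forall_congr' fun m => imp_congr_right fun _ => ih fun r hr => ?_
    rcases eq_or_ne r i with rfl | hi
    · simp
    · simpa [hi] using h r (Finset.mem_erase.2 ⟨hi, hr⟩)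
  | maj i j P ih =>
    have : ∀ m : ℕ × ℕ, P.Holds w (update (update v i m.1) j m.2) ↔
        P.Holds w (update (update v' i m.1) j m.2) := by
      refine fun m => ih fun r hr => ?_
      rcases eq_or_ne r j with rfl | hj
      · simp
      · rcases eq_or_ne r i with rfl | hi
        · simp [hj]
        · simpa [hi, hj] using
            h r (Finset.mem_erase.2 ⟨hj, Finset.mem_erase.2 ⟨hi, hr⟩⟩)
    simp only [Formula.Holds, this]

lemma Formula.IsSentence.mem_language_iff {k : ℕ} {P : Formula α k} (hP : P.IsSentence)
    (w : List α) (v : Fin k → ℕ) : w ∈ P.language ↔ P.Holds w v := by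
  constructor
  · exact fun h => h v
  · intro h v'
    refine (P.holds_congr w fun r hr => ?_).1 h
    rw [hP] at hr
    simp at hr

/-! ### The transformer -/

/-- Every available feature is the difference of the two logits of some transformer. -/
lemma Reach.exists_transformer {S : Submodule ℚ (Feature α)} (hS : Reach norm mk p t S)
    {f : Feature α} (hf : f ∈ S) : ∃ T : Transformer α, T.depth = t ∧
      ∀ w i, i < seqLen p w → ∀ φ : Prop, (φ → 0 < f w i) → (¬ φ → f w i < 0) →
        T.OutputsAt norm mk w (p w.length) i φ := by
  classical
  obtain ⟨ι, _, F, ⟨D₀, hD₀⟩, rfl⟩ := hS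
  obtain ⟨a, ha⟩ := hf
  obtain ⟨e, he⟩ : ∃ e : ι → Fin ((D₀ + Fintype.card ι) * (D₀ + Fintype.card ι)), Injective e := by
    have hcard : Fintype.card ι ≤ (D₀ + Fintype.card ι) * (D₀ + Fintype.card ι) :=
      (Nat.le_add_left _ _).trans (Nat.le_mul_self _)
    exact ⟨Fin.castLE hcard ∘ Fintype.equivFin ι,
      (Fin.castLE_injective hcard).comp (Fintype.equivFin ι).injective⟩
  obtain ⟨embed, pos, layers, hlen, hrun⟩ := hD₀ _ (Nat.le_add_right _ _) e he
  let T : Transformer α := ⟨_, embed, pos, layers, fun b r =>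
    if b then ∑ x, if e x = r then a x else 0 else 0⟩
  have hfalse : ∀ w i, T.logit norm mk w (p w.length) i false = 0 := by
    intro w i
    simp [Transformer.logit, T]
  have htrue : ∀ w i, i < seqLen p w → T.logit norm mk w (p w.length) i true = f w i := by
    intro w i hi
    have hfin : T.final norm mk w (p w.length) i = place e (fun x => F x w i) := hrun w i
    rw [Transformer.logit, hfin, ha w i hi]
    simp only [T, if_true, Rat.cast_sum, Finset.sum_mul]
    rw [Finset.sum_comm]
    refine Finset.sum_congr rfl fun x _ => ?_
    rw [Finset.sum_eq_single (e x)]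
    · rw [if_pos rfl, place_apply he]
    · intro r _ hr
      rw [if_neg hr.symm, Rat.cast_zero, zero_mul]
    · simp
  refine ⟨T, hlen, fun w i hi φ h1 h2 => ⟨fun h => ?_, fun h => ?_⟩⟩
  · rw [hfalse, htrue w i hi]
    exact h1 h
  · rw [hfalse, htrue w i hi]
    exact h2 h

/-- The transformer for `P` with `K + 1` blocks of padding tokens, which has the right output in
the last block as soon as there are enough blocks. -/
lemma exists_transformer_of_lag_le [Finite α] {k : ℕ} (hk : 1 ≤ k) (P : Formula α k) {K : ℕ}
    (hK : mk.lag * P.depth ≤ K) :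
    ∃ T : Transformer α, T.depth = setupDepth k + 3 * P.depth ∧
      T.ComputesFormula norm mk (fun n => (K + 1) * n ^ k) (fun n => K * n ^ k) P ∧
      (P.IsSentence → T.Recognizes norm mk (fun n => (K + 1) * n ^ k) P.language) := by
  classical
  obtain ⟨S₀, ID, SY, LT, hR₀, h₀⟩ :=
    exists_reach_assigned (α := α) (norm := norm) (mk := mk) hk K
  obtain ⟨S, hS, hR, V, hV⟩ := h₀.exists_reach_evaluates hk hR₀ P.depth Unit fun _ => P
  obtain ⟨hVS, hV₀₁, hVP⟩ := hV ()
  have h := h₀.mono hS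
  set p : ℕ → ℕ := fun n => (K + 1) * n ^ k with hp
  -- On the empty word there are no padding tokens, and the last token is the first one; the
  -- answer for this word is a constant added there.
  set ε : ℚ := if ([] : List α) ∈ P.language then 2 else -2 with hε
  obtain ⟨T, hT, hout⟩ := hR.exists_transformer (f := V () - (1 / 2 : ℚ) • 1 + ε • bosFeature)
    (S.add_mem (S.sub_mem hVS (S.smul_mem _ h.tokens.one)) (S.smul_mem _ h.tokens.bos))
  have hpad : ∀ (w : List α) (d : Fin k → Fin w.length), T.OutputsAt norm mk w (p w.length)
      (padPos w (blockIndex K d)) (P.Holds w (values d)) := by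
    intro w d
    have hval : (V () - (1 / 2 : ℚ) • 1 + ε • bosFeature : Feature α) w
        (padPos w (blockIndex K d)) = (if P.Holds w (values d) then 1 else 0) - 1 / 2 := by
      have hb : (bosFeature : Feature α) w (padPos w (blockIndex K d)) = 0 :=
        if_neg (by unfold padPos; omega)
      simp [Rat.smul_def, hb, hVP le_rfl w K d le_rfl hK]
    refine hout w _ (padPos_lt (blockIndex_lt K d)) _ (fun hφ => ?_) (fun hφ => ?_)
    · rw [hval, if_pos hφ]
      norm_num
    · rw [hval, if_neg hφ]
      norm_num
  refine ⟨T, hT, fun w d => ?_, fun hP w => ?_⟩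
  · have := hpad w d
    rwa [padPos, blockIndex, ← add_assoc, add_comm w.length 1] at this
  · rcases Nat.eq_zero_or_pos w.length with hw | hw
    · obtain rfl := List.eq_nil_of_length_eq_zero hw
      have hp0 : p 0 = 0 := by simp [hp, zero_pow (by omega : k ≠ 0)]
      have hlt : 0 < seqLen p ([] : List α) := by unfold seqLen; omega
      have hval : (V () - (1 / 2 : ℚ) • 1 + ε • bosFeature : Feature α) [] 0 =
          V () [] 0 - 1 / 2 + ε := by
        simp [Rat.smul_def, bosFeature]
      have hlast : ([] : List α).length + p ([] : List α).length = 0 := by simp [hp0]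
      rw [hlast]
      refine hout [] 0 hlt _ (fun hφ => ?_) (fun hφ => ?_)
      · rw [hval, hε, if_pos hφ]
        rcases hV₀₁ [] 0 hlt with h0 | h0 <;> rw [h0] <;> norm_num
      · rw [hval, hε, if_neg hφ]
        rcases hV₀₁ [] 0 hlt with h0 | h0 <;> rw [h0] <;> norm_num
    · have hpos : 0 < w.length ^ k := by positivity
      -- the last token stores the assignment that maps all variables to `n`
      obtain ⟨d, hd⟩ := exists_blockIndex (k := k) hw (p w.length - 1)
      have hpK : p w.length - 1 = w.length ^ k * K + (w.length ^ k - 1) := by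
        have : p w.length = w.length ^ k * K + w.length ^ k := by rw [hp]; ring
        omega
      have hdiv : (p w.length - 1) / w.length ^ k = K := by
        rw [hpK, Nat.mul_add_div hpos, Nat.div_eq_of_lt (by omega), add_zero]
      rw [hdiv] at hd
      have hlast : w.length + p w.length = padPos w (blockIndex K d) := by
        have : 0 < p w.length := Nat.mul_pos (by omega) hpos
        rw [← hd, padPos]
        omega
      have := hpad w d
      rw [← hP.mem_language_iff w (values d)] at this
      rwa [hlast]

end Evaluation

end PaddedAHAT

end

theorem mainTheorem5 :
    ∃ C : ℕ, ∀ k : ℕ, 1 ≤ k → ∃ c : ℕ,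
      ∀ (norm : PaddedAHAT.NormKind) (α : Type u) [Finite α] (P : PaddedAHAT.Formula α k),
        (∃ T : PaddedAHAT.Transformer α,
          T.depth ≤ C * P.depth + c ∧
          T.ComputesFormula norm .unmasked (fun n => n ^ k) (fun _ => 0) P ∧
          (P.IsSentence → T.Recognizes norm .unmasked (fun n => n ^ k) P.language)) ∧
        (∃ (T : PaddedAHAT.Transformer α) (K : ℕ),
          T.depth ≤ C * P.depth + c ∧
          T.ComputesFormula norm .causal (fun n => (K + 1) * n ^ k) (fun n => K * n ^ k) P ∧
          (P.IsSentence →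
            T.Recognizes norm .causal (fun n => (K + 1) * n ^ k) P.language)) := by
  refine ⟨3, fun k hk => ⟨PaddedAHAT.setupDepth k, fun norm α _ P => ⟨?_, ?_⟩⟩⟩
  · obtain ⟨T, hT, hcomp, hrec⟩ := PaddedAHAT.exists_transformer_of_lag_le (norm := norm)
      (mk := .unmasked) hk P (K := 0) (by simp [PaddedAHAT.Masking.lag])
    simp only [zero_add, one_mul, zero_mul] at hcomp hrec
    exact ⟨T, by omega, hcomp, hrec⟩
  · obtain ⟨T, hT, hcomp, hrec⟩ := PaddedAHAT.exists_transformer_of_lag_le (norm := norm)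
      (mk := .causal) hk P (K := P.depth) (by simp [PaddedAHAT.Masking.lag])
    exact ⟨T, P.depth, by omega, hcomp, hrec⟩
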